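/- Notation. Fix an algebraic closure $\overline{\mathbb Q}$ of $\mathbb Q$ and put $G_{\mathbb Q}=\mathrm{Gal}(\overline{\mathbb Q}/\mathbb Q)$. For an elliptic curve $E/\mathbb Q$ and a number field $K\subset\overline{\mathbb Q}$ let $$\mathrm{BSD}(E/K)=\frac{\mathrm{Reg}_{E/K}\,|Ш_{E/K}|\,C_{E/K}}{|E(K)_{\mathrm{tors}}|^2},\qquad C_{E/K}=\prod_{v\nmid\infty}c_v(E/K)\,\Bigl|\frac{\omega}{\omega_v^{\min}}\Bigr|_v ,$$ where $\mathrm{Reg}_{E/K}$ is the regulator of the Néron--Tate height pairing relative to $K$ (not normalised by $[K:\mathbb Q]$), $c_v$ are the local Tamagawa numbers, $\omega$ is a global minimal differential of $E/\mathbb Q$, $\omega_v^{\min}$ is a minimal differential of $E/K_v$, and $|\cdot|_v$ is the normalised absolute value. An Artin representation is a finite-dimensional complex representation of $G_{\mathbb Q}$ with open kernel; $\mathbb Q(\rho)\subset\mathbb C$ is the field generated by the values of the character of $\rho$, and for $\mathfrak g\in\mathrm{Gal}(\mathbb Q(\rho)/\mathbb Q)$, $\rho^{\mathfrak g}$ is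 the Artin representation with character $\mathfrak g\circ\mathrm{Tr}\,\rho$. Hypothesis (BSD$_E$). There is an invariant $\mathrm{BSD}(E,\rho)\in\mathbb C^\times$ of (isomorphism classes of) Artin representations $\rho$ such that: 1. for every number field $K\subset\overline{\mathbb Q}$, $Ш_{E/K}$ is finite and $\mathrm{BSD}(E/K)=\mathrm{BSD}(E,\mathrm{Ind}_{K/\mathbb Q}\mathbf 1)$; 2. $\mathrm{BSD}(E,\rho\oplus\tau)=\mathrm{BSD}(E,\rho)\,\mathrm{BSD}(E,\tau)$; 3. if $\rho$ factors through $\mathrm{Gal}(K/\mathbb Q)$ with $K/\mathbb Q$ finite Galois and $\langle\rho,E(K)\otimes\mathbb C\rangle=0$, then $\mathrm{BSD}(E,\rho)\in\mathbb Q(\rho)^\times$ and $\mathrm{BSD}(E,\rho^{\mathfrak g})=\mathrm{BSD}(E,\rho)^{\mathfrak g}$ for all $\mathfrak g\in\mathrm{Gal}(\mathbb Q(\rho)/\mathbb Q)$; 4. if in addition $\rho$ is one-dimensional and non-trivial (a non-trivial primitive Dirichlet character), of order $d$, and either the conductors of $E$ and $\rho$ are coprime or $E$ is semistable and has no non-trivial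 isogenies over $\mathbb Q$, then $\mathrm{BSD}(E,\rho)\in\mathbb Z[\zeta_d]$. Theorem. Let $\ell$ and $p$ be primes such that the primes above $p$ in $\mathbb Q(\zeta_\ell)$ are non-principal and have residue degree $2$. Let $E/\mathbb Q$ be a semistable elliptic curve with no non-trivial isogenies over $\mathbb Q$ (every finite Galois-stable subgroup of $E(\overline{\mathbb Q})$ is $E[n]$ for some $n\ge 1$), with $|Ш_{E/\mathbb Q}[p]|=1$ and $c_v(E/\mathbb Q)=1$ for all rational primes $v$, and suppose that (BSD$_E$) holds. Then for every cyclic extension $F/\mathbb Q$ of degree $\ell$ inside $\overline{\mathbb Q}$ with $E(F)=E(\mathbb Q)$: if $|Ш_{E/F}[p^\infty]|=p^2$, then $|Ш_{E/F}[q^\infty]|\neq 1$ for some prime $q\neq p,\ell$. -/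

import Mathlib

open scoped NumberField Topology TensorProduct
open IsDedekindDomain

namespace ArtinBSD

noncomputable section

/-! ### Points -/

/-- The group `W(k)` of (non-singular) `k`-rational points. -/
def Points {k : Type*} [Field k] (W : WeierstrassCurve k) : Type _ := W.toAffine.Point

open scoped Classical in
instance {k : Type*} [Field k] (W : WeierstrassCurve k) : AddCommGroup (Points W) :=
  inferInstanceAs (AddCommGroup W.toAffine.Point)

/-- The points of `W` over an extension `L` of `K`. -/
abbrev Pts {K : Type*} [Field K] (W : WeierstrassCurve K) (L : Type*) [Field L] [Algebra K L] :
    Type _ := Points (W.baseChange L)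

open scoped Classical in
/-- The map on points induced by a `K`-homomorphism of fields. -/
def ptsMap {K : Type*} [Field K] (W : WeierstrassCurve K) {L M : Type*} [Field L] [Algebra K L]
    [Field M] [Algebra K M] (f : L →ₐ[K] M) : Pts W L →+ Pts W M :=
  WeierstrassCurve.Affine.Point.map (W' := W) f

theorem ptsMap_id {K : Type*} [Field K] (W : WeierstrassCurve K) {L : Type*} [Field L]
    [Algebra K L] : ptsMap W ((1 : Gal(L/K)) : L →ₐ[K] L) = AddMonoidHom.id (Pts W L) := by
  ext P
  cases P <;> rfl

theorem ptsMap_comp {K : Type*} [Field K] (W : WeierstrassCurve K) {L : Type*} [Field L]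
    [Algebra K L] (σ τ : Gal(L/K)) :
    ptsMap W ((σ * τ : Gal(L/K)) : L →ₐ[K] L) =
      (ptsMap W (σ : L →ₐ[K] L)).comp (ptsMap W (τ : L →ₐ[K] L)) := by
  ext P
  cases P <;> rfl

/-! ### Elliptic curves over the fraction field of a discrete valuation ring -/

section Local

variable (R : Type*) [CommRing R] [IsDomain R] [IsDiscreteValuationRing R]
variable {k : Type*} [Field k] [Algebra R k] [IsFractionRing R k]

/-- The set `E₀(k)` of points with non-singular reduction on a minimal Weierstrass equation.
A point whose `x`-coordinate is not integral reduces to the point at infinity. -/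
def nonsingularReductionSet (W : WeierstrassCurve k) [W.IsMinimal R] : Set (Points W) :=
  {P | ∀ (x y : k) (h : W.toAffine.Nonsingular x y), P = (.some x y h : W.toAffine.Point) →
    x ∉ Set.range (algebraMap R k) ∨
      ∃ a b : R, algebraMap R k a = x ∧ algebraMap R k b = y ∧
        (W.reduction R).toAffine.Nonsingular (IsLocalRing.residue R a) (IsLocalRing.residue R b)}

/-- The local Tamagawa number `[E(k) : E₀(k)]`, computed on a minimal Weierstrass equation.
(`E₀(k)` is a subgroup, so taking the subgroup it generates changes nothing.) -/
def localTamagawa (W : WeierstrassCurve k) : ℕ :=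
  (AddSubgroup.closure (nonsingularReductionSet R (W.minimal R))).index

/-- The scalar `u` with `ω_min = u • ω_W`, where `ω_W = dx / (2y + a₁x + a₃)` is the invariant
differential of the equation `W` and `ω_min` is that of the minimal equation `W.minimal R`:
a change of variables `x = u²x' + r`, `y = u³y' + u²sx' + t` gives `ω' = u • ω`. -/
def minimalScale (W : WeierstrassCurve k) : kˣ :=
  (W.exists_isMinimal R).choose.u

/-- Good reduction (of a minimal equation). -/
def HasGoodRed (W : WeierstrassCurve k) : Prop :=
  (W.minimal R).HasGoodReduction R

/-- Good or multiplicative reduction (of a minimal equation). -/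
def HasSemistableRed (W : WeierstrassCurve k) : Prop :=
  (W.minimal R).HasGoodReduction R ∨ (W.minimal R).HasMultiplicativeReduction R

end Local

/-! ### Elliptic curves over a number field: finite places -/

section Global

variable {K : Type*} [Field K] [NumberField K]

/-- The base change of `W` to the completion `K_v`. -/
abbrev atPlace (W : WeierstrassCurve K) (v : HeightOneSpectrum (𝓞 K)) :
    WeierstrassCurve (v.adicCompletion K) :=
  W.baseChange (v.adicCompletion K)

/-- The Tamagawa number `c_v(W/K)`. -/
def tamagawa (W : WeierstrassCurve K) (v : HeightOneSpectrum (𝓞 K)) : ℕ :=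
  localTamagawa (v.adicCompletionIntegers K) (atPlace W v)

/-- Good or multiplicative reduction at all finite places. -/
def IsSemistable (W : WeierstrassCurve K) : Prop :=
  ∀ v : HeightOneSpectrum (𝓞 K), HasSemistableRed (v.adicCompletionIntegers K) (atPlace W v)

/-- The normalised absolute value at `v` of the scalar `ω_v^min / ω_W`. -/
def minimalScaleAbs (W : WeierstrassCurve K) (v : HeightOneSpectrum (𝓞 K)) : ℝ :=
  ‖(minimalScale (v.adicCompletionIntegers K) (atPlace W v) : v.adicCompletion K)‖

/-- `c • ω_E` is a global minimal differential of `E/ℚ`: it is a minimal differential at every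
prime. -/
def IsGlobalMinimalScale (E : WeierstrassCurve ℚ) (c : ℚ) : Prop :=
  c ≠ 0 ∧ ∀ p : HeightOneSpectrum (𝓞 ℚ),
    ‖algebraMap ℚ (p.adicCompletion ℚ) c‖ = minimalScaleAbs E p

/-- A scalar `c` such that `c • ω_E` is a global minimal differential of `E/ℚ`. It exists because
`ℤ` is a principal ideal domain, and is unique up to sign. -/
def globalMinimalScale (E : WeierstrassCurve ℚ) : ℚ :=
  Classical.epsilon (IsGlobalMinimalScale E)

variable (K) in
/-- `C_{E/K} = ∏_v c_v(E/K) |ω / ω_v^min|_v`, over the finite places `v` of `K`, where `ω` is a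
global minimal differential of `E/ℚ`. -/
def localFactor (E : WeierstrassCurve ℚ) [Algebra ℚ K] : ℝ :=
  ∏ᶠ v : HeightOneSpectrum (𝓞 K),
    (tamagawa (E.baseChange K) v : ℝ) *
      (‖algebraMap K (v.adicCompletion K) (algebraMap ℚ K (globalMinimalScale E))‖ /
        minimalScaleAbs (E.baseChange K) v)

/-! ### Heights and the regulator -/

/-- The naive height `h_K(x(P))`, relative to `K` (not divided by the degree of `K`). -/
def naiveHeight (W : WeierstrassCurve K) : Points W → ℝ
  | .zero => 0
  | .some x _ _ => Height.logHeight₁ x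

/-- The Néron–Tate height `ĥ_K(P) = ½ lim 4⁻ⁿ h_K(x(2ⁿP))`. -/
def canonicalHeight (W : WeierstrassCurve K) (P : Points W) : ℝ :=
  (1 / 2) * Filter.limUnder Filter.atTop fun n : ℕ => naiveHeight W (2 ^ n • P) / 4 ^ n

/-- The Néron–Tate height pairing over `K`; `⟨P, P⟩ = 2 ĥ_K(P)`. -/
def heightPairing (W : WeierstrassCurve K) (P Q : Points W) : ℝ :=
  canonicalHeight W (P + Q) - canonicalHeight W P - canonicalHeight W Q

/-- The classes of the `P i` form a `ℤ`-basis of `W(K)` modulo torsion. -/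
def IsMordellWeilBasis (W : WeierstrassCurve K) {r : ℕ} (P : Fin r → Points W) : Prop :=
  ∀ Q : Points W, ∃! n : Fin r → ℤ,
    Q - ∑ i, n i • P i ∈ AddCommGroup.torsion (Points W)

/-- The regulator: the absolute value of the determinant of the height pairing on a basis of `W(K)`
modulo torsion. It does not depend on the basis, so the set below has exactly one element. -/
def regulator (W : WeierstrassCurve K) : ℝ :=
  sInf {x | ∃ (r : ℕ) (P : Fin r → Points W), IsMordellWeilBasis W P ∧
    x = |(Matrix.of fun i j => heightPairing W (P i) (P j)).det|}

/-- The order of the torsion subgroup of `W(K)`. -/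
def torsionOrder (W : WeierstrassCurve K) : ℕ :=
  Nat.card (AddCommGroup.torsion (Points W))

end Global

/-! ### The Tate–Shafarevich group -/

section Sha

variable {K : Type*} [Field K] (W : WeierstrassCurve K)

variable (Ω : Type*) [Field Ω] [Algebra K Ω]

/-- Continuous `1`-cocycles of `Gal(Ω/K)` with values in the discrete module `W(Ω)`. -/
def cocycles : AddSubgroup (Gal(Ω/K) → Pts W Ω) where
  carrier := {c | IsLocallyConstant c ∧
    ∀ σ τ : Gal(Ω/K), c (σ * τ) = c σ + ptsMap W (σ : Ω →ₐ[K] Ω) (c τ)}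
  zero_mem' := ⟨IsLocallyConstant.const 0, fun σ τ => by simp⟩
  add_mem' := by
    rintro a b ⟨ha, ha'⟩ ⟨hb, hb'⟩
    refine ⟨ha.add hb, fun σ τ => ?_⟩
    simp only [Pi.add_apply, ha' σ τ, hb' σ τ, map_add]
    abel
  neg_mem' := by
    rintro a ⟨ha, ha'⟩
    refine ⟨ha.neg, fun σ τ => ?_⟩
    simp only [Pi.neg_apply, ha' σ τ, map_neg]
    abel

/-- `1`-coboundaries `σ ↦ σP - P`. -/
def coboundaries : AddSubgroup (Gal(Ω/K) → Pts W Ω) where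
  carrier := {c | ∃ P : Pts W Ω, ∀ σ : Gal(Ω/K), c σ = ptsMap W (σ : Ω →ₐ[K] Ω) P - P}
  zero_mem' := ⟨0, fun σ => by simp⟩
  add_mem' := by
    rintro a b ⟨P, hP⟩ ⟨Q, hQ⟩
    refine ⟨P + Q, fun σ => ?_⟩
    simp only [Pi.add_apply, hP σ, hQ σ, map_add]
    abel
  neg_mem' := by
    rintro a ⟨P, hP⟩
    refine ⟨-P, fun σ => ?_⟩
    simp only [Pi.neg_apply, hP σ, map_neg]
    abel

/-- Functions on `Gal(Ω/K)` whose restriction to the absolute Galois group of an extension `L` of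
`K` is a coboundary in `W(L̄)`. Here an embedding `ι : Ω → L̄` over `K` identifies `σ ∈ Gal(L̄/L)`
with its restriction `τ ∈ Gal(Ω/K)`, i.e. the `τ` with `σ ∘ ι = ι ∘ τ`. -/
def locallyTrivial (L : Type*) [Field L] [Algebra K L] :
    AddSubgroup (Gal(Ω/K) → Pts W Ω) where
  carrier := {c | ∀ ι : Ω →ₐ[K] AlgebraicClosure L, ∃ P : Pts W (AlgebraicClosure L),
    ∀ (σ : Gal(AlgebraicClosure L/L)) (τ : Gal(Ω/K)), (∀ x : Ω, σ (ι x) = ι (τ x)) →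
      ptsMap W ι (c τ) =
        ptsMap W ((σ : AlgebraicClosure L →ₐ[L] AlgebraicClosure L).restrictScalars K) P - P}
  zero_mem' := fun ι => ⟨0, fun σ τ _ => by simp⟩
  add_mem' := by
    intro a b ha hb ι
    obtain ⟨P, hP⟩ := ha ι
    obtain ⟨Q, hQ⟩ := hb ι
    refine ⟨P + Q, fun σ τ h => ?_⟩
    simp only [Pi.add_apply, map_add, hP σ τ h, hQ σ τ h]
    abel
  neg_mem' := by
    intro a ha ι
    obtain ⟨P, hP⟩ := ha ι
    refine ⟨-P, fun σ τ h => ?_⟩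
    simp only [Pi.neg_apply, map_neg, hP σ τ h]
    abel

/-- Continuous cocycles that become trivial in `H¹(K_v, W)` for all finite and infinite places. -/
def shaCocycles [NumberField K] : AddSubgroup (Gal(Ω/K) → Pts W Ω) :=
  cocycles W Ω ⊓ (⨅ v : HeightOneSpectrum (𝓞 K), locallyTrivial W Ω (v.adicCompletion K)) ⊓
    (⨅ v : NumberField.InfinitePlace K, locallyTrivial W Ω v.Completion)

/-- The Tate–Shafarevich group `ker (H¹(K, W) → ∏_v H¹(K_v, W))`, where `Ω` is an algebraic closure
of `K`. -/
abbrev Sha [NumberField K] : Type _ :=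
  shaCocycles W Ω ⧸ (coboundaries W Ω).addSubgroupOf (shaCocycles W Ω)

end Sha

/-! ### The Birch–Swinnerton-Dyer quotient -/

/-- The fixed algebraic closure of `ℚ`. -/
abbrev QBar : Type := AlgebraicClosure ℚ

instance : IsAlgClosure ℚ QBar := by
  have h : (DivisionRing.toRatAlgebra : Algebra ℚ QBar) =
      AlgebraicClosure.instAlgebra (R := ℚ) ℚ := Subsingleton.elim _ _
  rw [h]
  infer_instance

/-- The absolute Galois group of `ℚ`. -/
abbrev GQ : Type := Gal(QBar/ℚ)

/-- The Tate–Shafarevich group of `E/K`, for a number field `K` embedded in `ℚ̄`. -/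
abbrev ShaOver (E : WeierstrassCurve ℚ) (K : Type) [Field K] [NumberField K] [Algebra ℚ K]
    [Algebra K QBar] : Type :=
  Sha (E.baseChange K) QBar

/-- `BSD(E/K) = Reg_{E/K} |Ш_{E/K}| C_{E/K} / |E(K)_tors|²`. -/
def bsdQuotient (E : WeierstrassCurve ℚ) (K : Type) [Field K] [NumberField K] [Algebra ℚ K]
    [Algebra K QBar] : ℝ :=
  regulator (E.baseChange K) * (Nat.card (ShaOver E K) : ℝ) * localFactor K E /
    (torsionOrder (E.baseChange K) : ℝ) ^ 2

/-! ### Artin representations over `ℚ` -/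

/-- An Artin representation over `ℚ`: a finite-dimensional complex representation of the absolute
Galois group with open kernel. -/
structure ArtinRep where
  /-- The underlying space. -/
  V : Type
  [instAddCommGroup : AddCommGroup V]
  [instModule : Module ℂ V]
  [instFinite : FiniteDimensional ℂ V]
  /-- The action. -/
  rep : Representation ℂ GQ V
  isOpen_ker : IsOpen (rep.ker : Set GQ)

attribute [instance] ArtinRep.instAddCommGroup ArtinRep.instModule ArtinRep.instFinite

namespace ArtinRep

/-- Isomorphism of Artin representations. -/
def Iso (ρ τ : ArtinRep) : Prop := Nonempty (ρ.rep.Equiv τ.rep)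

/-- The direct sum. -/
def sum (ρ τ : ArtinRep) : ArtinRep where
  V := ρ.V × τ.V
  rep := ρ.rep.prod τ.rep
  isOpen_ker := by
    refine Subgroup.isOpen_mono (H₁ := ρ.rep.ker ⊓ τ.rep.ker) ?_
      (ρ.isOpen_ker.inter τ.isOpen_ker)
    intro g hg
    obtain ⟨h1, h2⟩ := Subgroup.mem_inf.1 hg
    rw [MonoidHom.mem_ker] at h1 h2 ⊢
    ext <;> simp [Representation.prod, h1, h2]

/-- The field `ℚ(ρ)` generated by the values of the character. -/
def charField (ρ : ArtinRep) : IntermediateField ℚ ℂ :=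
  IntermediateField.adjoin ℚ (Set.range ρ.rep.character)

/-- The value of the character as an element of `ℚ(ρ)`. -/
def charVal (ρ : ArtinRep) (g : GQ) : ρ.charField :=
  ⟨ρ.rep.character g, IntermediateField.subset_adjoin ℚ _ ⟨g, rfl⟩⟩

/-- `ρ` is unramified at the prime `p`: the inertia groups above `p` act trivially. -/
def IsUnramifiedAt (ρ : ArtinRep) (p : HeightOneSpectrum (𝓞 ℚ)) : Prop :=
  ∀ P : Ideal (𝓞 QBar), P.IsPrime → P.under (𝓞 ℚ) = p.asIdeal →
    ∀ σ : GQ, (∀ x y : 𝓞 QBar, (y : QBar) = σ (x : QBar) → y - x ∈ P) → σ ∈ ρ.rep.ker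

end ArtinRep

section Ind

variable (K : Type) [Field K] [NumberField K] [Algebra K QBar]

/-- The absolute Galois group of a number field `K` embedded in `ℚ̄`, as a subgroup of `GQ`. -/
def absGal : Subgroup GQ where
  carrier := {σ | ∀ x : K, σ (algebraMap K QBar x) = algebraMap K QBar x}
  one_mem' := fun x => by simp
  mul_mem' := fun {a b} ha hb x => by rw [AlgEquiv.mul_apply, hb x, ha x]
  inv_mem' := fun {a} ha x => by
    rw [AlgEquiv.aut_inv, AlgEquiv.symm_apply_eq]; exact (ha x).symm

theorem isOpen_absGal : IsOpen (absGal K : Set GQ) := by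
  let f : K →ₐ[ℚ] QBar := (algebraMap K QBar).toRatAlgHom
  have : FiniteDimensional ℚ f.fieldRange :=
    LinearEquiv.finiteDimensional (AlgEquiv.ofInjectiveField f).toLinearEquiv
  convert f.fieldRange.fixingSubgroup_isOpen using 1
  ext σ
  simp only [SetLike.mem_coe, IntermediateField.mem_fixingSubgroup_iff, AlgHom.mem_fieldRange]
  constructor
  · rintro h _ ⟨x, rfl⟩
    exact h x
  · intro h x
    exact h _ ⟨x, rfl⟩

instance : Finite (GQ ⧸ absGal K) :=
  have : IsGalois ℚ QBar := IsAlgClosure.isGalois ℚ QBar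
  Subgroup.quotient_finite_of_isOpen _ (isOpen_absGal K)

/-- `Ind_{K/ℚ} 𝟏`: the permutation representation of `GQ` on the cosets of the absolute Galois
group of `K`. -/
def indTrivial : ArtinRep where
  V := MonoidAlgebra ℂ (GQ ⧸ absGal K)
  instFinite := LinearEquiv.finiteDimensional
    (MonoidAlgebra.coeffLinearEquiv ℂ (M := GQ ⧸ absGal K)).symm
  rep := Representation.ofMulAction ℂ GQ (GQ ⧸ absGal K)
  isOpen_ker := by
    have hfi : (absGal K).FiniteIndex := Subgroup.finiteIndex_of_finite_quotient
    have hopen : IsOpen ((absGal K).normalCore : Set GQ) := by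
      refine Subgroup.isOpen_of_isClosed_of_finiteIndex _ ?_
      exact Subgroup.normalCore_isClosed _ (Subgroup.isClosed_of_isOpen _ (isOpen_absGal K))
    refine Subgroup.isOpen_mono ?_ hopen
    intro g hg
    rw [Subgroup.normalCore_eq_ker, MonoidHom.mem_ker] at hg
    rw [MonoidHom.mem_ker]
    have hg' : ∀ x : GQ ⧸ absGal K, g • x = x := fun x => by
      simpa using congrArg (fun f => f x) hg
    ext x
    simp [hg']

end Ind

/-! ### The Mordell–Weil representation -/

section MordellWeil

/-- The endomorphism of `ℂ ⊗ M` induced by an endomorphism of an abelian group `M`. -/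
def tensorEnd (M : Type*) [AddCommGroup M] : AddMonoid.End M →* Module.End ℂ (ℂ ⊗[ℤ] M) where
  toFun f := LinearMap.baseChange ℂ (AddMonoidHom.toIntLinearMap f)
  map_one' := LinearMap.baseChange_id
  map_mul' f g :=
    LinearMap.baseChange_comp (AddMonoidHom.toIntLinearMap g) (AddMonoidHom.toIntLinearMap f)

/-- The action of `Gal(L/ℚ)` on `E(L)`. -/
def pointsAction (E : WeierstrassCurve ℚ) (L : Type) [Field L] [Algebra ℚ L] :
    Gal(L/ℚ) →* AddMonoid.End (Pts E L) where
  toFun σ := ptsMap E (σ : L →ₐ[ℚ] L)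
  map_one' := ptsMap_id E
  map_mul' σ τ := ptsMap_comp E σ τ

/-- The action of `GQ` on `ℂ ⊗ E(K)` through `Gal(K/ℚ)`, for `K/ℚ` normal. -/
def mordellWeilRep (E : WeierstrassCurve ℚ) (K : IntermediateField ℚ QBar) [Normal ℚ K] :
    Representation ℂ GQ (ℂ ⊗[ℤ] Pts E K) :=
  (tensorEnd (Pts E K)).comp ((pointsAction E K).comp (AlgEquiv.restrictNormalHom K))

/-- The multiplicity `⟨ρ, E(K)_ℂ⟩ = dim Hom_{GQ}(ρ, ℂ ⊗ E(K))`. -/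
def multiplicity (ρ : ArtinRep) (E : WeierstrassCurve ℚ) (K : IntermediateField ℚ QBar)
    [Normal ℚ K] : Cardinal.{0} :=
  Module.rank ℂ (ρ.rep.IntertwiningMap (mordellWeilRep E K))

/-- `E/ℚ` has no non-trivial isogenies over `ℚ`. An isogeny over `ℚ` is determined, up to
isomorphism of its target, by its kernel, and the kernels are exactly the finite Galois-stable
subgroups of `E(ℚ̄)`; the trivial isogenies are those with the kernel of some multiplication by
`n`. -/
def HasNoIsogenies (E : WeierstrassCurve ℚ) : Prop :=
  ∀ C : AddSubgroup (Pts E QBar), Finite C →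
    (∀ (σ : GQ) (P : Pts E QBar), P ∈ C → ptsMap E (σ : QBar →ₐ[ℚ] QBar) P ∈ C) →
    ∃ n : ℕ, 0 < n ∧ ∀ P : Pts E QBar, P ∈ C ↔ n • P = 0

/-- `E(F) = E(ℚ)`. -/
def NoNewPoints (E : WeierstrassCurve ℚ) (F : Type) [Field F] [Algebra ℚ F] : Prop :=
  Function.Surjective (ptsMap E (Algebra.ofId ℚ F))

end MordellWeil

/-- The conductors of `E` and `ρ` have no common prime factor: at every prime `E` has good reduction
or `ρ` is unramified. -/
def ConductorsCoprime (E : WeierstrassCurve ℚ) (ρ : ArtinRep) : Prop :=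
  ∀ p : HeightOneSpectrum (𝓞 ℚ),
    HasGoodRed (p.adicCompletionIntegers ℚ) (atPlace E p) ∨ ρ.IsUnramifiedAt p

/-- `B` is an invariant `ρ ↦ BSD(E, ρ) ∈ ℂˣ` of (isomorphism classes of) Artin representations such
that: `Ш_{E/K}` is finite and `BSD(E/K) = BSD(E, Ind_{K/ℚ} 𝟏)` for number fields `K`; it is
multiplicative in direct sums; and, when `⟨ρ, E(K)_ℂ⟩ = 0`, it lies in `ℚ(ρ)`, is
Galois-equivariant, and is integral for non-trivial Dirichlet characters. (The further conjectural
properties, on root numbers, are not imposed; this only makes the assumption weaker.) -/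
structure IsBSDInvariant (E : WeierstrassCurve ℚ) (B : ArtinRep → ℂˣ) : Prop where
  iso_invariant : ∀ ρ τ : ArtinRep, ρ.Iso τ → B ρ = B τ
  finite_sha : ∀ (K : Type) [Field K] [NumberField K] [Algebra ℚ K] [Algebra K QBar],
    Finite (ShaOver E K)
  bsd_ind : ∀ (K : Type) [Field K] [NumberField K] [Algebra ℚ K] [Algebra K QBar],
    ((bsdQuotient E K : ℝ) : ℂ) = B (indTrivial K)
  direct_sum : ∀ ρ τ : ArtinRep, B (ρ.sum τ) = B ρ * B τ
  galois_equivariant : ∀ (ρ : ArtinRep) (K : IntermediateField ℚ QBar) [FiniteDimensional ℚ K]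
    [IsGalois ℚ K],
    K.fixingSubgroup ≤ ρ.rep.ker → multiplicity ρ E K = 0 →
    ∃ b : ρ.charField, (b : ℂ) = B ρ ∧
      ∀ (g : Gal(ρ.charField/ℚ)) (ρ' : ArtinRep),
        (∀ σ : GQ, ρ'.rep.character σ = g (ρ.charVal σ)) → (B ρ' : ℂ) = g b
  /-- One-dimensional Artin representations over `ℚ` are the same as primitive Dirichlet characters;
  the order of such a representation is the index of its kernel. -/
  integral : ∀ (ρ : ArtinRep) (K : IntermediateField ℚ QBar) [FiniteDimensional ℚ K]
    [IsGalois ℚ K],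
    K.fixingSubgroup ≤ ρ.rep.ker → multiplicity ρ E K = 0 →
    Module.finrank ℂ ρ.V = 1 → ρ.rep.ker ≠ ⊤ →
    (ConductorsCoprime E ρ ∨ (IsSemistable E ∧ HasNoIsogenies E)) →
    ∀ ζ : ℂ, IsPrimitiveRoot ζ ρ.rep.ker.index → (B ρ : ℂ) ∈ Algebra.adjoin ℤ {ζ}

/-- Existence of the invariant `BSD(E, ·)`. -/
def ArtinBSDConjecture (E : WeierstrassCurve ℚ) : Prop :=
  ∃ B : ArtinRep → ℂˣ, IsBSDInvariant E B

end

end ArtinBSD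

namespace ArtinBSD

/-! ### Ideals of prime power norm in the prime cyclotomic field -/

section Cyclotomic

variable {ℓ : ℕ} [Fact ℓ.Prime] {K : Type*} [Field K] [NumberField K]
  [hK : IsCyclotomicExtension {ℓ} ℚ K]

/-! The ratio BSD(E/F)/BSD(E/ℚ) is computed in two ways.

Analytically: Ind_{F/ℚ} 𝟏 is the sum of the ℓ characters of Gal(F/ℚ), so the ratio is the product of
BSD(E,χ) over the non-trivial χ. As E(F) = E(ℚ), no such χ occurs in E(F) ⊗ ℂ, and Galois
equivariance and integrality both apply: the values BSD(E,χ) are the conjugates of one element β of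
ℤ[ζ_ℓ], and the ratio is N(β) (`exists_bsdQuotient_eq_mul_norm`).

Arithmetically: every term of the ratio except Ш is a power of ℓ. The torsion is unchanged and the
regulator is multiplied by ℓ^r, because the points are the same and heights relative to F are ℓ
times those relative to ℚ (`exists_regulator_baseChange`). Semistable minimal equations stay
minimal, so the differentials contribute 1 and the local factor is a product of Tamagawa numbers,
each a power of ℓ (`localFactor_eq_zero_or_pow`). The prime-to-ℓ part of Ш_{E/ℚ} injects into
Ш_{E/F} (`sha_eq_zero_of_nsmul_eq_zero`); so if Ш_{E/F} had only p- and ℓ-parts, Ш_{E/ℚ} would be an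
ℓ-group. Then N(β) would be p² up to a power of ℓ. This is impossible (`pow_mul_absNorm_ne`): (β)
would be a prime P over p times a power of the principal ideal (ζ_ℓ − 1), so P would be principal.

The Tamagawa numbers are treated without Tate curves. Let k ⊂ l be the completions. For P of
singular reduction, x(P) and x(σP) are equally close to the x-coordinate of the node, and the
formulas for x(P+Q) and x(P−Q) then show that P + σP or P − σP lies in E₀(l) (`add_mem_or_sub_mem`).
A group of odd order acting up to sign on E(l)/E₀(l) acts trivially, and the trace of P comes from
E(k) = E₀(k); so the local degree kills E(l)/E₀(l) (`card_nsmul_mem_closure`).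

Degenerate values do no harm: finiteness of the Tamagawa indices and non-vanishing of the regulator
are read off from BSD(E,·) being non-zero, and the regulator comparison does not need the
Mordell–Weil theorem. -/

omit [Fact ℓ.Prime] [NumberField K] hK in
theorem liesOver_of_natCast_mem {q : ℕ} (hq : q.Prime)
    {P : Ideal (𝓞 K)} [hP : P.IsPrime] (h : (q : 𝓞 K) ∈ P) :
    P.LiesOver (Ideal.span {(q : ℤ)}) := by
  rw [Ideal.liesOver_iff]
  have : Fact q.Prime := ⟨hq⟩
  refine Ideal.IsMaximal.eq_of_le (Int.ideal_span_isMaximal_of_prime q)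
    (Ideal.IsPrime.ne_top inferInstance) ?_
  rw [Ideal.span_singleton_le_iff_mem, Ideal.mem_comap, algebraMap_int_eq, map_natCast]
  exact h

/-- The prime ℓ is totally ramified: the only prime above it is generated by ζ − 1. -/
theorem isPrincipal_of_liesOver_self (P : Ideal (𝓞 K)) [P.IsPrime]
    [P.LiesOver (Ideal.span {(ℓ : ℤ)})] : P.IsPrincipal :=
  ⟨_, IsCyclotomicExtension.Rat.eq_span_zeta_sub_one_of_liesOver' ℓ K
    (IsCyclotomicExtension.zeta_spec ℓ ℚ K) P⟩

theorem absNorm_of_liesOver_self (P : Ideal (𝓞 K)) [P.IsPrime]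
    [P.LiesOver (Ideal.span {(ℓ : ℤ)})] : Ideal.absNorm P = ℓ := by
  have h := IsCyclotomicExtension.Rat.inertiaDeg_eq_of_prime ℓ K P
  have := Ideal.pow_inertiaDeg ℓ P
  rw [h, pow_one] at this
  exact this.symm

/-- Every prime factor of J lies over ℓ, hence is the principal ideal (ζ − 1) of norm ℓ; such
factors are split off one at a time. -/
theorem isPrincipal_of_absNorm_eq_pow (x : ℕ) :
    ∀ J : Ideal (𝓞 K), Ideal.absNorm J = ℓ ^ x → J.IsPrincipal := by
  have hℓ : ℓ.Prime := Fact.out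
  induction x with
  | zero =>
    intro J hJ
    rw [pow_zero, Ideal.absNorm_eq_one_iff] at hJ
    subst hJ
    infer_instance
  | succ x ih =>
    intro J hJ
    have hJt : J ≠ ⊤ := by
      rintro rfl
      rw [Ideal.absNorm_top] at hJ
      exact (Nat.one_lt_pow (Nat.succ_ne_zero x) hℓ.one_lt).ne hJ
    obtain ⟨P, hP, hJP⟩ := Ideal.exists_le_maximal J hJt
    have : P.IsPrime := hP.isPrime
    have hmem : (ℓ : 𝓞 K) ∈ P := by
      refine this.mem_of_pow_mem (x + 1) (hJP ?_)
      have := Ideal.absNorm_mem J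
      rw [hJ] at this
      exact_mod_cast this
    have : P.LiesOver (Ideal.span {(ℓ : ℤ)}) := liesOver_of_natCast_mem hℓ hmem
    obtain ⟨J', rfl⟩ := Ideal.dvd_iff_le.2 hJP
    rw [map_mul, absNorm_of_liesOver_self (ℓ := ℓ), pow_succ'] at hJ
    have hJ' := ih J' (Nat.eq_of_mul_eq_mul_left hℓ.pos hJ)
    obtain ⟨a, ha⟩ := isPrincipal_of_liesOver_self (ℓ := ℓ) P
    obtain ⟨b, hb⟩ := hJ'
    refine ⟨a * b, ?_⟩
    rw [ha, hb]
    exact Ideal.span_singleton_mul_span_singleton a b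

variable {p : ℕ}
    (hp : ∀ P : Ideal (𝓞 K), P.IsPrime → P.LiesOver (Ideal.span {(p : ℤ)}) →
      ¬ P.IsPrincipal ∧ P.inertiaDeg ℤ = 2)

include hK hp in
theorem ne_of_not_isPrincipal [Fact p.Prime] : p ≠ ℓ := by
  rintro rfl
  obtain ⟨P, h1, h2⟩ := Ideal.exists_maximal_ideal_liesOver_of_isIntegral
    (S := 𝓞 K) (Ideal.span {(p : ℤ)})
  have := h1.isPrime
  exact (hp P h1.isPrime h2).1 (isPrincipal_of_liesOver_self (ℓ := p) P)

include hK hp in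
-- For ℓ = 2 the field is ℚ, where (p) has norm p and cannot be divisible by a prime of norm p². The
-- oddness of ℓ is what the sign argument for Tamagawa numbers needs.
theorem ne_two_of_not_isPrincipal [Fact p.Prime] : ℓ ≠ 2 := by
  rintro rfl
  obtain ⟨P, h1, h2⟩ := Ideal.exists_maximal_ideal_liesOver_of_isIntegral
    (S := 𝓞 K) (Ideal.span {(p : ℤ)})
  have h3 := (hp P h1.isPrime h2).2
  have h4 : Module.finrank ℚ K = 1 := by
    rw [IsCyclotomicExtension.finrank (n := 2) (K := ℚ) K
      (Polynomial.cyclotomic.irreducible_rat (by norm_num))]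
    rfl
  have h5 : Ideal.absNorm P = p ^ 2 := by rw [← h3]; exact (Ideal.pow_inertiaDeg p P).symm
  have h6 : P ∣ Ideal.span {(p : 𝓞 K)} := by
    rw [Ideal.dvd_iff_le, Ideal.span_singleton_le_iff_mem]
    have : (p : ℤ) ∈ P.under ℤ := by
      rw [← h2.over]
      exact Ideal.mem_span_singleton_self _
    rw [Ideal.under_def, Ideal.mem_comap] at this
    simpa using this
  have h7 := Ideal.absNorm_dvd_absNorm_of_le (Ideal.dvd_iff_le.1 h6)
  rw [h5, Ideal.absNorm_span_natCast, NumberField.RingOfIntegers.rank, h4, pow_one] at h7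
  have := Nat.le_of_dvd (Nat.Prime.pos Fact.out) h7
  have h1p : 1 < p := Nat.Prime.one_lt Fact.out
  nlinarith

include hK hp in
/-- No integer of `ℚ(ζ_ℓ)` has norm `p²` up to powers of `ℓ`. -/
theorem pow_mul_absNorm_ne [Fact p.Prime] (β : 𝓞 K) (x y : ℕ) :
    ℓ ^ y * Ideal.absNorm (Ideal.span {β}) ≠ ℓ ^ x * p ^ 2 := by
  intro h
  have hℓ : ℓ.Prime := Fact.out
  have hpp : p.Prime := Fact.out
  have hne := ne_of_not_isPrincipal (ℓ := ℓ) hp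
  have hcop : Nat.Coprime p ℓ := (Nat.coprime_primes hpp hℓ).2 hne
  have hdvd : p ^ 2 ∣ Ideal.absNorm (Ideal.span {β}) :=
    (Nat.Coprime.pow 2 y hcop).dvd_of_dvd_mul_left (h ▸ Dvd.intro_left _ rfl)
  have hpos : Ideal.absNorm (Ideal.span {β}) ≠ 0 := by
    intro h0
    rw [h0, mul_zero] at h
    exact (mul_ne_zero (pow_ne_zero _ hℓ.ne_zero) (pow_ne_zero _ hpp.ne_zero)) h.symm
  obtain ⟨P, hP, hPp, hβP⟩ : ∃ P : Ideal (𝓞 K), P.IsPrime ∧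
      (p : 𝓞 K) ∈ P ∧ Ideal.span {β} ≤ P := by
    obtain ⟨P, hP, hPp, hd⟩ := Ideal.exists_isMaximal_dvd_of_dvd_absNorm' hpp (Ideal.span {β})
      ((Dvd.intro_left _ (pow_succ p 1).symm).trans hdvd)
    refine ⟨P, hP.isPrime, ?_, Ideal.dvd_iff_le.1 hd⟩
    have : (p : ℤ) ∈ P.under ℤ := hPp ▸ Ideal.mem_span_singleton_self _
    rw [Ideal.under_def, Ideal.mem_comap] at this
    simpa using this
  have : P.LiesOver (Ideal.span {(p : ℤ)}) := liesOver_of_natCast_mem hpp hPp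
  obtain ⟨hnp, hdeg⟩ := hp P hP this
  have hPn : Ideal.absNorm P = p ^ 2 := by rw [← hdeg]; exact (Ideal.pow_inertiaDeg p P).symm
  -- The norm p² of P uses up the whole p-part of N(β). The cofactor J therefore has ℓ-power norm
  -- and is principal; cancelling its generator from β would leave a generator of P.
  obtain ⟨J, hJ⟩ := Ideal.dvd_iff_le.2 hβP
  rw [hJ, map_mul, hPn] at h
  have hJn : Ideal.absNorm J ∣ ℓ ^ x := by
    refine ⟨ℓ ^ y, ?_⟩
    apply Nat.eq_of_mul_eq_mul_right (pow_pos hpp.pos 2)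
    rw [← h]; ring
  obtain ⟨z, -, hz⟩ := (Nat.dvd_prime_pow hℓ).1 hJn
  obtain ⟨γ, hγ⟩ := isPrincipal_of_absNorm_eq_pow (ℓ := ℓ) z J hz
  change J = Ideal.span {γ} at hγ
  have hγβ : β ∈ Ideal.span {γ} := by
    rw [← hγ]
    have h1 : β ∈ P * J := by
      rw [← hJ]
      exact Ideal.mem_span_singleton_self β
    exact Ideal.mul_le_right h1
  obtain ⟨δ, rfl⟩ := Ideal.mem_span_singleton.1 hγβ
  have hγ0 : Ideal.span {γ} ≠ ⊥ := by
    rw [← hγ]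
    rintro rfl
    rw [Ideal.absNorm_bot] at hz
    exact pow_ne_zero z hℓ.ne_zero hz.symm
  refine hnp ⟨δ, ?_⟩
  change P = Ideal.span {δ}
  rw [hγ, mul_comm, ← Ideal.span_singleton_mul_span_singleton] at hJ
  exact (mul_right_cancel₀ hγ0 hJ).symm

end Cyclotomic

end ArtinBSD


namespace ArtinBSD

/-! ### Sums of one-dimensional Artin representations -/

section Characters

/-- The diagonal Artin representation attached to a finite family of characters. -/
noncomputable def diagRep {ι : Type} [Finite ι] (χ : ι → GQ →* ℂ)
    (hχ : ∀ i, IsOpen ((χ i).ker : Set GQ)) : ArtinRep where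
  V := ι → ℂ
  rep :=
    { toFun := fun g => LinearMap.pi fun i => χ i g • LinearMap.proj i
      map_one' := by ext; simp
      map_mul' := fun g h => by ext; simp [mul_assoc] }
  isOpen_ker := by
    have hopen : IsOpen ((⨅ i, (χ i).ker : Subgroup GQ) : Set GQ) := by
      rw [Subgroup.coe_iInf]
      exact isOpen_iInter_of_finite hχ
    refine Subgroup.isOpen_mono ?_ hopen
    intro g hg
    rw [Subgroup.mem_iInf] at hg
    rw [MonoidHom.mem_ker]
    refine LinearMap.ext fun v => funext fun i => ?_
    have h : χ i g = 1 := hg i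
    simp [h]

/-- The one-dimensional Artin representation attached to a character. -/
noncomputable def charRep (χ : GQ →* ℂ) (hχ : IsOpen (χ.ker : Set GQ)) : ArtinRep where
  V := ℂ
  rep :=
    { toFun := fun g => χ g • LinearMap.id
      map_one' := by ext; simp
      map_mul' := fun g h => by ext; simp [mul_comm] }
  isOpen_ker := by
    refine Subgroup.isOpen_mono ?_ hχ
    intro g hg
    rw [MonoidHom.mem_ker]
    refine LinearMap.ext fun v => ?_
    have h : χ g = 1 := hg
    simp [h]

theorem charRep_rep_apply (χ : GQ →* ℂ) (hχ : IsOpen (χ.ker : Set GQ)) (g : GQ) (v : ℂ) :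
    (charRep χ hχ).rep g v = χ g * v := rfl

theorem ker_charRep (χ : GQ →* ℂ) (hχ : IsOpen (χ.ker : Set GQ)) :
    (charRep χ hχ).rep.ker = χ.ker := by
  ext g
  rw [MonoidHom.mem_ker, MonoidHom.mem_ker]
  constructor
  · intro h
    have := LinearMap.congr_fun h (1 : ℂ)
    rwa [charRep_rep_apply, mul_one] at this
  · intro h
    have h1 : ∀ v : ℂ, χ g * v = v := fun v => by rw [h, one_mul]
    exact LinearMap.ext fun v => h1 v

theorem character_charRep (χ : GQ →* ℂ) (hχ : IsOpen (χ.ker : Set GQ)) (g : GQ) :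
    (charRep χ hχ).rep.character g = χ g := by
  change LinearMap.trace ℂ ℂ (χ g • LinearMap.id) = χ g
  simp

/-- An equivariant linear equivalence is an isomorphism of Artin representations. -/
theorem ArtinRep.iso_of_linearEquiv {ρ τ : ArtinRep} (e : ρ.V ≃ₗ[ℂ] τ.V)
    (h : ∀ g v, e (ρ.rep g v) = τ.rep g (e v)) : ρ.Iso τ :=
  ⟨{ e with isIntertwining' := fun g => LinearMap.ext fun v => h g v }⟩

variable {B : ArtinRep → ℂˣ} (hiso : ∀ ρ τ : ArtinRep, ρ.Iso τ → B ρ = B τ)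
    (hsum : ∀ ρ τ : ArtinRep, B (ρ.sum τ) = B ρ * B τ)

include hiso hsum in
/-- A multiplicative invariant of a diagonal representation is a product. -/
theorem map_diagRep (ι : Type) [Fintype ι] :
    ∀ (χ : ι → GQ →* ℂ) (hχ : ∀ i, IsOpen ((χ i).ker : Set GQ)),
      B (diagRep χ hχ) = ∏ i, B (charRep (χ i) (hχ i)) := by
  refine Fintype.induction_empty_option
    (P := fun (ι : Type) [Fintype ι] => ∀ (χ : ι → GQ →* ℂ)
      (hχ : ∀ i, IsOpen ((χ i).ker : Set GQ)),
      B (diagRep χ hχ) = ∏ i, B (charRep (χ i) (hχ i))) ?_ ?_ ?_ ι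
  · intro α β _ e ih χ hχ
    let _ : Fintype α := Fintype.ofEquiv β e.symm
    rw [← Equiv.prod_comp e (fun i => B (charRep (χ i) (hχ i))),
      ← ih (fun a => χ (e a)) (fun a => hχ (e a))]
    refine hiso _ _ (ArtinRep.iso_of_linearEquiv
      (LinearEquiv.funCongrLeft ℂ ℂ e : (diagRep χ hχ).V ≃ₗ[ℂ] _) fun g v => ?_)
    rfl
  · intro χ hχ
    rw [Fintype.prod_empty]
    -- The zero representation satisfies 0 ≅ 0 ⊕ 0, so its value b has b = b², and b = 1 because b
    -- is a unit.
    have h : (diagRep χ hχ).Iso ((diagRep χ hχ).sum (diagRep χ hχ)) := by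
      have : Subsingleton (diagRep χ hχ).V := inferInstanceAs (Subsingleton (PEmpty → ℂ))
      have : Subsingleton ((diagRep χ hχ).sum (diagRep χ hχ)).V :=
        inferInstanceAs (Subsingleton ((PEmpty → ℂ) × (PEmpty → ℂ)))
      refine ArtinRep.iso_of_linearEquiv
        { toFun := fun _ => 0
          invFun := fun _ => 0
          map_add' := fun _ _ => Subsingleton.elim _ _
          map_smul' := fun _ _ => Subsingleton.elim _ _
          left_inv := fun _ => Subsingleton.elim _ _
          right_inv := fun _ => Subsingleton.elim _ _ } fun g v => Subsingleton.elim _ _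
    have h2 := hiso _ _ h
    rw [hsum] at h2
    exact mul_eq_left.1 h2.symm
  · intro α _ ih χ hχ
    rw [Fintype.prod_option, ← ih (fun a => χ (some a)) (fun a => hχ (some a)), ← hsum]
    refine hiso _ _ (ArtinRep.iso_of_linearEquiv
      { toFun := fun v : Option α → ℂ => ((v none, fun a => v (some a)) : ℂ × (α → ℂ))
        invFun := fun w : ℂ × (α → ℂ) => fun o : Option α => o.elim w.1 w.2
        map_add' := fun _ _ => rfl
        map_smul' := fun _ _ => rfl
        left_inv := fun v => by
          funext o
          cases o <;> rfl
        right_inv := fun _ => rfl } fun g v => ?_)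
    rfl

end Characters

/-! ### Cyclic permutation representations -/

section Cyclic

variable {n : ℕ} [NeZero n]

/-- The `k`-th character of `GQ` attached to a homomorphism to `ℤ/n`. -/
noncomputable def cyclicChar (ψ : GQ →* Multiplicative (ZMod n)) (k : ZMod n) : GQ →* ℂ where
  -- The minus sign is that of the kernel of `ZMod.dft`, so that the discrete Fourier transform
  -- produces exactly these characters.
  toFun g := ZMod.stdAddChar (-((ψ g).toAdd * k))
  map_one' := by simp
  map_mul' g h := by
    rw [map_mul, toAdd_mul, add_mul, neg_add, AddChar.map_add_eq_mul]

theorem cyclicChar_apply (ψ : GQ →* Multiplicative (ZMod n)) (k : ZMod n) (g : GQ) :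
    cyclicChar ψ k g = ZMod.stdAddChar (-((ψ g).toAdd * k)) := rfl

theorem ker_le_ker_cyclicChar (ψ : GQ →* Multiplicative (ZMod n)) (k : ZMod n) :
    ψ.ker ≤ (cyclicChar ψ k).ker := by
  intro g hg
  rw [MonoidHom.mem_ker] at hg ⊢
  simp [cyclicChar_apply, hg]

theorem isOpen_ker_cyclicChar {ψ : GQ →* Multiplicative (ZMod n)}
    (hψ : IsOpen (ψ.ker : Set GQ)) (k : ZMod n) : IsOpen ((cyclicChar ψ k).ker : Set GQ) :=
  Subgroup.isOpen_mono (ker_le_ker_cyclicChar ψ k) hψ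

theorem ker_cyclicChar (ψ : GQ →* Multiplicative (ZMod n)) {k : ZMod n} (hk : IsUnit k) :
    (cyclicChar ψ k).ker = ψ.ker := by
  refine le_antisymm ?_ (ker_le_ker_cyclicChar ψ k)
  intro g hg
  rw [MonoidHom.mem_ker] at hg ⊢
  rw [cyclicChar_apply, ← (ZMod.stdAddChar (N := n)).map_zero_eq_one] at hg
  have := ZMod.injective_stdAddChar hg
  rw [neg_eq_zero, hk.mul_left_eq_zero] at this
  exact this

/-- If `K/ℚ` is cyclic, with `Gal(ℚ̄/K) = ker ψ`, then `Ind_{K/ℚ} 𝟏` is the sum of the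
characters attached to `ψ`. -/
theorem indTrivial_iso_diagRep (K : Type) [Field K] [NumberField K] [Algebra K QBar]
    (ψ : GQ →* Multiplicative (ZMod n)) (hψ : Function.Surjective ψ) (hker : ψ.ker = absGal K)
    (hopen : ∀ k, IsOpen ((cyclicChar ψ k).ker : Set GQ)) :
    (indTrivial K).Iso (diagRep (cyclicChar ψ) hopen) := by
  classical
  let ε : GQ ⧸ absGal K → ZMod n := Quotient.lift (fun g => (ψ g).toAdd) (by
    intro a b hab
    have : a⁻¹ * b ∈ ψ.ker := by rw [hker]; exact QuotientGroup.leftRel_apply.1 hab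
    rw [MonoidHom.mem_ker, map_mul, map_inv, inv_mul_eq_one] at this
    exact congrArg _ this)
  have hε : Function.Bijective ε := by
    constructor
    · intro a b
      induction a using QuotientGroup.induction_on with | H a => ?_
      induction b using QuotientGroup.induction_on with | H b => ?_
      intro h
      change (ψ a).toAdd = (ψ b).toAdd at h
      rw [QuotientGroup.eq, ← hker, MonoidHom.mem_ker, map_mul, map_inv, inv_mul_eq_one]
      exact h
    · intro x
      obtain ⟨g, hg⟩ := hψ (Multiplicative.ofAdd x)
      exact ⟨(g : GQ ⧸ absGal K), congrArg Multiplicative.toAdd hg⟩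
  have hεg : ∀ (g : GQ) (x : GQ ⧸ absGal K), ε (g • x) = (ψ g).toAdd + ε x := by
    intro g x
    induction x using QuotientGroup.induction_on with | H x => ?_
    change (ψ (g * x)).toAdd = (ψ g).toAdd + (ψ x).toAdd
    rw [map_mul, toAdd_mul]
  let e := Equiv.ofBijective ε hε
  let _ : Fintype (GQ ⧸ absGal K) := Fintype.ofEquiv _ e.symm
  -- The cosets are identified with ℤ/n, on which g translates by ψ(g); the Fourier transform turns
  -- this translation into multiplication by the characters.
  let T : (indTrivial K).V ≃ₗ[ℂ] (ZMod n → ℂ) :=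
    (((MonoidAlgebra.coeffLinearEquiv ℂ (M := GQ ⧸ absGal K)).trans
      (Finsupp.linearEquivFunOnFinite ℂ ℂ _)).trans (LinearEquiv.funCongrLeft ℂ ℂ e.symm)).trans
      ZMod.dft
  have hT : ∀ v k, T v k = ∑ x : GQ ⧸ absGal K,
      ZMod.stdAddChar (-(ε x * k)) • (MonoidAlgebra.coeff v) x := by
    intro v k
    change ZMod.dft _ k = _
    rw [ZMod.dft_apply, ← Equiv.sum_comp e]
    refine Finset.sum_congr rfl fun x _ => ?_
    change _ • (MonoidAlgebra.coeff v) (e.symm (e x)) = _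
    rw [Equiv.symm_apply_apply]
    rfl
  refine ArtinRep.iso_of_linearEquiv (T : (indTrivial K).V ≃ₗ[ℂ] (diagRep _ hopen).V) ?_
  intro g v
  refine funext fun k => ?_
  change T _ k = cyclicChar ψ k g * T v k
  rw [hT, hT, ← Equiv.sum_comp (MulAction.toPerm g), Finset.mul_sum]
  refine Finset.sum_congr rfl fun x _ => ?_
  have h1 : (MonoidAlgebra.coeff ((indTrivial K).rep g v)) (MulAction.toPerm g x) =
      (MonoidAlgebra.coeff v) x := by
    refine (Representation.coeff_ofMulAction g v (g • x)).trans ?_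
    rw [inv_smul_smul]
  rw [h1, MulAction.toPerm_apply, hεg, cyclicChar_apply, add_mul, neg_add,
    AddChar.map_add_eq_mul, smul_eq_mul, smul_eq_mul, mul_assoc]

end Cyclic

end ArtinBSD


namespace ArtinBSD

/-! ### The ratio of BSD quotients as a norm -/

section Norm

theorem ptsMap_comp_apply {K : Type*} [Field K] (W : WeierstrassCurve K) {L M N : Type*} [Field L]
    [Algebra K L] [Field M] [Algebra K M] [Field N] [Algebra K N] (f : L →ₐ[K] M) (g : M →ₐ[K] N)
    (P : Pts W L) : ptsMap W (g.comp f) P = ptsMap W g (ptsMap W f P) := by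
  cases P <;> rfl

/-- An automorphism fixes the points that come from the base field. -/
theorem ptsMap_eq_self_of_noNewPoints {E : WeierstrassCurve ℚ} {F : Type} [Field F] [Algebra ℚ F]
    (hpts : NoNewPoints E F) (σ : Gal(F/ℚ)) (P : Pts E F) : ptsMap E (σ : F →ₐ[ℚ] F) P = P := by
  obtain ⟨Q, rfl⟩ := hpts P
  have h : (σ : F →ₐ[ℚ] F).comp (Algebra.ofId ℚ F) = Algebra.ofId ℚ F := Subsingleton.elim _ _
  conv_rhs => rw [← h]
  exact (ptsMap_comp_apply E _ _ Q).symm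

theorem mordellWeilRep_eq_one {E : WeierstrassCurve ℚ} (F : IntermediateField ℚ QBar) [Normal ℚ F]
    (hpts : NoNewPoints E F) (g : GQ) : mordellWeilRep E F g = 1 := by
  have : (pointsAction E F) (AlgEquiv.restrictNormalHom F g) = 1 :=
    AddMonoidHom.ext fun P => ptsMap_eq_self_of_noNewPoints hpts _ P
  change tensorEnd (Pts E F) ((pointsAction E F) (AlgEquiv.restrictNormalHom F g)) = 1
  rw [this, map_one]

/-- All points over F come from ℚ, so the Galois group acts trivially on E(F) ⊗ ℂ. An intertwining
map f satisfies χ(g) f = f, hence vanishes as soon as some χ(g) ≠ 1. -/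
theorem multiplicity_charRep_eq_zero {E : WeierstrassCurve ℚ} (F : IntermediateField ℚ QBar)
    [Normal ℚ F] (hpts : NoNewPoints E F) (χ : GQ →* ℂ) (hχ : IsOpen (χ.ker : Set GQ))
    (hne : χ ≠ 1) : multiplicity (charRep χ hχ) E F = 0 := by
  obtain ⟨g, hg⟩ : ∃ g, χ g ≠ 1 := by
    by_contra! h
    exact hne (MonoidHom.ext h)
  have : Subsingleton ((charRep χ hχ).rep.IntertwiningMap (mordellWeilRep E F)) := by
    refine subsingleton_of_forall_eq 0 fun f => ?_
    have key : ∀ v, f.toLinearMap v = 0 := by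
      intro v
      have h := LinearMap.congr_fun (f.isIntertwining' g) v
      rw [LinearMap.comp_apply, LinearMap.comp_apply, mordellWeilRep_eq_one F hpts] at h
      have h2 : (charRep χ hχ).rep g v = χ g • v := rfl
      rw [h2, map_smul, Module.End.one_apply] at h
      have h3 : (χ g - 1) • f.toLinearMap v = 0 := by rw [sub_smul, h, one_smul, sub_self]
      exact (smul_eq_zero.1 h3).resolve_left (sub_ne_zero.2 hg)
    ext
    exact key _
  exact rank_subsingleton' _ _

theorem fixingSubgroup_eq_absGal (F : IntermediateField ℚ QBar) [NumberField F] :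
    F.fixingSubgroup = absGal F := by
  ext σ
  rw [IntermediateField.mem_fixingSubgroup_iff]
  exact ⟨fun h x => h x x.2, fun h x hx => h ⟨x, hx⟩⟩

/-- A cyclic extension of prime degree is cut out by a homomorphism to `ℤ/ℓ`. -/
theorem exists_hom_zmod {ℓ : ℕ} (hℓ : ℓ.Prime) (F : IntermediateField ℚ QBar) [NumberField F]
    [IsGalois ℚ F] (hdeg : Module.finrank ℚ F = ℓ) :
    ∃ ψ : GQ →* Multiplicative (ZMod ℓ), Function.Surjective ψ ∧ ψ.ker = absGal F := by
  have : Fact ℓ.Prime := ⟨hℓ⟩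
  have h1 : Nat.card Gal(F/ℚ) = ℓ := by rw [IsGalois.card_aut_eq_finrank, hdeg]
  have h2 : Nat.card (Multiplicative (ZMod ℓ)) = ℓ := by
    rw [Nat.card_eq_fintype_card, Fintype.card_multiplicative, ZMod.card]
  let e : Gal(F/ℚ) ≃* Multiplicative (ZMod ℓ) := mulEquivOfPrimeCardEq h1 h2
  have : Normal ℚ QBar := IsAlgClosure.normal ℚ QBar
  refine ⟨(e : Gal(F/ℚ) →* Multiplicative (ZMod ℓ)).comp (AlgEquiv.restrictNormalHom F),
    e.surjective.comp (AlgEquiv.restrictNormalHom_surjective (F := ℚ) (K₁ := F) QBar), ?_⟩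
  ext σ
  rw [MonoidHom.mem_ker, MonoidHom.comp_apply]
  change e _ = 1 ↔ _
  rw [EmbeddingLike.map_eq_one_iff]
  constructor
  · intro h x
    have h3 := AlgEquiv.restrictNormal_commutes σ F x
    change algebraMap F QBar (AlgEquiv.restrictNormalHom F σ x) = _ at h3
    rw [h] at h3
    exact h3.symm
  · intro h
    refine AlgEquiv.ext fun x => (algebraMap F QBar).injective ?_
    exact (AlgEquiv.restrictNormal_commutes σ F x).trans (h x)

theorem absGal_rat : absGal ℚ = ⊤ := by
  ext σ
  simp only [Subgroup.mem_top, iff_true]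
  intro x
  simp

theorem isPrimitiveRoot_stdAddChar_one (n : ℕ) [NeZero n] :
    IsPrimitiveRoot (ZMod.stdAddChar (1 : ZMod n)) n := by
  have := ZMod.stdAddChar_coe (N := n) 1
  rw [Int.cast_one, Int.cast_one, mul_one] at this
  rw [this]
  exact Complex.isPrimitiveRoot_exp n (NeZero.ne n)

theorem stdAddChar_eq_pow {n : ℕ} [NeZero n] (a : ZMod n) :
    ZMod.stdAddChar a = (ZMod.stdAddChar (1 : ZMod n) : ℂ) ^ a.val := by
  rw [← AddChar.map_nsmul_eq_pow, nsmul_one, ZMod.natCast_zmod_val]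

theorem charField_cyclicChar {ℓ : ℕ} [Fact ℓ.Prime] {ψ : GQ →* Multiplicative (ZMod ℓ)}
    (hψ : Function.Surjective ψ) (h : IsOpen ((cyclicChar ψ 1).ker : Set GQ)) :
    (charRep (cyclicChar ψ 1) h).charField =
      IntermediateField.adjoin ℚ {(ZMod.stdAddChar (1 : ZMod ℓ) : ℂ)} := by
  refine le_antisymm ?_ ?_
  · refine IntermediateField.adjoin_le_iff.2 ?_
    rintro _ ⟨g, rfl⟩
    rw [character_charRep, cyclicChar_apply, SetLike.mem_coe,
      stdAddChar_eq_pow (-((ψ g).toAdd * 1))]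
    exact pow_mem (IntermediateField.mem_adjoin_simple_self ℚ (ZMod.stdAddChar (1 : ZMod ℓ) : ℂ)) _
  · refine IntermediateField.adjoin_simple_le_iff.2 ?_
    -- The value −1 compensates the sign in `cyclicChar`.
    obtain ⟨g, hg⟩ := hψ (Multiplicative.ofAdd (-1))
    refine IntermediateField.subset_adjoin ℚ _ ⟨g, ?_⟩
    rw [character_charRep, cyclicChar_apply, hg, toAdd_ofAdd, mul_one, neg_neg]

variable {E : WeierstrassCurve ℚ} {B : ArtinRep → ℂˣ} (hB : IsBSDInvariant E B)

include hB in
/-- The product of the values of the invariant at the non-trivial characters of order `ℓ` is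
the norm of an integer of `ℚ(ζ_ℓ)`. -/
theorem exists_prod_eq_norm {ℓ : ℕ} [Fact ℓ.Prime] (L : Type*) [Field L] [NumberField L]
    [IsCyclotomicExtension {ℓ} ℚ L] (hss : IsSemistable E)
    (hisog : HasNoIsogenies E) (F : IntermediateField ℚ QBar) [NumberField F] [IsGalois ℚ F]
    (hpts : NoNewPoints E F) (ψ : GQ →* Multiplicative (ZMod ℓ)) (hψ : Function.Surjective ψ)
    (hker : ψ.ker = absGal F) (hopen : ∀ k, IsOpen ((cyclicChar ψ k).ker : Set GQ)) :
    ∃ β : 𝓞 L, (∏ k : (ZMod ℓ)ˣ,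
      (B (charRep (cyclicChar ψ k) (hopen k)) : ℂ)) = (Algebra.norm ℤ β : ℂ) := by
  have hgal : IsGalois ℚ L := IsCyclotomicExtension.isGalois {ℓ} ℚ L
  set ζ : ℂ := ZMod.stdAddChar (1 : ZMod ℓ) with hζdef
  have hζ : IsPrimitiveRoot ζ ℓ := isPrimitiveRoot_stdAddChar_one ℓ
  have hz := IsCyclotomicExtension.zeta_spec ℓ ℚ L
  set z := IsCyclotomicExtension.zeta ℓ ℚ L
  -- The hypotheses on the invariant are applied to this single character; all other non-trivial
  -- ones are its Galois conjugates.
  set ρ := charRep (cyclicChar ψ 1) (hopen 1) with hρ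
  have hρker : ρ.rep.ker = ψ.ker := by rw [hρ, ker_charRep, ker_cyclicChar ψ isUnit_one]
  have hindex : ρ.rep.ker.index = ℓ := by
    rw [hρker, Subgroup.index_ker, MonoidHom.range_eq_top.2 hψ, Subgroup.card_top,
      Nat.card_eq_fintype_card, Fintype.card_multiplicative, ZMod.card]
  have hfix : F.fixingSubgroup ≤ ρ.rep.ker := by
    rw [hρker, hker, fixingSubgroup_eq_absGal]
  have hℓ : ℓ.Prime := Fact.out
  have hkertop : ρ.rep.ker ≠ ⊤ := by
    intro h
    rw [h, Subgroup.index_top] at hindex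
    exact hℓ.one_lt.ne hindex
  have hmult : multiplicity ρ E F = 0 := by
    refine multiplicity_charRep_eq_zero F hpts _ _ fun h => hkertop ?_
    rw [hρ, ker_charRep, h]
    exact MonoidHom.ker_one
  obtain ⟨b, hb, hbg⟩ := hB.galois_equivariant ρ F hfix hmult
  have hint := hB.integral ρ F hfix hmult (Module.finrank_self ℂ) hkertop
    (Or.inr ⟨hss, hisog⟩) ζ (hindex.symm ▸ hζ)
  -- an embedding of the cyclotomic field with image `ℚ(ρ)`
  have hirr := Polynomial.cyclotomic.irreducible_rat hℓ.pos
  obtain ⟨φ, hφ⟩ : ∃ φ : L →ₐ[ℚ] ℂ, φ z = ζ := by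
    obtain ⟨φ, hφ⟩ := (hz.embeddingsEquivPrimitiveRoots ℂ hirr).surjective
      ⟨ζ, (mem_primitiveRoots hℓ.pos).2 hζ⟩
    exact ⟨φ, by rw [← hz.embeddingsEquivPrimitiveRoots_apply_coe ℂ hirr φ, hφ]⟩
  have hrange : φ.fieldRange = ρ.charField := by
    rw [charField_cyclicChar hψ, AlgHom.fieldRange_eq_map, ← hζdef, ← hφ,
      ← (IntermediateField.adjoin_simple_eq_top_iff_of_isAlgebraic
        (Algebra.IsAlgebraic.isAlgebraic z)).2
        (IsCyclotomicExtension.adjoin_primitive_root_eq_top hz),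
      IntermediateField.adjoin_map, Set.image_singleton]
  let e : L ≃ₐ[ℚ] ρ.charField :=
    (AlgEquiv.ofInjectiveField φ).trans (IntermediateField.equivOfEq hrange)
  have he : ∀ x, ((e x : ρ.charField) : ℂ) = φ x := fun x => rfl
  -- The value is an integral polynomial in ζ; β is the same polynomial evaluated at the root of
  -- unity z of L.
  obtain ⟨β, hβ⟩ : ∃ β : 𝓞 L, φ β = B ρ := by
    rw [Algebra.adjoin_singleton_eq_range_aeval] at hint
    obtain ⟨f, hf⟩ := hint
    refine ⟨Polynomial.aeval hz.toInteger f, ?_⟩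
    have h1 : ((Polynomial.aeval hz.toInteger f : 𝓞 L) : L) = Polynomial.aeval z f :=
      (Polynomial.aeval_algebraMap_apply L hz.toInteger f).symm
    have h2 : φ (Polynomial.aeval z f) = Polynomial.aeval (φ z) f :=
      (Polynomial.aeval_algHom_apply (φ.restrictScalars ℤ) z f).symm
    rw [h1, h2, hφ, ← hf]
    rfl
  refine ⟨β, ?_⟩
  have hbβ : b = e β := Subtype.ext (hb.trans (hβ.symm.trans (he β).symm))
  -- If τ raises z to the power k, then conjugating ρ by τ gives the k-th character; Galois
  -- equivariance identifies its value with τ(β).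
  have hconj : ∀ τ : Gal(L/ℚ), φ (τ β) = B (charRep
      (cyclicChar ψ (IsCyclotomicExtension.Rat.galEquivZMod ℓ L τ : (ZMod ℓ)ˣ)) (hopen _)) := by
    intro τ
    set k : (ZMod ℓ)ˣ := IsCyclotomicExtension.Rat.galEquivZMod ℓ L τ with hk
    have h1 := hbg (AlgEquiv.autCongr e τ) (charRep (cyclicChar ψ k) (hopen k)) (by
      intro σ
      have h2 : ρ.charVal σ = e (z ^ (-((ψ σ).toAdd * 1)).val) := by
        refine Subtype.ext ?_
        rw [he, map_pow, hφ, hζdef, ← stdAddChar_eq_pow, ← cyclicChar_apply]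
        exact character_charRep _ _ σ
      have h3 : AlgEquiv.autCongr e τ (ρ.charVal σ) =
          e (τ (z ^ (-((ψ σ).toAdd * 1)).val)) := by
        rw [h2]
        exact congrArg (fun x => e (τ x)) (e.symm_apply_apply _)
      rw [h3, he, map_pow τ, IsCyclotomicExtension.Rat.galEquivZMod_apply_of_pow_eq ℓ L τ
        hz.pow_eq_one, ← hk, ← pow_mul, map_pow, hφ, character_charRep, cyclicChar_apply, hζdef,
        ← AddChar.map_nsmul_eq_pow, nsmul_one]
      congr 1
      rw [Nat.cast_mul, ZMod.natCast_zmod_val, ZMod.natCast_zmod_val]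
      ring)
    rw [h1, hbβ]
    exact congrArg (fun x => φ (τ x)) (e.symm_apply_apply (β : L)).symm
  have hnorm : (Algebra.norm ℤ β : ℂ) = φ (algebraMap ℚ L (Algebra.norm ℚ (β : L))) := by
    rw [← Algebra.coe_norm_int, AlgHom.commutes]
    simp
  rw [hnorm, Algebra.norm_eq_prod_automorphisms, map_prod,
    ← Equiv.prod_comp (IsCyclotomicExtension.Rat.galEquivZMod ℓ L).toEquiv]
  exact Finset.prod_congr rfl fun τ _ => (hconj τ).symm

include hB in
/-- The quotient of `BSD(E/F)` by `BSD(E/ℚ)` is the norm of an integer of `ℚ(ζ_ℓ)`. -/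
theorem exists_bsdQuotient_eq_mul_norm {ℓ : ℕ} [Fact ℓ.Prime] (hss : IsSemistable E)
    (hisog : HasNoIsogenies E) (F : IntermediateField ℚ QBar) [NumberField F] [IsGalois ℚ F]
    (hdeg : Module.finrank ℚ F = ℓ) (hpts : NoNewPoints E F) :
    ∃ β : 𝓞 (CyclotomicField ℓ ℚ),
      bsdQuotient E F = bsdQuotient E ℚ * (Algebra.norm ℤ β : ℝ) := by
  obtain ⟨ψ, hψ, hker⟩ := exists_hom_zmod Fact.out F hdeg
  have hopen : ∀ k, IsOpen ((cyclicChar ψ k).ker : Set GQ) := by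
    refine fun k => isOpen_ker_cyclicChar ?_ k
    rw [hker]
    exact isOpen_absGal F
  have : IsCyclotomicExtension {ℓ} ℚ (CyclotomicField ℓ ℚ) :=
    CyclotomicField.isCyclotomicExtension ℓ ℚ
  obtain ⟨β, hβ⟩ := exists_prod_eq_norm hB (CyclotomicField ℓ ℚ) hss hisog F hpts ψ hψ hker hopen
  refine ⟨β, ?_⟩
  have hF : ((bsdQuotient E F : ℝ) : ℂ) =
      ∏ k : ZMod ℓ, (B (charRep (cyclicChar ψ k) (hopen k)) : ℂ) := by
    rw [hB.bsd_ind F, hB.iso_invariant _ _ (indTrivial_iso_diagRep F ψ hψ hker hopen),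
      map_diagRep hB.iso_invariant hB.direct_sum, Units.coe_prod]
  -- The field ℚ is treated as cyclic of degree 1, through the trivial map to ℤ/1; its only
  -- character is also the 0-th character of ψ.
  have hQ : ((bsdQuotient E ℚ : ℝ) : ℂ) = B (charRep (cyclicChar ψ 0) (hopen 0)) := by
    have h1 : (1 : GQ →* Multiplicative (ZMod 1)).ker = absGal ℚ := by
      rw [absGal_rat]; exact MonoidHom.ker_one
    have h2 : ∀ k, IsOpen ((cyclicChar (1 : GQ →* Multiplicative (ZMod 1)) k).ker : Set GQ) := by
      refine fun k => isOpen_ker_cyclicChar ?_ k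
      rw [h1]
      exact isOpen_absGal ℚ
    rw [hB.bsd_ind ℚ, hB.iso_invariant _ _ (indTrivial_iso_diagRep ℚ 1
      (fun x => ⟨1, Subsingleton.elim _ _⟩) h1 h2),
      map_diagRep hB.iso_invariant hB.direct_sum, Units.coe_prod, Fintype.prod_subsingleton _ 0]
    congr 2
    have : cyclicChar (1 : GQ →* Multiplicative (ZMod 1)) 0 = cyclicChar ψ 0 := by
      ext g
      simp [cyclicChar_apply]
    congr 1
  have : ((bsdQuotient E F : ℝ) : ℂ) = ((bsdQuotient E ℚ * (Algebra.norm ℤ β : ℝ) : ℝ) : ℂ) := by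
    rw [hF, Complex.ofReal_mul, hQ, Complex.ofReal_intCast, ← hβ, Fintype.prod_eq_mul_prod_compl 0]
    congr 1
    symm
    refine Finset.prod_bij' (fun k _ => (k : ZMod ℓ))
      (fun k hk => Units.mk0 k (by simpa using hk)) ?_ ?_ ?_ ?_ ?_
    · exact fun k _ => by simp
    · exact fun k _ => Finset.mem_univ _
    · exact fun k _ => Units.ext rfl
    · exact fun k _ => rfl
    · exact fun k _ => rfl
  exact_mod_cast this

end Norm

end ArtinBSD


namespace ArtinBSD

/-! ### Points under ring homomorphisms -/

section MapPts

variable {k L M N : Type*} [Field k] [Field L] [Field M] [Field N]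

open scoped Classical in
/-- The map on points induced by a homomorphism of fields. -/
noncomputable def mapPts (f : L →+* M) (W : WeierstrassCurve L) (W' : WeierstrassCurve M)
    (h : W' = W.map f) : Points W →+ Points W' := by
  subst h
  exact letI := f.toAlgebra
    WeierstrassCurve.Affine.Point.map (W' := W) (Algebra.ofId L M)

theorem mapPts_zero (f : L →+* M) (W : WeierstrassCurve L) (W' : WeierstrassCurve M)
    (h : W' = W.map f) :
    mapPts f W W' h (WeierstrassCurve.Affine.Point.zero : W.toAffine.Point) =
      (WeierstrassCurve.Affine.Point.zero : W'.toAffine.Point) := by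
  subst h
  rfl

theorem nonsingular_map {f : L →+* M} {W : WeierstrassCurve L} {W' : WeierstrassCurve M}
    (h : W' = W.map f) {x y : L} (hn : W.toAffine.Nonsingular x y) :
    W'.toAffine.Nonsingular (f x) (f y) := by
  subst h
  exact (WeierstrassCurve.Affine.map_nonsingular W.toAffine f.injective x y).2 hn

theorem mapPts_some (f : L →+* M) (W : WeierstrassCurve L) (W' : WeierstrassCurve M)
    (h : W' = W.map f) (x y : L) (hn : W.toAffine.Nonsingular x y) :
    mapPts f W W' h (WeierstrassCurve.Affine.Point.some x y hn : W.toAffine.Point) =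
      (WeierstrassCurve.Affine.Point.some (f x) (f y) (nonsingular_map h hn) :
        W'.toAffine.Point) := by
  subst h
  rfl

theorem mapPts_mapPts (f : L →+* M) (g : M →+* N) (f' : L →+* N) {W : WeierstrassCurve L}
    {W' : WeierstrassCurve M} {W'' : WeierstrassCurve N} (h : W' = W.map f) (h' : W'' = W'.map g)
    (h'' : W'' = W.map f') (hf : ∀ x, g (f x) = f' x) (P : Points W) :
    mapPts g W' W'' h' (mapPts f W W' h P) = mapPts f' W W'' h'' P := by
  obtain rfl : g.comp f = f' := RingHom.ext hf
  subst h h'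
  cases P <;> rfl

theorem ptsMap_eq_mapPts {W : WeierstrassCurve k} [Algebra k L] [Algebra k M] (f : L →ₐ[k] M)
    (P : Pts W L) : ptsMap W f P = mapPts (f : L →+* M) (W.baseChange L) (W.baseChange M)
      (WeierstrassCurve.map_baseChange W f).symm P := by
  cases P
  · exact (mapPts_zero _ _ _ _).symm
  · exact (mapPts_some _ _ _ _ _ _ _).symm

theorem mapPts_injective (f : L →+* M) (W : WeierstrassCurve L) (W' : WeierstrassCurve M)
    (h : W' = W.map f) : Function.Injective (mapPts f W W' h) := by
  classical
  subst h
  let _ := f.toAlgebra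
  exact WeierstrassCurve.Affine.Point.map_injective (W' := W) (Algebra.ofId L M)

end MapPts

/-! ### Restriction of cocycles -/

section Restriction

variable {k K Ω : Type*} [Field k] [Field K] [Field Ω] [Algebra k K] [Algebra k Ω] [Algebra K Ω]
  [IsScalarTower k K Ω] {W : WeierstrassCurve k} {W' : WeierstrassCurve K}

/-- The two curves over Ω are equal, but not definitionally. Transport of points along this equality
is expressed as the map induced by the identity of Ω, so that it composes with the other maps on
points. -/
theorem baseChange_eq_map_id (h : W' = W.map (algebraMap k K)) :
    W'.baseChange Ω = (W.baseChange Ω).map (RingHom.id Ω) := by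
  subst h
  rw [WeierstrassCurve.map_id, WeierstrassCurve.baseChange, WeierstrassCurve.map_map,
    ← IsScalarTower.algebraMap_eq]
  rfl

/-- The restriction of a function on `Gal(Ω/k)` to `Gal(Ω/K)`. -/
noncomputable def restrictCochain (h : W' = W.map (algebraMap k K))
    (c : Gal(Ω/k) → Pts W Ω) : Gal(Ω/K) → Pts W' Ω :=
  fun σ => mapPts (RingHom.id Ω) _ _ (baseChange_eq_map_id h) (c (σ.restrictScalars k))

theorem restrictCochain_nsmul (h : W' = W.map (algebraMap k K)) (n : ℕ)
    (c : Gal(Ω/k) → Pts W Ω) : restrictCochain h (n • c) = n • restrictCochain h c :=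
  funext fun _ => map_nsmul _ _ _

theorem mapPts_id_ptsMap (h : W' = W.map (algebraMap k K)) (σ : Gal(Ω/K)) (P : Pts W Ω) :
    mapPts (RingHom.id Ω) _ _ (baseChange_eq_map_id h)
      (ptsMap W ((σ.restrictScalars k : Gal(Ω/k)) : Ω →ₐ[k] Ω) P) =
      ptsMap W' (σ : Ω →ₐ[K] Ω)
        (mapPts (RingHom.id Ω) _ _ (baseChange_eq_map_id h) P) := by
  rw [ptsMap_eq_mapPts, ptsMap_eq_mapPts]
  have h1 : W'.baseChange Ω = (W.baseChange Ω).map ((σ : Ω →ₐ[K] Ω) : Ω →+* Ω) := by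
    rw [← WeierstrassCurve.map_baseChange W' (σ : Ω →ₐ[K] Ω), baseChange_eq_map_id h,
      WeierstrassCurve.map_id]
  rw [mapPts_mapPts _ _ ((σ : Ω →ₐ[K] Ω) : Ω →+* Ω) _ _ h1 fun x => rfl,
    mapPts_mapPts _ _ ((σ : Ω →ₐ[K] Ω) : Ω →+* Ω) _ _ h1 fun x => rfl]

/-- A finite extension k(S) of k generates a finite extension K(S) of K, and automorphisms fixing
K(S) fix k(S). -/
theorem continuous_restrictScalars [Algebra.IsAlgebraic k Ω] :
    Continuous fun σ : Gal(Ω/K) => (σ.restrictScalars k : Gal(Ω/k)) := by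
  let f : Gal(Ω/K) →* Gal(Ω/k) :=
    { toFun := fun σ => σ.restrictScalars k, map_one' := rfl, map_mul' := fun _ _ => rfl }
  refine continuous_of_continuousAt_one f (continuousAt_def.2 fun U hU => ?_)
  rw [map_one, krullTopology_mem_nhds_one_iff] at hU
  obtain ⟨E, hE, hEU⟩ := hU
  obtain ⟨S, hS⟩ := IntermediateField.fg_of_fg_toSubalgebra E
    (Subalgebra.fg_of_fg_toSubmodule (Module.Finite.iff_fg.1 hE))
  rw [krullTopology_mem_nhds_one_iff]
  refine ⟨IntermediateField.adjoin K (S : Set Ω), ?_, fun σ hσ => hEU ?_⟩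
  · exact IntermediateField.finiteDimensional_adjoin fun x _ =>
      (Algebra.IsIntegral.isIntegral (R := k) x).tower_top
  · rw [SetLike.mem_coe, IntermediateField.mem_fixingSubgroup_iff] at hσ ⊢
    intro x hx
    refine hσ x ?_
    have h1 : E ≤ (IntermediateField.adjoin K (S : Set Ω)).restrictScalars k := by
      rw [← hS]
      exact IntermediateField.adjoin_le_iff.2 (IntermediateField.subset_adjoin K _)
    exact h1 hx

theorem restrictCochain_mem_cocycles [Algebra.IsAlgebraic k Ω] (h : W' = W.map (algebraMap k K))
    {c : Gal(Ω/k) → Pts W Ω} (hc : c ∈ cocycles W Ω) :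
    restrictCochain h c ∈ cocycles W' Ω := by
  refine ⟨?_, fun σ τ => ?_⟩
  · have hcont : Continuous fun σ : Gal(Ω/K) => (σ.restrictScalars k : Gal(Ω/k)) := by
      exact continuous_restrictScalars
    exact (hc.1.comp_continuous hcont).comp _
  · change mapPts _ _ _ _ (c (σ.restrictScalars k * τ.restrictScalars k)) = _
    rw [hc.2, map_add, mapPts_id_ptsMap h]
    rfl

theorem restrictCochain_mem_coboundaries (h : W' = W.map (algebraMap k K))
    {c : Gal(Ω/k) → Pts W Ω} (hc : c ∈ coboundaries W Ω) :
    restrictCochain h c ∈ coboundaries W' Ω := by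
  obtain ⟨P, hP⟩ := hc
  refine ⟨mapPts (RingHom.id Ω) _ _ (baseChange_eq_map_id h) P, fun σ => ?_⟩
  change mapPts _ _ _ _ _ = _
  rw [hP, map_sub, mapPts_id_ptsMap h]

/-- An element of an extension of an algebraically closed field which is algebraic over it lies
in it. -/
theorem mem_range_of_isIntegral {A R : Type*} [Field A] [Field R] {f : A →+* R} [IsAlgClosed A]
    {k : Type*} [Field k] [Algebra k A] [Algebra k R] (hf : ∀ x, f (algebraMap k A x) = algebraMap k R x)
    {y : R} (hy : IsIntegral k y) : y ∈ Set.range f := by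
  let _ := f.toAlgebra
  have : IsScalarTower k A R := .of_algebraMap_eq fun x => (hf x).symm
  have h1 : IsIntegral A y := hy.tower_top
  exact minpoly.mem_range_of_degree_eq_one A y
    (IsAlgClosed.degree_eq_one_of_irreducible A (minpoly.irreducible h1))

/-- Restriction preserves local triviality. -/
theorem restrictCochain_mem_locallyTrivial [Algebra.IsAlgebraic k Ω]
    (h : W' = W.map (algebraMap k K)) {L₀ L : Type*} [Field L₀] [Field L] [Algebra k L₀]
    [Algebra K L] (j : L₀ →+* L)
    (hj : ∀ x, j (algebraMap k L₀ x) = algebraMap K L (algebraMap k K x))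
    {c : Gal(Ω/k) → Pts W Ω} (hc : c ∈ locallyTrivial W Ω L₀) :
    restrictCochain h c ∈ locallyTrivial W' Ω L := by
  intro ι
  let A := AlgebraicClosure L₀
  let R := AlgebraicClosure L
  let _ : Algebra L₀ R := ((algebraMap L R).comp j).toAlgebra
  -- The embedding of completions is extended to algebraic closures. The image of A contains
  -- everything algebraic over k or over L₀; hence both the embedding ι of Ω and the automorphism σ
  -- descend to A, as ι' and σ', and local triviality over L₀ can be applied to them.
  let J : A →ₐ[L₀] R := IsAlgClosed.lift
  have hJk : ∀ x : k, J (algebraMap k A x) = algebraMap K R (algebraMap k K x) := by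
    intro x
    rw [IsScalarTower.algebraMap_apply k L₀ A, J.commutes, IsScalarTower.algebraMap_apply K L R,
      ← hj]
    rfl
  let _ : Algebra k R := ((algebraMap K R).comp (algebraMap k K)).toAlgebra
  have : IsScalarTower k K R := .of_algebraMap_eq fun x => rfl
  have hιrange : ∀ x : Ω, ι x ∈ Set.range J := by
    intro x
    refine mem_range_of_isIntegral (f := (J : A →+* R)) (k := k) hJk ?_
    exact (Algebra.IsIntegral.isIntegral (R := k) x).map (ι.restrictScalars k)
  let Jk : A →ₐ[k] R := { (J : A →+* R) with commutes' := hJk }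
  let e := AlgEquiv.ofInjectiveField Jk
  let ι' : Ω →ₐ[k] A := (e.symm : Jk.range →ₐ[k] A).comp
    ((ι.restrictScalars k).codRestrict Jk.range hιrange)
  have hι' : ∀ x, J (ι' x) = ι x := by
    intro x
    exact congrArg Subtype.val (e.apply_symm_apply
      ((ι.restrictScalars k).codRestrict Jk.range hιrange x))
  obtain ⟨P, hP⟩ := hc ι'
  have hcurve : W'.baseChange R = (W.baseChange A).map (J : A →+* R) := by
    subst h
    rw [WeierstrassCurve.baseChange, WeierstrassCurve.baseChange, WeierstrassCurve.map_map,
      WeierstrassCurve.map_map]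
    congr 1
    ext x
    exact (hJk x).symm
  refine ⟨mapPts (J : A →+* R) _ _ hcurve P, fun σ τ hστ => ?_⟩
  have hσrange : ∀ x : A, σ (J x) ∈ Set.range J := by
    intro x
    refine mem_range_of_isIntegral (f := (J : A →+* R)) (k := L₀) J.commutes ?_
    have h1 : IsIntegral L₀ x := Algebra.IsIntegral.isIntegral x
    have h2 : IsIntegral L₀ (J x) := h1.map J
    let σ₀ : R →ₐ[L₀] R :=
      { ((σ : R →ₐ[L] R) : R →+* R) with commutes' := fun x => σ.commutes (j x) }
    exact h2.map σ₀
  let eL := AlgEquiv.ofInjectiveField J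
  let σJ : A →ₐ[L₀] R :=
    { (((σ : R →ₐ[L] R) : R →+* R).comp (J : A →+* R)) with
      commutes' := fun x => (congrArg σ (J.commutes x)).trans (σ.commutes (j x)) }
  let σ₁ : A →ₐ[L₀] A := (eL.symm : J.range →ₐ[L₀] A).comp (σJ.codRestrict J.range hσrange)
  let σ' : Gal(A/L₀) := AlgEquiv.ofBijective σ₁ (Algebra.IsAlgebraic.algHom_bijective σ₁)
  have hσ' : ∀ x, J (σ' x) = σ (J x) := by
    intro x
    exact congrArg Subtype.val (eL.apply_symm_apply (σJ.codRestrict J.range hσrange x))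
  have key := hP σ' (τ.restrictScalars k) (fun x => J.injective (by
    change J _ = J _
    rw [hσ', hι', hι', hστ]
    rfl))
  have key2 := congrArg (mapPts (J : A →+* R) _ _ hcurve) key
  rw [map_sub] at key2
  have hcurve2 : W'.baseChange R = (W.baseChange Ω).map (ι : Ω →+* R) := by
    rw [← WeierstrassCurve.map_baseChange W' ι, baseChange_eq_map_id h, WeierstrassCurve.map_id]
  have hcurve3 : W'.baseChange R = (W.baseChange A).map (σJ : A →+* R) := by
    have h1 : (W.baseChange A).map (σJ : A →+* R) =
        ((W.baseChange A).map (J : A →+* R)).map ((σ : R →ₐ[L] R) : R →+* R) := by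
      rw [WeierstrassCurve.map_map]
      rfl
    rw [h1, ← hcurve, WeierstrassCurve.baseChange, WeierstrassCurve.map_map]
    congr 1
    ext x
    exact (((σ : R →ₐ[L] R).restrictScalars K).commutes x).symm
  convert key2 using 1
  · change ptsMap W' ι (mapPts (RingHom.id Ω) _ _ _ (c (τ.restrictScalars k))) = _
    rw [ptsMap_eq_mapPts, ptsMap_eq_mapPts,
      mapPts_mapPts _ _ (ι : Ω →+* R) _ _ hcurve2 fun x => rfl,
      mapPts_mapPts (ι' : Ω →+* A) (J : A →+* R) (ι : Ω →+* R) _ hcurve hcurve2 hι']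
  · congr 1
    rw [ptsMap_eq_mapPts, ptsMap_eq_mapPts,
      mapPts_mapPts (J : A →+* R) _ (σJ : A →+* R) hcurve _ hcurve3 fun x => rfl,
      mapPts_mapPts _ (J : A →+* R) (σJ : A →+* R) _ hcurve hcurve3 hσ']

/-- A cocycle whose restriction to a subgroup of finite index `n` is a coboundary is killed
by `n`. -/
theorem index_nsmul_mem_coboundaries {c : Gal(Ω/k) → Pts W Ω} (hc : c ∈ cocycles W Ω)
    (H : Subgroup Gal(Ω/k)) [H.FiniteIndex] {P : Pts W Ω}
    (hP : ∀ σ ∈ H, c σ = ptsMap W (σ : Ω →ₐ[k] Ω) P - P) :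
    H.index • c ∈ coboundaries W Ω := by
  -- Subtracting the coboundary of P gives a cocycle vanishing on H, which therefore factors through
  -- the cosets of H.
  let d : Gal(Ω/k) → Pts W Ω := fun σ => c σ - (ptsMap W (σ : Ω →ₐ[k] Ω) P - P)
  have hd : ∀ σ τ, d (σ * τ) = d σ + ptsMap W (σ : Ω →ₐ[k] Ω) (d τ) := by
    intro σ τ
    simp only [d]
    rw [hc.2, ptsMap_comp]
    simp only [map_sub, AddMonoidHom.comp_apply]
    abel
  have hdH : ∀ σ ∈ H, d σ = 0 := fun σ hσ => by simp only [d, hP σ hσ, sub_self]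
  let D : Gal(Ω/k) ⧸ H → Pts W Ω := Quotient.lift d (by
    intro a b hab
    have hmem : a⁻¹ * b ∈ H := QuotientGroup.leftRel_apply.1 hab
    have := hd a (a⁻¹ * b)
    rw [hdH _ hmem, map_zero, add_zero, mul_inv_cancel_left] at this
    exact this.symm)
  have hD : ∀ (σ : Gal(Ω/k)) (x : Gal(Ω/k) ⧸ H),
      D (σ • x) = d σ + ptsMap W (σ : Ω →ₐ[k] Ω) (D x) := by
    intro σ x
    induction x using QuotientGroup.induction_on with | H x => exact hd σ x
  let _ : Fintype (Gal(Ω/k) ⧸ H) := Fintype.ofFinite _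
  have hcard : Fintype.card (Gal(Ω/k) ⧸ H) = H.index := by
    rw [← Nat.card_eq_fintype_card]
    rfl
  -- Summing D(σx) = d(σ) + σD(x) over all cosets exhibits [G : H]·d as the coboundary of −∑ D; the
  -- term [G : H]·P restores the coboundary removed above.
  refine ⟨H.index • P - ∑ x, D x, fun σ => ?_⟩
  have h1 : ∑ x, D x = H.index • d σ + ptsMap W (σ : Ω →ₐ[k] Ω) (∑ x, D x) := by
    conv_lhs => rw [← Equiv.sum_comp (MulAction.toPerm σ)]
    simp only [MulAction.toPerm_apply, hD, Finset.sum_add_distrib, Finset.sum_const,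
      Finset.card_univ, hcard, map_sum]
  have h2 : ptsMap W (σ : Ω →ₐ[k] Ω) (∑ x, D x) = ∑ x, D x - H.index • d σ := by
    rw [eq_sub_iff_add_eq', ← h1]
  rw [map_sub, h2, map_nsmul]
  simp only [d, Pi.smul_apply, smul_sub]
  abel

end Restriction

end ArtinBSD


namespace ArtinBSD

/-! ### Maps between completions -/

section Completion

open WithZero

variable {K L : Type*} [Field K] [NumberField K] [Field L] [NumberField L] [Algebra K L]
  (w : HeightOneSpectrum (𝓞 L))

/-- The place of `K` below a finite place of `L`. -/
noncomputable abbrev placeBelow (K : Type*) [Field K] [NumberField K] {L : Type*} [Field L]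
    [NumberField L] [Algebra K L] (w : HeightOneSpectrum (𝓞 L)) : HeightOneSpectrum (𝓞 K) :=
  w.under (𝓞 K)

theorem mem_placeBelow_iff (a : 𝓞 K) :
    a ∈ (placeBelow K w).asIdeal ↔ algebraMap (𝓞 K) (𝓞 L) a ∈ w.asIdeal := Iff.rfl

/-- A v-integral x is a quotient of global integers with denominator prime to v, and this
denominator stays prime to w. -/
theorem valuation_algebraMap_le_one {x : K} (hx : (placeBelow K w).valuation K x ≤ 1) :
    w.valuation L (algebraMap K L x) ≤ 1 := by
  obtain ⟨n, d, hnd⟩ := (placeBelow K w).exists_primeCompl_mul_eq_of_integer x hx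
  have h1 := congrArg (fun y => w.valuation L (algebraMap K L y)) hnd
  simp only [map_mul, ← IsScalarTower.algebraMap_apply (𝓞 K) K L] at h1
  rw [IsScalarTower.algebraMap_apply (𝓞 K) (𝓞 L) L, IsScalarTower.algebraMap_apply (𝓞 K) (𝓞 L) L,
    (w.valuation_eq_one_iff_notMem (K := L)).2
      (fun h => d.2 ((mem_placeBelow_iff w _).2 h)), mul_one] at h1
  rw [h1]
  exact w.valuation_le_one _

theorem valuation_algebraMap_lt_one {x : K} (hx : (placeBelow K w).valuation K x < 1) :
    w.valuation L (algebraMap K L x) < 1 := by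
  obtain ⟨n, d, hnd⟩ := (placeBelow K w).exists_primeCompl_mul_eq_of_integer x hx.le
  have h0 := congrArg ((placeBelow K w).valuation K) hnd
  rw [map_mul, ((placeBelow K w).valuation_eq_one_iff_notMem (K := K)).2 d.2, mul_one] at h0
  have hn : n ∈ (placeBelow K w).asIdeal :=
    ((placeBelow K w).valuation_lt_one_iff_mem (K := K) n).1 (h0 ▸ hx)
  have h1 := congrArg (fun y => w.valuation L (algebraMap K L y)) hnd
  simp only [map_mul, ← IsScalarTower.algebraMap_apply (𝓞 K) K L] at h1
  rw [IsScalarTower.algebraMap_apply (𝓞 K) (𝓞 L) L, IsScalarTower.algebraMap_apply (𝓞 K) (𝓞 L) L,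
    (w.valuation_eq_one_iff_notMem (K := L)).2
      (fun h => d.2 ((mem_placeBelow_iff w _).2 h)), mul_one] at h1
  rw [h1]
  exact (w.valuation_lt_one_iff_mem _).2 ((mem_placeBelow_iff w _).1 hn)

/-- The embedding of `K`, with its `v`-adic topology, into `L_w`. -/
noncomputable def withValMap :
    WithVal ((placeBelow K w).valuation K) →+* w.adicCompletion L :=
  (algebraMap L (w.adicCompletion L)).comp
    ((algebraMap K L).comp (WithVal.equiv ((placeBelow K w).valuation K)).toRingHom)

theorem norm_algebraMap_lt_one_iff (x : L) :
    ‖algebraMap L (w.adicCompletion L) x‖ < 1 ↔ w.valuation L x < 1 := by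
  rw [Valued.toNormedField.norm_lt_one_iff, ← HeightOneSpectrum.valuedAdicCompletion_eq_valuation']
  rfl

theorem norm_algebraMap_le_one_iff (x : L) :
    ‖algebraMap L (w.adicCompletion L) x‖ ≤ 1 ↔ w.valuation L x ≤ 1 := by
  rw [Valued.toNormedField.norm_le_one_iff, ← HeightOneSpectrum.valuedAdicCompletion_eq_valuation']
  rfl

/-- An element smaller than π^m is π^m times a v-integer. Integers stay integral at w, and the image
of the uniformizer π has norm less than 1, so a large m gives any prescribed smallness. -/
theorem continuous_withValMap : Continuous (withValMap (K := K) w) := by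
  refine continuous_of_continuousAt_zero (withValMap (K := K) w) ?_
  rw [ContinuousAt, map_zero, Metric.tendsto_nhds]
  intro ε hε
  obtain ⟨π, hπ⟩ := (placeBelow K w).valuation_exists_uniformizer K
  have hπ1 : (placeBelow K w).valuation K π < 1 := by
    rw [hπ, ← exp_zero, exp_lt_exp]; norm_num
  have hπ0 : (placeBelow K w).valuation K π ≠ 0 := by rw [hπ]; exact exp_ne_zero
  have hn := (norm_algebraMap_lt_one_iff w _).2 (valuation_algebraMap_lt_one w hπ1)
  obtain ⟨m, hm⟩ := exists_pow_lt_of_lt_one hε hn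
  have hπm : (placeBelow K w).valuation K (π ^ m) ≠ 0 := by
    rw [map_pow]; exact pow_ne_zero _ hπ0
  have hπm' : π ^ m ≠ 0 := (Valuation.ne_zero_iff _).1 hπm
  let π' : WithVal ((placeBelow K w).valuation K) := (WithVal.equiv _).symm (π ^ m)
  have hv : (Valued.v.restrict π') ≠ 0 := by
    simpa [Valuation.restrict_eq_zero_iff, Valuation.ne_zero_iff, π'] using hπm'
  refine (Valued.mem_nhds_zero).2 ⟨Units.mk0 _ hv, fun x hx => ?_⟩
  simp only [Units.val_mk0, Set.mem_ofPred_eq, Valuation.restrict_lt_iff] at hx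
  have hx' : (placeBelow K w).valuation K (WithVal.equiv _ x) <
      (placeBelow K w).valuation K (π ^ m) := hx
  set y := WithVal.equiv ((placeBelow K w).valuation K) x
  have hy : (placeBelow K w).valuation K (y / π ^ m) ≤ 1 := by
    rw [map_div₀]
    exact (div_le_one₀ (zero_lt_iff.2 hπm)).2 hx'.le
  have h3 := (norm_algebraMap_le_one_iff w _).2 (valuation_algebraMap_le_one w hy)
  have h4 : withValMap w x = algebraMap L (w.adicCompletion L) (algebraMap K L π) ^ m *
      algebraMap L (w.adicCompletion L) (algebraMap K L (y / π ^ m)) := by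
    rw [← map_pow, ← map_pow, ← map_mul, ← map_mul, mul_div_cancel₀ _ hπm']
    rfl
  change dist (withValMap w x) 0 < ε
  rw [dist_zero_right, h4, norm_mul, norm_pow]
  calc _ ≤ ‖(algebraMap L (HeightOneSpectrum.adicCompletion L w)) ((algebraMap K L) π)‖ ^ m * 1 := by
        gcongr
    _ < ε := by rwa [mul_one]

/-- The map `K_v → L_w` of completions, for `v` below `w`. -/
noncomputable def adicCompletionMap :
    (placeBelow K w).adicCompletion K →+* w.adicCompletion L :=
  (UniformSpace.Completion.extensionHom (withValMap (K := K) w) (continuous_withValMap w)).comp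
    (HeightOneSpectrum.adicCompletion.equiv K (placeBelow K w)).toRingHom

theorem continuous_adicCompletionMap : Continuous (adicCompletionMap (K := K) w) :=
  UniformSpace.Completion.continuous_extension.comp
    (HeightOneSpectrum.adicCompletion.continuous_toCompletion K (placeBelow K w))

theorem adicCompletionMap_algebraMap (x : K) :
    adicCompletionMap w (algebraMap K ((placeBelow K w).adicCompletion K) x) =
      algebraMap L (w.adicCompletion L) (algebraMap K L x) :=
  UniformSpace.Completion.extensionHom_coe (withValMap (K := K) w) (continuous_withValMap w)
    ((WithVal.equiv ((placeBelow K w).valuation K)).symm x)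

end Completion

/-! ### Continuous homomorphisms of normed fields. -/

section ContinuousRingHom

variable {k l : Type*} [NormedField k] [NormedField l] {j : k →+* l}

/-- An element has norm less than 1 exactly when its powers tend to 0, and continuity preserves
this. -/
theorem norm_map_lt_one (hj : Continuous j) {x : k} (hx : ‖x‖ < 1) : ‖j x‖ < 1 := by
  have h1 := (hj.tendsto 0).comp (tendsto_pow_atTop_nhds_zero_of_norm_lt_one hx)
  rw [map_zero] at h1
  obtain ⟨n, hn⟩ := ((Metric.tendsto_nhds.1 h1 1 one_pos).and
    (Filter.eventually_ge_atTop 1)).exists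
  simp only [Function.comp_apply, dist_zero_right, map_pow, norm_pow] at hn
  by_contra! h
  exact hn.1.not_ge (one_le_pow₀ h)

/-- If ‖j x‖ > 1, the elements j(xⁿπ) are unbounded, although every xⁿπ has norm less than 1. -/
theorem norm_map_le_one (hk : ∃ π : k, 0 < ‖π‖ ∧ ‖π‖ < 1) (hj : Continuous j) {x : k}
    (hx : ‖x‖ ≤ 1) : ‖j x‖ ≤ 1 := by
  obtain ⟨π, h0, h1⟩ := hk
  by_contra! h
  have h2 : ∀ n : ℕ, ‖j x‖ ^ n * ‖j π‖ < 1 := fun n => by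
    rw [← norm_pow, ← map_pow, ← norm_mul, ← map_mul]
    refine norm_map_lt_one hj ?_
    rw [norm_mul, norm_pow]
    exact (mul_le_of_le_one_left (norm_nonneg _) (pow_le_one₀ (norm_nonneg _) hx)).trans_lt h1
  have hπ : 0 < ‖j π‖ := norm_pos_iff.2 ((map_ne_zero j).2 (norm_pos_iff.1 h0))
  obtain ⟨n, hn⟩ := pow_unbounded_of_one_lt ‖j π‖⁻¹ h
  have := h2 n
  rw [inv_lt_iff_one_lt_mul₀ hπ] at hn
  linarith [mul_comm ‖j π‖ (‖j x‖ ^ n)]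

theorem norm_map_lt_one_iff (hk : ∃ π : k, 0 < ‖π‖ ∧ ‖π‖ < 1) (hj : Continuous j) {x : k} :
    ‖j x‖ < 1 ↔ ‖x‖ < 1 := by
  refine ⟨fun h => ?_, norm_map_lt_one hj⟩
  by_contra! h'
  have h0 : x ≠ 0 := norm_pos_iff.1 (one_pos.trans_le h')
  have := norm_map_le_one hk hj (x := x⁻¹) (by rw [norm_inv]; exact inv_le_one_of_one_le₀ h')
  rw [map_inv₀, norm_inv, inv_le_one₀ (norm_pos_iff.2 ((map_ne_zero j).2 h0))] at this
  linarith

end ContinuousRingHom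

/-! ### Integrality under the map K_v → L_w. -/

section Completion

variable {K L : Type*} [Field K] [NumberField K] [Field L] [NumberField L] [Algebra K L]
  (w : HeightOneSpectrum (𝓞 L))

theorem exists_norm_lt_one : ∃ π : w.adicCompletion L, 0 < ‖π‖ ∧ ‖π‖ < 1 := by
  obtain ⟨π, hπ⟩ := w.valuation_exists_uniformizer L
  refine ⟨algebraMap L (w.adicCompletion L) π, norm_pos_iff.2 ?_, ?_⟩
  · rw [map_ne_zero_iff _ (algebraMap L (w.adicCompletion L)).injective, ← (w.valuation L).ne_zero_iff,
      hπ]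
    exact WithZero.exp_ne_zero
  · rw [norm_algebraMap_lt_one_iff, hπ, ← WithZero.exp_zero, WithZero.exp_lt_exp]
    norm_num

theorem norm_adicCompletionMap_le_one {x : (placeBelow K w).adicCompletion K} (hx : ‖x‖ ≤ 1) :
    ‖adicCompletionMap w x‖ ≤ 1 :=
  norm_map_le_one (j := adicCompletionMap w) (exists_norm_lt_one (placeBelow K w))
    (continuous_adicCompletionMap w) hx

theorem norm_adicCompletionMap_lt_one_iff {x : (placeBelow K w).adicCompletion K} :
    ‖adicCompletionMap w x‖ < 1 ↔ ‖x‖ < 1 :=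
  norm_map_lt_one_iff (j := adicCompletionMap w) (exists_norm_lt_one (placeBelow K w))
    (continuous_adicCompletionMap w)

end Completion

end ArtinBSD


namespace ArtinBSD

/-! ### Points under a change of variables -/

section ChangeOfVariables

open WeierstrassCurve

variable {k : Type*} [Field k] (C : VariableChange k) (W : WeierstrassCurve k)

/-- The old `x`-coordinate in terms of the new one. -/
def changeX (x : k) : k := C.u ^ 2 * x + C.r

/-- The old `y`-coordinate in terms of the new ones. -/
def changeY (x y : k) : k := C.u ^ 3 * y + C.u ^ 2 * C.s * x + C.t

theorem changeX_injective : Function.Injective (changeX C) := by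
  intro x x' h
  have h : (C.u : k) ^ 2 * x + C.r = C.u ^ 2 * x' + C.r := h
  exact mul_left_cancel₀ (pow_ne_zero 2 C.u.ne_zero) (add_right_cancel h)

theorem equation_change_iff (x y : k) :
    W.toAffine.Equation (changeX C x) (changeY C x y) ↔ (C • W).toAffine.Equation x y := by
  have hu : (C.u : k) ≠ 0 := C.u.ne_zero
  rw [Affine.equation_iff', Affine.equation_iff']
  refine Iff.trans (iff_of_eq (congrArg (· = 0) ?_)) (mul_eq_zero_iff_left (pow_ne_zero 6 hu))
  simp only [changeX, changeY, variableChange_def, Units.val_inv_eq_inv_val]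
  field_simp
  ring

theorem polynomialY_change (x y : k) :
    2 * changeY C x y + W.a₁ * changeX C x + W.a₃ =
      C.u ^ 3 * (2 * y + (C • W).a₁ * x + (C • W).a₃) := by
  have hu : (C.u : k) ≠ 0 := C.u.ne_zero
  simp only [changeX, changeY, variableChange_def, Units.val_inv_eq_inv_val]
  field_simp
  ring

theorem polynomialX_change (x y : k) :
    W.a₁ * changeY C x y - (3 * changeX C x ^ 2 + 2 * W.a₂ * changeX C x + W.a₄) =
      C.u ^ 4 * ((C • W).a₁ * y - (3 * x ^ 2 + 2 * (C • W).a₂ * x + (C • W).a₄)) -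
        C.u ^ 3 * C.s * (2 * y + (C • W).a₁ * x + (C • W).a₃) := by
  have hu : (C.u : k) ≠ 0 := C.u.ne_zero
  simp only [changeX, changeY, variableChange_def, Units.val_inv_eq_inv_val]
  field_simp
  ring

theorem nonsingular_change_iff (x y : k) :
    W.toAffine.Nonsingular (changeX C x) (changeY C x y) ↔ (C • W).toAffine.Nonsingular x y := by
  have hu : (C.u : k) ≠ 0 := C.u.ne_zero
  rw [Affine.nonsingular_iff', Affine.nonsingular_iff', equation_change_iff, polynomialX_change,
    polynomialY_change]
  refine and_congr_right fun _ => ?_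
  rw [← not_iff_not]
  push Not
  constructor
  · rintro ⟨h1, h2⟩
    have h2' := (mul_eq_zero_iff_left (pow_ne_zero 3 hu)).1 h2
    rw [h2', mul_zero, sub_zero] at h1
    exact ⟨(mul_eq_zero_iff_left (pow_ne_zero 4 hu)).1 h1, h2'⟩
  · rintro ⟨h1, h2⟩
    rw [h1, h2]
    simp

theorem negY_change (x y : k) :
    W.toAffine.negY (changeX C x) (changeY C x y) = changeY C x ((C • W).toAffine.negY x y) := by
  have hu : (C.u : k) ≠ 0 := C.u.ne_zero
  simp only [Affine.negY, changeX, changeY, variableChange_def, Units.val_inv_eq_inv_val]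
  field_simp
  ring

theorem changeY_injective (x : k) : Function.Injective (changeY C x) := by
  intro y y' h
  have h : (C.u : k) ^ 3 * y + C.u ^ 2 * C.s * x + C.t =
    C.u ^ 3 * y' + C.u ^ 2 * C.s * x + C.t := h
  exact mul_left_cancel₀ (pow_ne_zero 3 C.u.ne_zero)
    (add_right_cancel (add_right_cancel h))

open scoped Classical in
-- With x = u²x' + r and y = u³y' + u²sx' + t, a line of slope λ in the new coordinates has slope uλ
-- + s in the old ones. The hypothesis excludes vertical lines.
theorem slope_change {x₁ x₂ y₁ y₂ : k} (h₁ : (C • W).toAffine.Equation x₁ y₁)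
    (h₂ : (C • W).toAffine.Equation x₂ y₂)
    (h : ¬ (x₁ = x₂ ∧ y₁ = (C • W).toAffine.negY x₂ y₂)) :
    W.toAffine.slope (changeX C x₁) (changeX C x₂) (changeY C x₁ y₁) (changeY C x₂ y₂) =
      C.u * (C • W).toAffine.slope x₁ x₂ y₁ y₂ + C.s := by
  have hu : (C.u : k) ≠ 0 := C.u.ne_zero
  by_cases hx : x₁ = x₂
  · subst hx
    have hy : y₁ ≠ (C • W).toAffine.negY x₁ y₂ := fun e => h ⟨rfl, e⟩
    obtain rfl := Affine.Y_eq_of_Y_ne h₁ h₂ rfl hy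
    have hy' : changeY C x₁ y₁ ≠ W.toAffine.negY (changeX C x₁) (changeY C x₁ y₁) := by
      rw [negY_change]
      exact fun e => hy (changeY_injective C x₁ e)
    rw [Affine.slope_of_Y_ne rfl hy, Affine.slope_of_Y_ne rfl hy']
    have e1 : changeY C x₁ y₁ - W.toAffine.negY (changeX C x₁) (changeY C x₁ y₁) =
        C.u ^ 3 * (y₁ - (C • W).toAffine.negY x₁ y₁) := by
      rw [negY_change]; simp only [changeY]; ring
    have hd : y₁ - (C • W).toAffine.negY x₁ y₁ ≠ 0 := sub_ne_zero.2 hy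
    have e2 := polynomialX_change C W x₁ y₁
    have e3 : 2 * y₁ + (C • W).a₁ * x₁ + (C • W).a₃ = y₁ - (C • W).toAffine.negY x₁ y₁ := by
      simp only [Affine.negY]; ring
    rw [e3] at e2
    rw [e1]
    field_simp
    linear_combination -e2
  · have hx' : changeX C x₁ ≠ changeX C x₂ := fun e => hx (changeX_injective C e)
    rw [Affine.slope_of_X_ne hx, Affine.slope_of_X_ne hx']
    have e1 : changeX C x₁ - changeX C x₂ = C.u ^ 2 * (x₁ - x₂) := by simp only [changeX]; ring
    have hd : x₁ - x₂ ≠ 0 := sub_ne_zero.2 hx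
    rw [e1]
    simp only [changeY]
    field_simp
    ring

theorem addX_change (x₁ x₂ l : k) :
    W.toAffine.addX (changeX C x₁) (changeX C x₂) (C.u * l + C.s) =
      changeX C ((C • W).toAffine.addX x₁ x₂ l) := by
  have hu : (C.u : k) ≠ 0 := C.u.ne_zero
  simp only [Affine.addX, changeX, variableChange_def, Units.val_inv_eq_inv_val]
  field_simp
  ring

theorem addY_change (x₁ x₂ y₁ l : k) :
    W.toAffine.addY (changeX C x₁) (changeX C x₂) (changeY C x₁ y₁) (C.u * l + C.s) =
      changeY C ((C • W).toAffine.addX x₁ x₂ l) ((C • W).toAffine.addY x₁ x₂ y₁ l) := by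
  have hu : (C.u : k) ≠ 0 := C.u.ne_zero
  rw [Affine.addY, Affine.negAddY, Affine.addY, addX_change, ← negY_change]
  congr 1
  simp only [Affine.negAddY, changeX, changeY]
  ring

open scoped Classical in
/-- The isomorphism of a Weierstrass curve with its transform, on points. -/
noncomputable def changePts : Points (C • W) →+ Points W where
  toFun
    | .zero => (0 : W.toAffine.Point)
    | .some x y h => (.some (changeX C x) (changeY C x y) ((nonsingular_change_iff C W x y).2 h) :
        W.toAffine.Point)
  map_zero' := rfl
  map_add' := by
    rintro (_ | ⟨x₁, y₁, h₁⟩) (_ | ⟨x₂, y₂, h₂⟩)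
    · rfl
    · rfl
    · rfl
    · by_cases h : x₁ = x₂ ∧ y₁ = (C • W).toAffine.negY x₂ y₂
      · have h' : changeX C x₁ = changeX C x₂ ∧
            changeY C x₁ y₁ = W.toAffine.negY (changeX C x₂) (changeY C x₂ y₂) := by
          rw [negY_change, h.1, h.2]; exact ⟨rfl, rfl⟩
        have e1 : (Affine.Point.some x₁ y₁ h₁ + Affine.Point.some x₂ y₂ h₂ :
          (C • W).toAffine.Point) = 0 := Affine.Point.add_of_Y_eq h.1 h.2
        have e2 := Affine.Point.add_of_Y_eq (W := W.toAffine)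
          (h₁ := (nonsingular_change_iff C W x₁ y₁).2 h₁)
          (h₂ := (nonsingular_change_iff C W x₂ y₂).2 h₂) h'.1 h'.2
        refine Eq.trans ?_ e2.symm
        erw [e1]
      · have h' : ¬ (changeX C x₁ = changeX C x₂ ∧
            changeY C x₁ y₁ = W.toAffine.negY (changeX C x₂) (changeY C x₂ y₂)) := by
          rintro ⟨a, b⟩
          obtain rfl := changeX_injective C a
          rw [negY_change] at b
          exact h ⟨rfl, changeY_injective C _ b⟩
        have e1 : (Affine.Point.some x₁ y₁ h₁ + Affine.Point.some x₂ y₂ h₂ :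
          (C • W).toAffine.Point) = _ := Affine.Point.add_some h
        have e2 := Affine.Point.add_some (W := W.toAffine)
          (h₁ := (nonsingular_change_iff C W x₁ y₁).2 h₁)
          (h₂ := (nonsingular_change_iff C W x₂ y₂).2 h₂) h'
        refine Eq.trans ?_ e2.symm
        erw [e1]
        refine (Affine.Point.some.injEq ..).mpr ?_
        rw [slope_change C W h₁.1 h₂.1 h, addX_change, addY_change]
        exact ⟨rfl, rfl⟩

theorem changePts_surjective : Function.Surjective (changePts C W) := by
  have hu : (C.u : k) ≠ 0 := C.u.ne_zero
  rintro (_ | ⟨x, y, h⟩)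
  · exact ⟨0, rfl⟩
  · obtain ⟨x', rfl⟩ : ∃ x', changeX C x' = x :=
      ⟨(x - C.r) / C.u ^ 2, by simp only [changeX]; field_simp; ring⟩
    obtain ⟨y', rfl⟩ : ∃ y', changeY C x' y' = y :=
      ⟨(y - C.t - C.u ^ 2 * C.s * x') / C.u ^ 3, by simp only [changeY]; field_simp; ring⟩
    exact ⟨(.some x' y' ((nonsingular_change_iff C W x' y').1 h) : (C • W).toAffine.Point), rfl⟩

end ChangeOfVariables

end ArtinBSD


namespace ArtinBSD

/-! ### Minimal Weierstrass equations -/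

section Minimal

open WeierstrassCurve Polynomial

variable (R : Type*) [CommRing R] [IsDomain R] [IsDiscreteValuationRing R]
variable {k : Type*} [Field k] [Algebra R k] [IsFractionRing R k]

/-- The normalised valuation of a discretely valued field. -/
noncomputable abbrev dvrVal (k : Type*) [Field k] [Algebra R k] [IsFractionRing R k] :
    Valuation k (WithZero (Multiplicative ℤ)) :=
  (IsDiscreteValuationRing.maximalIdeal R).valuation k

variable {R}

theorem dvrVal_le_one_iff {x : k} : dvrVal R k x ≤ 1 ↔ x ∈ Set.range (algebraMap R k) := by
  constructor
  · intro h
    obtain ⟨a, rfl⟩ := IsDiscreteValuationRing.exists_lift_of_le_one h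
    exact ⟨a, rfl⟩
  · rintro ⟨a, rfl⟩
    exact HeightOneSpectrum.valuation_le_one _ _

theorem dvrVal_lt_one_iff {a : R} :
    dvrVal R k (algebraMap R k a) < 1 ↔ a ∈ IsLocalRing.maximalIdeal R :=
  HeightOneSpectrum.valuation_lt_one_iff_mem _ _

theorem dvrVal_eq_one_iff {a : R} : dvrVal R k (algebraMap R k a) = 1 ↔ IsUnit a := by
  rw [← IsLocalRing.notMem_maximalIdeal, ← dvrVal_lt_one_iff (k := k), not_lt]
  exact ⟨fun h => h.ge, fun h => le_antisymm (HeightOneSpectrum.valuation_le_one _ _) h⟩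

/-- A discrete valuation ring is integrally closed. This shape and the quartic one below are the
monic equations satisfied by the parameters of a change of variables. -/
theorem mem_range_of_sq_eq {x : k} {b c : R}
    (h : x ^ 2 = algebraMap R k b * x + algebraMap R k c) : x ∈ Set.range (algebraMap R k) := by
  refine IsIntegrallyClosed.isIntegral_iff.1 ⟨X ^ 2 - C b * X - C c, by monicity!, ?_⟩
  simp [h]

theorem mem_range_of_pow_four_eq {x : k} {b c d : R}
    (h : x ^ 4 = algebraMap R k b * x ^ 2 + algebraMap R k c * x + algebraMap R k d) :
    x ∈ Set.range (algebraMap R k) := by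
  refine IsIntegrallyClosed.isIntegral_iff.1
    ⟨X ^ 4 - C b * X ^ 2 - C c * X - C d, by monicity!, ?_⟩
  simp [h]
  ring

theorem valuation_Δ_le_of_isMinimal (W : WeierstrassCurve k) [W.IsMinimal R]
    (C : VariableChange k) (h : (C • W).IsIntegral R) :
    dvrVal R k (C • W).Δ ≤ dvrVal R k W.Δ := by
  by_contra! hlt
  have hm := (IsMinimal.val_Δ_maximal (R := R) (W := W)).2 (j := C) h
  have e1 := valuation_Δ_aux_eq_of_isIntegral R W
  have e2 := valuation_Δ_aux_eq_of_isIntegral R (C • W)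
  simp only [one_smul] at hm
  rw [← Subtype.coe_le_coe, ← Subtype.coe_le_coe, e1, e2] at hm
  exact (hm hlt.le).not_gt hlt

/-- Each discriminant is minimal against the other, so they have the same valuation, while they
differ by the factor u⁻¹². -/
theorem valuation_u_eq_one_of_isMinimal {W : WeierstrassCurve k} (hΔ : W.Δ ≠ 0)
    (C : VariableChange k) [W.IsMinimal R] [(C • W).IsMinimal R] :
    dvrVal R k (C.u : k) = 1 := by
  have h1 := valuation_Δ_le_of_isMinimal (R := R) W C inferInstance
  have h2 := valuation_Δ_le_of_isMinimal (R := R) (C • W) C⁻¹ (by rw [inv_smul_smul]; infer_instance)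
  rw [inv_smul_smul] at h2
  have h3 := le_antisymm h1 h2
  have h4 : dvrVal R k W.Δ ≠ 0 := (Valuation.ne_zero_iff _).2 hΔ
  rw [variableChange_Δ, map_mul, map_pow, Units.val_inv_eq_inv_val, map_inv₀] at h3
  have h5 := mul_right_cancel₀ h4 (h3.trans (one_mul _).symm)
  rw [inv_pow, inv_eq_one] at h5
  exact (pow_eq_one_iff_of_nonneg zero_le (by norm_num)).1 h5

/-- A change of variables between minimal equations is integral. -/
theorem exists_variableChange_of_isMinimal {W : WeierstrassCurve k} (hΔ : W.Δ ≠ 0)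
    (C : VariableChange k) [W.IsMinimal R] [(C • W).IsMinimal R] :
    ∃ C' : VariableChange R, C'.map (algebraMap R k) = C := by
  have hu := valuation_u_eq_one_of_isMinimal (R := R) hΔ C
  obtain ⟨u, hu'⟩ := dvrVal_le_one_iff.1 hu.le
  have huu : IsUnit u := dvrVal_eq_one_iff.1 (hu' ▸ hu)
  have hu0 : (C.u : k) ≠ 0 := C.u.ne_zero
  have a1 := integralModel_a₁_eq R W
  have a2 := integralModel_a₂_eq R W
  have a3 := integralModel_a₃_eq R W
  have a4 := integralModel_a₄_eq R W
  have a6 := integralModel_a₆_eq R W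
  have b2 := integralModel_b₂_eq R W
  have b4 := integralModel_b₄_eq R W
  have b6 := integralModel_b₆_eq R W
  have b8 := integralModel_b₈_eq R W
  have a2' := integralModel_a₂_eq R (C • W)
  have a6' := integralModel_a₆_eq R (C • W)
  have b6' := integralModel_b₆_eq R (C • W)
  have b8' := integralModel_b₈_eq R (C • W)
  generalize integralModel R W = I at *
  generalize integralModel R (C • W) = I' at *
  rw [variableChange_a₂, Units.val_inv_eq_inv_val] at a2'
  rw [variableChange_a₆, Units.val_inv_eq_inv_val] at a6'
  rw [variableChange_b₆, Units.val_inv_eq_inv_val] at b6'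
  rw [variableChange_b₈, Units.val_inv_eq_inv_val] at b8'
  have a2' := (eq_inv_mul_iff_mul_eq₀ (pow_ne_zero 2 hu0)).1 (inv_pow (C.u : k) _ ▸ a2')
  have a6' := (eq_inv_mul_iff_mul_eq₀ (pow_ne_zero 6 hu0)).1 (inv_pow (C.u : k) _ ▸ a6')
  have b6' := (eq_inv_mul_iff_mul_eq₀ (pow_ne_zero 6 hu0)).1 (inv_pow (C.u : k) _ ▸ b6')
  have b8' := (eq_inv_mul_iff_mul_eq₀ (pow_ne_zero 8 hu0)).1 (inv_pow (C.u : k) _ ▸ b8')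
  rw [← hu'] at a2' a6' b6' b8'
  -- Subtracting the law for b₈ from r times the law for b₆ leaves a monic quartic in r, whatever
  -- the residue characteristic. The laws for a₂ and a₆ then give monic quadratics for s and t.
  obtain ⟨r, hr⟩ : C.r ∈ Set.range (algebraMap R k) := by
    refine mem_range_of_pow_four_eq (b := I.b₄) (c := 2 * I.b₆ + u ^ 6 * I'.b₆)
      (d := I.b₈ - u ^ 8 * I'.b₈) ?_
    simp only [map_add, map_sub, map_mul, map_pow, b4, b6, b8, map_ofNat]
    linear_combination (-C.r) * b6' + b8'
  obtain ⟨s, hs⟩ : C.s ∈ Set.range (algebraMap R k) := by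
    refine mem_range_of_sq_eq (b := -I.a₁) (c := I.a₂ + 3 * r - u ^ 2 * I'.a₂) ?_
    simp only [map_add, map_sub, map_mul, map_pow, map_neg, a1, a2, hr, map_ofNat]
    linear_combination a2'
  obtain ⟨t, ht⟩ : C.t ∈ Set.range (algebraMap R k) := by
    refine mem_range_of_sq_eq (b := -I.a₃ - r * I.a₁)
      (c := I.a₆ + r * I.a₄ + r ^ 2 * I.a₂ + r ^ 3 - u ^ 6 * I'.a₆) ?_
    simp only [map_add, map_sub, map_mul, map_pow, map_neg, a1, a2, a3, a4, a6, hr]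
    linear_combination a6'
  refine ⟨⟨huu.unit, r, s, t⟩, ?_⟩
  ext
  · exact hu'
  · exact hr
  · exact hs
  · exact ht

/-- A change of variables between minimal equations respects points of non-singular reduction. -/
theorem changePts_mem_nonsingularReductionSet {W : WeierstrassCurve k} (hΔ : W.Δ ≠ 0)
    (C : VariableChange k) [W.IsMinimal R] [(C • W).IsMinimal R] {P : Points (C • W)}
    (hP : P ∈ nonsingularReductionSet R (C • W)) :
    changePts C W P ∈ nonsingularReductionSet R W := by
  obtain ⟨C', rfl⟩ := exists_variableChange_of_isMinimal (R := R) hΔ C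
  intro X Y h e
  obtain _ | ⟨x, y, hn⟩ := P
  · cases e
  have e' := (Affine.Point.some.injEq ..).mp e
  rcases hP x y hn rfl with hx | ⟨a, b, ha, hb, hab⟩
  · left
    rintro ⟨A, hA⟩
    refine hx ⟨C'.u⁻¹ ^ 2 * (A - C'.r), ?_⟩
    rw [map_mul, map_sub, hA, ← e'.1]
    have h1 : (algebraMap R k ↑C'.u⁻¹) * algebraMap R k C'.u = 1 := by
      rw [← map_mul, Units.inv_mul, map_one]
    change algebraMap R k (C'.u⁻¹ ^ 2) * (algebraMap R k C'.u ^ 2 * x + algebraMap R k C'.r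
      - algebraMap R k C'.r) = x
    rw [map_pow]
    linear_combination (algebraMap R k ↑C'.u⁻¹ * algebraMap R k C'.u + 1) * x * h1
  · right
    refine ⟨C'.u ^ 2 * a + C'.r, C'.u ^ 3 * b + C'.u ^ 2 * C'.s * a + C'.t, ?_, ?_, ?_⟩
    · rw [← e'.1, ← ha, map_add, map_mul, map_pow]
      rfl
    · rw [← e'.2, ← ha, ← hb, map_add, map_add, map_mul, map_mul, map_mul, map_pow, map_pow]
      rfl
    · have hI : integralModel R (C'.map (algebraMap R k) • W) = C' • integralModel R W := by
        refine WeierstrassCurve.map_injective (IsFractionRing.injective R k) ?_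
        have h1 := baseChange_integralModel_eq R (C'.map (algebraMap R k) • W)
        have h2 := baseChange_integralModel_eq R W
        refine Eq.trans h1 ?_
        conv_lhs => rw [← h2]
        exact map_variableChange ..
      have hred : (C'.map (algebraMap R k) • W).reduction R =
          C'.map (IsLocalRing.residue R) • W.reduction R := by
        rw [reduction, hI, reduction]
        exact (map_variableChange ..).symm
      rw [hred] at hab
      have := (nonsingular_change_iff _ _ _ _).2 hab
      simpa [changeX, changeY, VariableChange.map] using this

/-- Whether n kills E/E₀ does not depend on the minimal equation. `localTamagawa` uses a chosen
equation over L_w, while the Galois argument needs one defined over K_v. -/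
theorem nsmul_mem_closure_of_variableChange {W W' : WeierstrassCurve k} (hΔ : W.Δ ≠ 0)
    (C : VariableChange k) (hC : W' = C • W) [W.IsMinimal R] [W'.IsMinimal R] {n : ℕ}
    (h : ∀ P : Points W', n • P ∈ AddSubgroup.closure (nonsingularReductionSet R W'))
    (P : Points W) : n • P ∈ AddSubgroup.closure (nonsingularReductionSet R W) := by
  subst hC
  obtain ⟨Q, rfl⟩ := changePts_surjective C W P
  rw [← map_nsmul]
  have h1 := AddSubgroup.mem_map_of_mem (changePts C W) (h Q)
  rw [AddMonoidHom.map_closure] at h1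
  refine AddSubgroup.closure_mono ?_ h1
  rintro _ ⟨S, hS, rfl⟩
  exact changePts_mem_nonsingularReductionSet hΔ C hS

/-- If c₄ is a unit and u⁻⁴c₄ is integral, then u⁻¹ is integral, so the discriminant u⁻¹²Δ is no
larger in absolute value. Unlike minimality itself, this criterion survives ramified base change. -/
theorem isMinimal_of_valuation_c₄ {W : WeierstrassCurve k} [W.IsIntegral R]
    (h : dvrVal R k W.c₄ = 1 ∨ dvrVal R k W.Δ = 1) : W.IsMinimal R := by
  refine ⟨⟨by simpa only [one_smul], fun C hC _ => ?_⟩⟩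
  have hC : (C • W).IsIntegral R := hC
  change (valuation_Δ_aux R (C • W) : WithZero (Multiplicative ℤ)) ≤
    valuation_Δ_aux R ((1 : VariableChange k) • W)
  rw [one_smul, valuation_Δ_aux_eq_of_isIntegral, valuation_Δ_aux_eq_of_isIntegral]
  change dvrVal R k (C • W).Δ ≤ dvrVal R k W.Δ
  rcases h with h | h
  · have h1 : dvrVal R k (C • W).c₄ ≤ 1 := dvrVal_le_one_iff.2 ⟨_, integralModel_c₄_eq R (C • W)⟩
    rw [variableChange_c₄, map_mul, h, mul_one, map_pow] at h1
    rw [variableChange_Δ, map_mul, map_pow]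
    refine mul_le_of_le_one_left zero_le ?_
    exact pow_le_one₀ zero_le ((pow_le_one_iff_of_nonneg zero_le (by norm_num)).1 h1)
  · rw [h]
    exact dvrVal_le_one_iff.2 ⟨_, integralModel_Δ_eq R (C • W)⟩

end Minimal

end ArtinBSD


namespace ArtinBSD

/-! ### Sums and differences of points of singular reduction -/

section AddSub

open WeierstrassCurve

variable {l : Type*} [Field l] {W : WeierstrassCurve l} {x₁ y₁ x₂ y₂ : l}

open scoped Classical in
-- The sum and the product of x(P+Q) and x(P−Q) are functions of x(P) and x(Q) alone. These two
-- identities do the work of Tate's parametrisation.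
theorem addX_add_addX_negY (h₁ : W.toAffine.Equation x₁ y₁) (h₂ : W.toAffine.Equation x₂ y₂)
    (hx : x₁ ≠ x₂) :
    (x₁ - x₂) ^ 2 * (W.toAffine.addX x₁ x₂ (W.toAffine.slope x₁ x₂ y₁ y₂) +
      W.toAffine.addX x₁ x₂ (W.toAffine.slope x₁ x₂ y₁ (W.toAffine.negY x₂ y₂))) =
    2 * x₁ * x₂ * (x₁ + x₂) + W.b₂ * x₁ * x₂ + W.b₄ * (x₁ + x₂) + W.b₆ := by
  rw [Affine.equation_iff] at h₁ h₂
  have hd : x₁ - x₂ ≠ 0 := sub_ne_zero.2 hx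
  rw [Affine.slope_of_X_ne hx, Affine.slope_of_X_ne hx]
  simp only [Affine.addX, Affine.negY, b₂, b₄, b₆]
  field_simp
  linear_combination 2 * h₁ + 2 * h₂

open scoped Classical in
theorem addX_mul_addX_negY (h₁ : W.toAffine.Equation x₁ y₁) (h₂ : W.toAffine.Equation x₂ y₂)
    (hx : x₁ ≠ x₂) :
    (x₁ - x₂) ^ 2 * (W.toAffine.addX x₁ x₂ (W.toAffine.slope x₁ x₂ y₁ y₂) *
      W.toAffine.addX x₁ x₂ (W.toAffine.slope x₁ x₂ y₁ (W.toAffine.negY x₂ y₂))) =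
    x₁ ^ 2 * x₂ ^ 2 - W.b₄ * x₁ * x₂ - W.b₆ * (x₁ + x₂) - W.b₈ := by
  rw [Affine.equation_iff] at h₁ h₂
  have hd : x₁ - x₂ ≠ 0 := sub_ne_zero.2 hx
  rw [Affine.slope_of_X_ne hx, Affine.slope_of_X_ne hx]
  simp only [Affine.addX, Affine.negY]
  set c := (W.a₂ + x₁ + x₂) * (x₁ - x₂) ^ 2 with hc
  set e := (W.a₁ * x₁ + W.a₃) * (W.a₁ * x₂ + W.a₃) with he
  have key : ((y₁ - y₂) ^ 2 + W.a₁ * (y₁ - y₂) * (x₁ - x₂) - c) *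
      ((y₁ - (-y₂ - W.a₁ * x₂ - W.a₃)) ^ 2 +
        W.a₁ * (y₁ - (-y₂ - W.a₁ * x₂ - W.a₃)) * (x₁ - x₂) - c) =
      (x₁ - x₂) ^ 2 * (x₁ ^ 2 * x₂ ^ 2 - W.b₄ * x₁ * x₂ - W.b₆ * (x₁ + x₂) - W.b₈) := by
    -- The product is rearranged so that y₁, y₂ enter only through yᵢ² + a₁xᵢyᵢ + a₃yᵢ, which the
    -- curve equation turns into a cubic in xᵢ.
    have h : ((y₁ - y₂) ^ 2 + W.a₁ * (y₁ - y₂) * (x₁ - x₂) - c) *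
      ((y₁ - (-y₂ - W.a₁ * x₂ - W.a₃)) ^ 2 +
        W.a₁ * (y₁ - (-y₂ - W.a₁ * x₂ - W.a₃)) * (x₁ - x₂) - c) =
        ((y₁ ^ 2 + W.a₁ * x₁ * y₁ + W.a₃ * y₁) + (y₂ ^ 2 + W.a₁ * x₂ * y₂ + W.a₃ * y₂) - c) *
        ((y₁ ^ 2 + W.a₁ * x₁ * y₁ + W.a₃ * y₁) + (y₂ ^ 2 + W.a₁ * x₂ * y₂ + W.a₃ * y₂) - c + e) -
        (4 * (y₁ ^ 2 + W.a₁ * x₁ * y₁ + W.a₃ * y₁) * (y₂ ^ 2 + W.a₁ * x₂ * y₂ + W.a₃ * y₂) +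
          (y₁ ^ 2 + W.a₁ * x₁ * y₁ + W.a₃ * y₁) * (W.a₁ * x₂ + W.a₃) ^ 2 +
          (y₂ ^ 2 + W.a₁ * x₂ * y₂ + W.a₃ * y₂) * (W.a₁ * x₁ + W.a₃) ^ 2) := by
      rw [he]; ring
    rw [h, h₁, h₂, hc, he]
    simp only [b₄, b₆, b₈]
    ring
  rw [hc] at key
  field_simp
  linear_combination key

end AddSub

/-! ### Singular points of an integral equation modulo an ideal. -/

section Singular

open WeierstrassCurve IsLocalRing

variable {R : Type*} [CommRing R] {I : WeierstrassCurve R} {x y : R}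

/-- The `b`-invariants of the equation translated by `r` along the `x`-axis. -/
def shiftB₂ (I : WeierstrassCurve R) (r : R) : R := I.b₂ + 12 * r

/-- The `b`-invariants of the equation translated by `r` along the `x`-axis. -/
def shiftB₄ (I : WeierstrassCurve R) (r : R) : R := I.b₄ + r * I.b₂ + 6 * r ^ 2

/-- The `b`-invariants of the equation translated by `r` along the `x`-axis. -/
def shiftB₆ (I : WeierstrassCurve R) (r : R) : R :=
  I.b₆ + 2 * r * I.b₄ + r ^ 2 * I.b₂ + 4 * r ^ 3

/-- The `b`-invariants of the equation translated by `r` along the `x`-axis. -/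
def shiftB₈ (I : WeierstrassCurve R) (r : R) : R :=
  I.b₈ + 3 * r * I.b₆ + 3 * r ^ 2 * I.b₄ + r ^ 3 * I.b₂ + 3 * r ^ 4

theorem shift_relation (r : R) :
    4 * shiftB₈ I r = shiftB₂ I r * shiftB₆ I r - shiftB₄ I r ^ 2 := by
  have := I.b_relation
  simp only [shiftB₂, shiftB₄, shiftB₆, shiftB₈]
  linear_combination this

theorem shift_Δ (r : R) :
    I.Δ = -shiftB₂ I r ^ 2 * shiftB₈ I r - 8 * shiftB₄ I r ^ 3 - 27 * shiftB₆ I r ^ 2 +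
      9 * shiftB₂ I r * shiftB₄ I r * shiftB₆ I r := by
  have := I.b_relation
  simp only [shiftB₂, shiftB₄, shiftB₆, shiftB₈, Δ]
  linear_combination (6 * I.b₂ * r + 36 * r ^ 2) * this

theorem shift_c₄ (r : R) : I.c₄ = shiftB₂ I r ^ 2 - 24 * shiftB₄ I r := by
  simp only [shiftB₂, shiftB₄, c₄]
  ring

/-- The point `(x, y)` of an integral equation has singular reduction. -/
structure IsSingularMod (J : Ideal R) (I : WeierstrassCurve R) (x y : R) : Prop where
  equation : I.toAffine.Equation x y
  memY : 2 * y + I.a₁ * x + I.a₃ ∈ J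
  memX : I.a₁ * y - (3 * x ^ 2 + 2 * I.a₂ * x + I.a₄) ∈ J

variable {J : Ideal R}

/-- On the curve, the shifted b₄, b₆ and b₈ are combinations without constant term of the two
partial derivatives at the point, so they vanish modulo J with them. -/
theorem IsSingularMod.shiftB₄_mem (h : IsSingularMod J I x y) : shiftB₄ I x ∈ J := by
  have : shiftB₄ I x = I.a₁ * (2 * y + I.a₁ * x + I.a₃) -
      2 * (I.a₁ * y - (3 * x ^ 2 + 2 * I.a₂ * x + I.a₄)) := by
    simp only [shiftB₄, b₂, b₄]; ring
  rw [this]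
  exact J.sub_mem (J.mul_mem_left _ h.memY) (J.mul_mem_left _ h.memX)

theorem IsSingularMod.shiftB₆_mem (h : IsSingularMod J I x y) : shiftB₆ I x ∈ J := by
  have e := (Affine.equation_iff ..).1 h.equation
  have : shiftB₆ I x = (2 * y + I.a₁ * x + I.a₃) * (2 * y + I.a₁ * x + I.a₃) := by
    simp only [shiftB₆, b₂, b₄, b₆]
    linear_combination -4 * e
  rw [this]
  exact J.mul_mem_left _ h.memY

theorem IsSingularMod.shiftB₈_mem (h : IsSingularMod J I x y) : shiftB₈ I x ∈ J := by
  have e := (Affine.equation_iff ..).1 h.equation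
  have : shiftB₈ I x = (I.a₁ * (I.a₁ * y - (3 * x ^ 2 + 2 * I.a₂ * x + I.a₄)) +
      (I.a₂ + 3 * x) * (2 * y + I.a₁ * x + I.a₃)) * (2 * y + I.a₁ * x + I.a₃) -
      (I.a₁ * y - (3 * x ^ 2 + 2 * I.a₂ * x + I.a₄)) *
        (I.a₁ * y - (3 * x ^ 2 + 2 * I.a₂ * x + I.a₄)) := by
    simp only [shiftB₈, b₂, b₄, b₆, b₈]
    linear_combination -(I.a₁ ^ 2 + 4 * I.a₂ + 12 * x) * e
  rw [this]
  exact J.sub_mem (J.mul_mem_left _ h.memY) (J.mul_mem_left _ h.memX)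

/-- The `x`-coordinate of the singular point of the reduction. -/
theorem IsSingularMod.c₄_mul_sub_mem (h : IsSingularMod J I x y) :
    I.c₄ * x - (18 * I.b₆ - I.b₂ * I.b₄) ∈ J := by
  have : I.c₄ * x - (18 * I.b₆ - I.b₂ * I.b₄) =
      (12 * x + I.b₂) * shiftB₄ I x - 18 * shiftB₆ I x := by
    simp only [shiftB₄, shiftB₆, c₄]; ring
  rw [this]
  exact J.sub_mem (J.mul_mem_left _ h.shiftB₄_mem) (J.mul_mem_left _ h.shiftB₆_mem)

theorem shiftB₄_sub_mem {r : R} (h : x - r ∈ J) : shiftB₄ I x - shiftB₄ I r ∈ J := by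
  have : shiftB₄ I x - shiftB₄ I r = (I.b₂ + 6 * (x + r)) * (x - r) := by
    simp only [shiftB₄]; ring
  rw [this]
  exact J.mul_mem_left _ h

variable [IsLocalRing R]

/-- The invariant c₄ = b₂² − 24b₄ is unchanged by translation. -/
theorem isUnit_shiftB₂ (hc : IsUnit I.c₄) {r : R} (h : shiftB₄ I r ∈ maximalIdeal R) :
    IsUnit (shiftB₂ I r) := by
  rw [← notMem_maximalIdeal] at hc ⊢
  intro h2
  refine hc ?_
  rw [shift_c₄ r, sq]
  exact Ideal.sub_mem _ (Ideal.mul_mem_left _ _ h2) (Ideal.mul_mem_left _ _ h)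

/-- Newton's method for the quadratic polynomial `b₄ + b₂ r + 6 r ^ 2`. -/
theorem exists_shiftB₄_mem_pow (hc : IsUnit I.c₄) {r₀ : R} (h : shiftB₄ I r₀ ∈ maximalIdeal R)
    (n : ℕ) : ∃ r, r - r₀ ∈ maximalIdeal R ∧ shiftB₄ I r ∈ maximalIdeal R ^ (n + 1) := by
  induction n with
  | zero => exact ⟨r₀, by simp, by simpa using h⟩
  | succ n ih =>
    obtain ⟨r, h1, h2⟩ := ih
    have h3 : shiftB₄ I r ∈ maximalIdeal R := Ideal.pow_le_self (Nat.succ_ne_zero n) h2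
    obtain ⟨u, hu⟩ := isUnit_shiftB₂ hc h3
    -- The derivative of `shiftB₄ I` at r is `shiftB₂ I r`, a unit. The error is squared, which is
    -- more than the one extra power required.
    refine ⟨r - ↑u⁻¹ * shiftB₄ I r, ?_, ?_⟩
    · rw [sub_right_comm]
      exact Ideal.sub_mem _ h1 (Ideal.mul_mem_left _ _ h3)
    · have hu' : (↑u⁻¹ : R) * (I.b₂ + 12 * r) = 1 := by
        change (↑u⁻¹ : R) * shiftB₂ I r = 1
        rw [← hu, Units.inv_mul]
      have : shiftB₄ I (r - ↑u⁻¹ * shiftB₄ I r) =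
          6 * (↑u⁻¹) ^ 2 * (shiftB₄ I r * shiftB₄ I r) := by
        have e : ∀ z, shiftB₄ I (r - z) = shiftB₄ I r - z * (I.b₂ + 12 * r) + 6 * z ^ 2 := by
          intro z; simp only [shiftB₄]; ring
        rw [e]
        linear_combination -shiftB₄ I r * hu'
      rw [this, pow_succ]
      exact Ideal.mul_mem_left _ _ (Ideal.mul_mem_mul h2 h3)

/-- If both `x(P + Q)` and `x(P - Q)` reduced to the node, where `P` and `Q` reduce to the node and
`x(P)`, `x(Q)` are equally close to it, then the discriminant would vanish. -/
theorem false_of_mem_maximalIdeal [IsDomain R] [ValuationRing R] {b₂ b₄ b₆ b₈ D x₁ x₂ ε m₁ m₂ μ : R}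
    (hrel : 4 * b₈ = b₂ * b₆ - b₄ ^ 2)
    (hD : D = -b₂ ^ 2 * b₈ - 8 * b₄ ^ 3 - 27 * b₆ ^ 2 + 9 * b₂ * b₄ * b₆) (hD0 : D ≠ 0)
    (hb₂ : IsUnit b₂) (hμ : μ ∈ maximalIdeal R) (hb₄ : b₄ = D * μ)
    (hx₁ : x₁ ∈ maximalIdeal R) (hε : IsUnit ε) (hx₂ : x₂ = ε * x₁)
    (hm₁ : m₁ ∈ maximalIdeal R) (hm₂ : m₂ ∈ maximalIdeal R)
    (h₁ : (x₁ - x₂) ^ 2 * m₁ = 2 * x₁ * x₂ * (x₁ + x₂) + b₂ * x₁ * x₂ + b₄ * (x₁ + x₂) + b₆)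
    (h₂ : (x₁ - x₂) ^ 2 * m₂ = x₁ ^ 2 * x₂ ^ 2 - b₄ * x₁ * x₂ - b₆ * (x₁ + x₂) - b₈) : False := by
  obtain ⟨u, rfl⟩ := hb₂
  have hu : (↑u⁻¹ : R) * u = 1 := Units.inv_mul u
  set v : R := ↑u⁻¹
  have hb₆ : b₆ = v * (4 * b₈ + b₄ ^ 2) := by linear_combination -b₆ * hu - v * hrel
  have hone : ∀ z ∈ maximalIdeal R, IsUnit (1 + z) := fun z hz => by
    by_contra h
    rw [← mem_nonunits_iff, ← mem_maximalIdeal] at h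
    have := Ideal.sub_mem _ h hz
    rw [add_sub_cancel_right] at this
    exact (notMem_maximalIdeal.2 isUnit_one) this
  -- After elimination of b₆, every term of D not divisible by b₈ contains b₄ = Dμ. Moved to the
  -- left, these terms change D only by a factor in 1 + 𝔪, a unit.
  have hDb : b₈ ∣ D := by
    have hz : μ * (8 * D ^ 2 * μ ^ 2 + 27 * v ^ 2 * D ^ 3 * μ ^ 3 - 9 * u * b₆) ∈ maximalIdeal R :=
      Ideal.mul_mem_right _ _ hμ
    refine (hone _ hz).dvd_mul_right.1
      ⟨-(u ^ 2 + 27 * v ^ 2 * (16 * b₈ + 8 * b₄ ^ 2)), ?_⟩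
    have h6 : b₆ ^ 2 = v ^ 2 * (16 * b₈ ^ 2 + 8 * b₈ * b₄ ^ 2 + b₄ ^ 4) := by rw [hb₆]; ring
    have e : D * (1 + μ * (8 * D ^ 2 * μ ^ 2 + 27 * v ^ 2 * D ^ 3 * μ ^ 3 - 9 * u * b₆)) =
      D + 8 * (D * μ) ^ 3 + 27 * v ^ 2 * (D * μ) ^ 4 - 9 * u * (D * μ) * b₆ := by ring
    rw [e, ← hb₄]
    linear_combination hD - 27 * h6
  have hb₈0 : b₈ ≠ 0 := fun h => hD0 (zero_dvd_iff.1 (h ▸ hDb))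
  obtain ⟨δ, hδ⟩ := hDb
  have hb₄' : b₄ = b₈ * (δ * μ) := by rw [hb₄, hδ]; ring
  have hb₆' : b₆ = b₈ * (v * (4 + δ * μ * b₄)) := by
    linear_combination hb₆ + v * b₄ * hb₄'
  -- Now b₄ and b₆ are multiples of b₈. If x₁² is one too, the product relation can be divided by b₈
  -- and puts 1 in 𝔪.
  have hdvd : b₈ ∣ x₁ ^ 2 → False := by
    rintro ⟨t, ht⟩
    have : b₈ * (t * ε ^ 2 * x₁ ^ 2 - δ * μ * x₁ * x₂ - v * (4 + δ * μ * b₄) * (x₁ + x₂) -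
        t * (1 - ε) ^ 2 * m₂) = b₈ * 1 := by
      have e : (x₁ - x₂) ^ 2 = b₈ * t * (1 - ε) ^ 2 := by rw [← ht, hx₂]; ring
      have e' : x₁ ^ 2 * x₂ ^ 2 = b₈ * t * ε ^ 2 * x₁ ^ 2 := by rw [← ht, hx₂]; ring
      rw [e, e'] at h₂
      linear_combination -h₂ + x₁ * x₂ * hb₄' + (x₁ + x₂) * hb₆'
    have h1 := mul_left_cancel₀ hb₈0 this
    refine notMem_maximalIdeal.2 (isUnit_one (M := R)) ?_
    rw [← h1, hx₂, show t * ε ^ 2 * x₁ ^ 2 - δ * μ * x₁ * (ε * x₁) -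
      v * (4 + δ * μ * b₄) * (x₁ + ε * x₁) - t * (1 - ε) ^ 2 * m₂ = (t * ε ^ 2 * x₁ -
      δ * μ * (ε * x₁) - v * (4 + δ * μ * b₄) * (1 + ε)) * x₁ - t * (1 - ε) ^ 2 * m₂ by ring]
    exact Ideal.sub_mem _ (Ideal.mul_mem_left _ _ hx₁) (Ideal.mul_mem_left _ _ hm₂)
  rcases ValuationRing.dvd_total b₈ (x₁ ^ 2) with h | ⟨t, ht⟩
  · exact hdvd h
  -- In the remaining case b₈ is a proper multiple of x₁². Dividing the sum relation by x₁² puts the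
  -- unit εb₂ in 𝔪.
  · have htm : t ∈ maximalIdeal R := by
      rw [mem_maximalIdeal, mem_nonunits_iff]
      rintro ⟨w, rfl⟩
      exact hdvd ⟨↑w⁻¹, by rw [ht, mul_assoc, Units.mul_inv, mul_one]⟩
    have hx0 : x₁ ^ 2 ≠ 0 := fun h => hb₈0 (by rw [ht, h, zero_mul])
    have : x₁ ^ 2 * (ε * u) = x₁ ^ 2 * ((1 - ε) ^ 2 * m₁ - 2 * ε * (1 + ε) * x₁ -
        (δ * μ * (x₁ + x₂) + v * (4 + δ * μ * b₄)) * t) := by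
      have e : (x₁ - x₂) ^ 2 = x₁ ^ 2 * (1 - ε) ^ 2 := by rw [hx₂]; ring
      have e2 : 2 * x₁ * x₂ * (x₁ + x₂) = x₁ ^ 2 * (2 * ε * (1 + ε) * x₁) := by rw [hx₂]; ring
      have e3 : u * x₁ * x₂ = x₁ ^ 2 * (ε * u) := by rw [hx₂]; ring
      rw [e, e2, e3] at h₁
      linear_combination -h₁ - (x₁ + x₂) * hb₄' - hb₆' -
        (δ * μ * (x₁ + x₂) + v * (4 + δ * μ * b₄)) * ht
    have h1 := mul_left_cancel₀ hx0 this
    refine notMem_maximalIdeal.2 (hε.mul u.isUnit) ?_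
    rw [h1]
    exact Ideal.sub_mem _ (Ideal.sub_mem _ (Ideal.mul_mem_left _ _ hm₁)
      (Ideal.mul_mem_left _ _ hx₁)) (Ideal.mul_mem_left _ _ htm)

end Singular

end ArtinBSD


namespace ArtinBSD

/-! ### Points of singular reduction on a minimal equation. -/

section Points

open WeierstrassCurve IsLocalRing

variable {S : Type*} [CommRing S] [IsDomain S] [IsDiscreteValuationRing S]
variable {l : Type*} [Field l] [Algebra S l] [IsFractionRing S l]

theorem mem_range_y {W : WeierstrassCurve l} [W.IsIntegral S] {x y : l}
    (h : W.toAffine.Equation x y) (hx : x ∈ Set.range (algebraMap S l)) :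
    y ∈ Set.range (algebraMap S l) := by
  obtain ⟨a, rfl⟩ := hx
  have a1 := integralModel_a₁_eq S W
  have a2 := integralModel_a₂_eq S W
  have a3 := integralModel_a₃_eq S W
  have a4 := integralModel_a₄_eq S W
  have a6 := integralModel_a₆_eq S W
  generalize integralModel S W = I at *
  rw [Affine.equation_iff] at h
  refine mem_range_of_sq_eq (b := -I.a₁ * a - I.a₃) (c := a ^ 3 + I.a₂ * a ^ 2 + I.a₄ * a + I.a₆) ?_
  simp only [map_add, map_sub, map_mul, map_pow, map_neg, a1, a2, a3, a4, a6]
  linear_combination h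

theorem equation_integralModel_iff {W : WeierstrassCurve l} [W.IsIntegral S] {a b : S} :
    (integralModel S W).toAffine.Equation a b ↔
      W.toAffine.Equation (algebraMap S l a) (algebraMap S l b) := by
  conv_rhs => rw [← baseChange_integralModel_eq S W]
  exact (Affine.map_equation _ (IsFractionRing.injective S l) a b).symm

theorem nonsingular_reduction_iff {W : WeierstrassCurve l} [W.IsMinimal S] {a b : S}
    (h : W.toAffine.Equation (algebraMap S l a) (algebraMap S l b)) :
    (W.reduction S).toAffine.Nonsingular (residue S a) (residue S b) ↔
      ¬ IsSingularMod (maximalIdeal S) (integralModel S W) a b := by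
  have h1 := equation_integralModel_iff.2 h
  have h2 : (W.reduction S).toAffine.Equation (residue S a) (residue S b) := h1.map (residue S)
  rw [Affine.nonsingular_iff']
  have e1 : 2 * residue S b + (W.reduction S).a₁ * residue S a + (W.reduction S).a₃ =
      residue S (2 * b + (integralModel S W).a₁ * a + (integralModel S W).a₃) := by
    simp [reduction, map_ofNat (residue S)]
  have e2 : (W.reduction S).a₁ * residue S b - (3 * residue S a ^ 2 +
      2 * (W.reduction S).a₂ * residue S a + (W.reduction S).a₄) =
      residue S ((integralModel S W).a₁ * b - (3 * a ^ 2 + 2 * (integralModel S W).a₂ * a +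
        (integralModel S W).a₄)) := by
    simp [reduction, map_ofNat (residue S)]
  rw [e1, e2, ne_eq, ne_eq, residue_eq_zero_iff, residue_eq_zero_iff]
  constructor
  · rintro ⟨-, h3 | h3⟩ h4
    · exact h3 h4.memX
    · exact h3 h4.memY
  · intro h3
    refine ⟨h2, ?_⟩
    by_contra! h4
    exact h3 ⟨h1, h4.2, h4.1⟩

theorem exists_of_notMem_nonsingularReductionSet {W : WeierstrassCurve l} [W.IsMinimal S]
    {P : Points W} (hP : P ∉ nonsingularReductionSet S W) :
    ∃ (a b : S) (h : W.toAffine.Nonsingular (algebraMap S l a) (algebraMap S l b)),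
      P = (.some _ _ h : W.toAffine.Point) ∧
        IsSingularMod (maximalIdeal S) (integralModel S W) a b := by
  by_contra! hc
  refine hP fun x y h e => ?_
  by_cases hx : x ∈ Set.range (algebraMap S l)
  · right
    obtain ⟨b, rfl⟩ := mem_range_y (S := S) h.1 hx
    obtain ⟨a, rfl⟩ := hx
    exact ⟨a, b, rfl, rfl, (nonsingular_reduction_iff h.1).2 (hc a b h e)⟩
  · exact Or.inl hx

theorem zero_mem_nonsingularReductionSet {W : WeierstrassCurve l} [W.IsMinimal S] :
    (0 : Points W) ∈ nonsingularReductionSet S W := by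
  intro x y h e
  cases e

/-- A singular reduction would put the shifted b₄, b₆, b₈ in the maximal ideal, and Δ with them. -/
theorem mem_nonsingularReductionSet_of_isUnit_Δ {W : WeierstrassCurve l} [W.IsMinimal S]
    (hΔ : dvrVal S l W.Δ = 1) (P : Points W) : P ∈ nonsingularReductionSet S W := by
  by_contra hP
  obtain ⟨a, b, h, -, hs⟩ := exists_of_notMem_nonsingularReductionSet hP
  rw [← integralModel_Δ_eq S W, dvrVal_eq_one_iff] at hΔ
  refine notMem_maximalIdeal.2 hΔ ?_
  rw [shift_Δ a]
  have h4 := hs.shiftB₄_mem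
  have h6 := hs.shiftB₆_mem
  have h8 := hs.shiftB₈_mem
  refine Ideal.add_mem _ (Ideal.sub_mem _ (Ideal.sub_mem _ (Ideal.mul_mem_left _ _ h8) ?_) ?_)
    (Ideal.mul_mem_left _ _ h6)
  · exact Ideal.mul_mem_left _ _ (Ideal.pow_mem_of_mem _ h4 3 (by norm_num))
  · exact Ideal.mul_mem_left _ _ (Ideal.pow_mem_of_mem _ h6 2 (by norm_num))

open scoped Classical in
/-- For a node: if `P` and `Q` have singular reduction and `x(P)`, `x(Q)` are equally close to the
`x`-coordinate `r` of the node, then `P + Q` or `P - Q` has non-singular reduction. -/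
theorem add_mem_or_sub_mem {W : WeierstrassCurve l} [W.IsMinimal S] (hΔ : W.Δ ≠ 0)
    (hc : IsUnit (integralModel S W).c₄) {a b a' b' r ε μ : S}
    {h : W.toAffine.Nonsingular (algebraMap S l a) (algebraMap S l b)}
    {h' : W.toAffine.Nonsingular (algebraMap S l a') (algebraMap S l b')}
    (hs : IsSingularMod (maximalIdeal S) (integralModel S W) a b)
    (hr : a - r ∈ maximalIdeal S) (hε : IsUnit ε) (ha' : a' - r = ε * (a - r))
    (hμ : μ ∈ maximalIdeal S) (hb₄ : shiftB₄ (integralModel S W) r = (integralModel S W).Δ * μ)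
    {P Q : Points W} (hP : P = (.some _ _ h : W.toAffine.Point))
    (hQ : Q = (.some _ _ h' : W.toAffine.Point)) :
    P + Q ∈ nonsingularReductionSet S W ∨ P - Q ∈ nonsingularReductionSet S W := by
  subst hP hQ
  by_cases hx : algebraMap S l a = algebraMap S l a'
  · rcases (Affine.Point.X_eq_iff (h₁ := h) (h₂ := h')).1 hx with e | e
    · right
      have e0 : (Affine.Point.some _ _ h : W.toAffine.Point) - Affine.Point.some _ _ h' = 0 := by
        rw [e, sub_self]
      exact e0 ▸ zero_mem_nonsingularReductionSet
    · left
      have e0 : (Affine.Point.some _ _ h : W.toAffine.Point) + Affine.Point.some _ _ h' = 0 := by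
        rw [e, neg_add_cancel]
      exact e0 ▸ zero_mem_nonsingularReductionSet
  by_contra! hcon
  obtain ⟨hc1, hc2⟩ := hcon
  obtain ⟨X, Y, hX, eX, sX⟩ := exists_of_notMem_nonsingularReductionSet hc1
  obtain ⟨X', Y', hX', eX', sX'⟩ := exists_of_notMem_nonsingularReductionSet hc2
  have e1 : (Affine.Point.some _ _ h : W.toAffine.Point) + Affine.Point.some _ _ h' = _ :=
    Affine.Point.add_of_X_ne hx
  have e2 : (Affine.Point.some _ _ h : W.toAffine.Point) - Affine.Point.some _ _ h' = _ :=
    (sub_eq_add_neg _ _).trans ((congrArg _ (Affine.Point.neg_some h')).trans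
      (Affine.Point.add_of_X_ne hx))
  have f1 := ((Affine.Point.some.injEq ..).mp (e1.symm.trans eX)).1
  have f2 := ((Affine.Point.some.injEq ..).mp (e2.symm.trans eX')).1
  have g1 := addX_add_addX_negY h.1 h'.1 hx
  have g2 := addX_mul_addX_negY h.1 h'.1 hx
  rw [f1, f2, ← integralModel_b₂_eq S W, ← integralModel_b₄_eq S W, ← integralModel_b₆_eq S W] at g1
  rw [f1, f2, ← integralModel_b₄_eq S W, ← integralModel_b₆_eq S W, ← integralModel_b₈_eq S W] at g2
  have hinj := IsFractionRing.injective S l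
  have g1' : (a - a') ^ 2 * (X + X') = 2 * a * a' * (a + a') + (integralModel S W).b₂ * a * a' +
      (integralModel S W).b₄ * (a + a') + (integralModel S W).b₆ := by
    apply hinj; simpa only [map_add, map_sub, map_mul, map_pow, map_ofNat] using g1
  have g2' : (a - a') ^ 2 * (X * X') = a ^ 2 * a' ^ 2 - (integralModel S W).b₄ * a * a' -
      (integralModel S W).b₆ * (a + a') - (integralModel S W).b₈ := by
    apply hinj; simpa using g2
  have hD0 : (integralModel S W).Δ ≠ 0 := by
    intro h0
    apply hΔ
    rw [← integralModel_Δ_eq S W, h0, map_zero]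
  -- As c₄ is a unit, the congruence c₄x ≡ 18b₆ − b₂b₄ determines the x-coordinate of a singular
  -- point; so x(P+Q) and x(P−Q) would both be congruent to r.
  have hclose : ∀ {z w : S}, IsSingularMod (maximalIdeal S) (integralModel S W) z w →
      z - r ∈ maximalIdeal S := by
    intro z w hz
    have h1 := Ideal.sub_mem _ hz.c₄_mul_sub_mem hs.c₄_mul_sub_mem
    rw [sub_sub_sub_cancel_right, ← mul_sub] at h1
    have h2 : z - a ∈ maximalIdeal S := by
      obtain ⟨u, hu⟩ := hc
      have := Ideal.mul_mem_left _ (↑u⁻¹ : S) h1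
      rwa [← hu, Units.inv_mul_cancel_left] at this
    have := Ideal.add_mem _ h2 hr
    rwa [sub_add_sub_cancel] at this
  have k1 := hclose sX
  have k2 := hclose sX'
  have hb4m : shiftB₄ (integralModel S W) r ∈ maximalIdeal S := by
    rw [hb₄]; exact Ideal.mul_mem_left _ _ hμ
  refine false_of_mem_maximalIdeal (shift_relation r) (shift_Δ r) hD0 (isUnit_shiftB₂ hc hb4m) hμ
    hb₄ hr hε ha' (m₁ := (X - r) + (X' - r)) (m₂ := (X - r) * (X' - r)) (Ideal.add_mem _ k1 k2)
    (Ideal.mul_mem_left _ _ k2) ?_ ?_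
  · simp only [shiftB₂, shiftB₄, shiftB₆]
    linear_combination g1'
  · simp only [shiftB₄, shiftB₆, shiftB₈]
    linear_combination g2' - r * g1'

end Points

end ArtinBSD


namespace ArtinBSD

/-! ### Component groups in Galois extensions -/

section GroupTheory

/-- A finite group of odd order which acts up to sign on a quotient acts trivially on it; so a
multiple of any element is congruent to an invariant one. -/
theorem card_nsmul_mem_of_odd {G A : Type*} [Group G] [Finite G] [AddCommGroup A]
    [DistribMulAction G A] (H : AddSubgroup A) (hH : ∀ (g : G), ∀ a ∈ H, g • a ∈ H)
    (hodd : Odd (Nat.card G)) (hsign : ∀ (g : G) (a : A), a + g • a ∈ H ∨ a - g • a ∈ H)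
    (hinv : ∀ a : A, (∀ g : G, g • a = a) → a ∈ H) (a : A) : Nat.card G • a ∈ H := by
  have key : ∀ g : G, a - g • a ∈ H := fun g => by
    rcases hsign g a with h | h
    -- From ga ≡ −a follows gⁿa ≡ (−1)ⁿa. Taking n = |G| odd gives 2a ∈ H, and a − ga = 2a − (a +
    -- ga).
    · have hpow : ∀ n : ℕ, (g ^ n) • a - (-1 : ℤ) ^ n • a ∈ H := fun n => by
        induction n with
        | zero => simp
        | succ n ih =>
          have h1 := hH g _ ih
          rw [smul_sub, ← mul_smul, ← pow_succ', show g • ((-1 : ℤ) ^ n • a) = (-1 : ℤ) ^ n • g • a from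
            map_zsmul (DistribSMul.toAddMonoidHom A g) _ _] at h1
          have h2 := H.add_mem h1 (H.zsmul_mem h ((-1) ^ n))
          convert h2 using 1
          rw [pow_succ (-1 : ℤ), mul_neg_one, neg_smul, smul_add]
          abel
      have h1 := hpow (Nat.card G)
      rw [pow_card_eq_one', one_smul, hodd.neg_one_pow, neg_smul, one_smul, sub_neg_eq_add] at h1
      have h2 := H.sub_mem h1 h
      rwa [add_sub_add_left_eq_sub] at h2
    · exact h
  have := Fintype.ofFinite G
  -- Summing over G shows that |G|·a is congruent to the trace of a, which is invariant and so lies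
  -- in H.
  have h1 : ∑ g : G, (a - g • a) ∈ H := H.sum_mem fun g _ => key g
  rw [Finset.sum_sub_distrib, Finset.sum_const, Finset.card_univ, ← Nat.card_eq_fintype_card] at h1
  have h2 : ∑ g : G, g • a ∈ H := by
    refine hinv _ fun g => ?_
    rw [Finset.smul_sum]
    exact Fintype.sum_equiv (Equiv.mulLeft g) _ _ fun x => by simp [mul_smul]
  have := H.add_mem h1 h2
  rwa [sub_add_cancel] at this

end GroupTheory

/-! ### Automorphisms and divisibility in a discrete valuation ring. -/

section DVR

open IsLocalRing

variable {S : Type*} [CommRing S] [IsDomain S] [IsDiscreteValuationRing S]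

/-- An automorphism sends a uniformizer to a uniformizer, hence preserves the valuation. This is why
x(P) and x(σP) are equally close to the node. -/
theorem exists_isUnit_mul_eq (τ : S ≃+* S) (z : S) : ∃ ε, IsUnit ε ∧ τ z = ε * z := by
  by_cases hz : z = 0
  · exact ⟨1, isUnit_one, by simp [hz]⟩
  obtain ⟨ϖ, hϖ⟩ := IsDiscreteValuationRing.exists_irreducible S
  obtain ⟨n, u, rfl⟩ := IsDiscreteValuationRing.eq_unit_mul_pow_irreducible hz hϖ
  have hϖ' : Irreducible (τ ϖ) := (MulEquiv.irreducible_iff τ).2 hϖ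
  obtain ⟨w, hw⟩ := IsDiscreteValuationRing.associated_of_irreducible S hϖ hϖ'
  refine ⟨τ u * w ^ n * ↑u⁻¹, (((u.isUnit.map τ).mul (w.isUnit.pow n)).mul u⁻¹.isUnit), ?_⟩
  rw [map_mul, map_pow, ← hw, mul_pow]
  linear_combination (-τ u * w ^ n * ϖ ^ n) * u.inv_mul

/-- The exponent n is the valuation of D. It fixes the precision demanded of Newton's method. -/
theorem exists_forall_mem_pow_eq_mul {D : S} (hD : D ≠ 0) :
    ∃ n : ℕ, ∀ z ∈ maximalIdeal S ^ (n + 1), ∃ μ ∈ maximalIdeal S, z = D * μ := by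
  obtain ⟨ϖ, hϖ⟩ := IsDiscreteValuationRing.exists_irreducible S
  obtain ⟨n, u, rfl⟩ := IsDiscreteValuationRing.eq_unit_mul_pow_irreducible hD hϖ
  refine ⟨n, fun z hz => ?_⟩
  have hm := hϖ.maximalIdeal_eq
  rw [hm, Ideal.span_singleton_pow, Ideal.mem_span_singleton] at hz
  obtain ⟨c, rfl⟩ := hz
  refine ⟨↑u⁻¹ * c * ϖ, ?_, ?_⟩
  · rw [hm]
    exact Ideal.mul_mem_left _ _ (Ideal.mem_span_singleton_self ϖ)
  · linear_combination (-c * ϖ ^ (n + 1)) * u.mul_inv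

theorem exists_ringEquiv_of_forall_mem_range {l : Type*} [Field l] [Algebra S l]
    [IsFractionRing S l] (σ : l ≃+* l)
    (h : ∀ a, σ (algebraMap S l a) ∈ Set.range (algebraMap S l))
    (h' : ∀ a, σ.symm (algebraMap S l a) ∈ Set.range (algebraMap S l)) :
    ∃ τ : S ≃+* S, ∀ a, algebraMap S l (τ a) = σ (algebraMap S l a) := by
  have hinj := IsFractionRing.injective S l
  choose f hf using h
  choose g hg using h'
  refine ⟨{ toFun := f, invFun := g, left_inv := fun a => hinj ?_, right_inv := fun a => hinj ?_,
            map_mul' := fun a b => hinj ?_, map_add' := fun a b => hinj ?_ }, hf⟩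
  · rw [hg, hf, RingEquiv.symm_apply_apply]
  · rw [hf, hg, RingEquiv.apply_symm_apply]
  · rw [hf, map_mul, map_mul, map_mul, hf, hf]
  · rw [hf, map_add, map_add, map_add, hf, hf]

end DVR

/-! ### Base change of minimal equations and of points. -/

section Extension

open WeierstrassCurve IsLocalRing

variable {R : Type*} [CommRing R] [IsDomain R] [IsDiscreteValuationRing R]
variable {k : Type*} [Field k] [Algebra R k] [IsFractionRing R k]
variable {S : Type*} [CommRing S] [IsDomain S] [IsDiscreteValuationRing S]
variable {l : Type*} [Field l] [Algebra S l] [IsFractionRing S l]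
variable [Algebra k l] (i : R →+* S)
  (hi : ∀ a, algebraMap S l (i a) = algebraMap k l (algebraMap R k a))
  (M : WeierstrassCurve k)

include hi

theorem baseChange_eq_map_integralModel [M.IsIntegral R] :
    M.baseChange l = ((integralModel R M).map i).baseChange l := by
  conv_lhs => rw [← baseChange_integralModel_eq R M]
  simp only [WeierstrassCurve.baseChange, WeierstrassCurve.map_map]
  congr 1
  ext a
  exact (hi a).symm

theorem isIntegral_baseChange [M.IsIntegral R] : (M.baseChange l).IsIntegral S :=
  ⟨_, baseChange_eq_map_integralModel i hi M⟩

theorem integralModel_baseChange [M.IsIntegral R] [(M.baseChange l).IsIntegral S] :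
    integralModel S (M.baseChange l) = (integralModel R M).map i :=
  WeierstrassCurve.map_injective (IsFractionRing.injective S l)
    ((baseChange_integralModel_eq S (M.baseChange l)).trans
      (baseChange_eq_map_integralModel i hi M))

theorem dvrVal_algebraMap_eq_one {x : k} (hx : dvrVal R k x = 1) :
    dvrVal S l (algebraMap k l x) = 1 := by
  obtain ⟨a, rfl⟩ := dvrVal_le_one_iff.1 hx.le
  rw [← hi, dvrVal_eq_one_iff]
  exact (dvrVal_eq_one_iff.1 hx).map i

/-- A unit c₄ or Δ stays a unit, so the minimal equation of a semistable curve remains minimal. -/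
theorem isMinimal_baseChange [M.IsIntegral R]
    (h : dvrVal R k M.c₄ = 1 ∨ dvrVal R k M.Δ = 1) : (M.baseChange l).IsMinimal S := by
  have := isIntegral_baseChange i hi M
  refine isMinimal_of_valuation_c₄ ?_
  rw [WeierstrassCurve.baseChange, map_c₄, map_Δ]
  exact h.imp (dvrVal_algebraMap_eq_one i hi) (dvrVal_algebraMap_eq_one i hi)

theorem mem_range_of_algebraMap_mem_range [IsLocalHom i] {x : k}
    (hx : algebraMap k l x ∈ Set.range (algebraMap S l)) : x ∈ Set.range (algebraMap R k) := by
  by_contra h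
  rw [← dvrVal_le_one_iff, not_le] at h
  have hx0 : x ≠ 0 := by rintro rfl; simp at h
  have h1 : dvrVal R k x⁻¹ < 1 := by
    rw [map_inv₀]; exact inv_lt_one_of_one_lt₀ h
  obtain ⟨a, ha⟩ := dvrVal_le_one_iff.1 h1.le
  obtain ⟨b, hb⟩ := hx
  rw [← ha, dvrVal_lt_one_iff] at h1
  refine h1 (isUnit_of_map_unit i a (IsUnit.of_mul_eq_one b ?_))
  apply IsFractionRing.injective S l
  rw [map_mul, hb, hi, ha, ← map_mul, inv_mul_cancel₀ hx0, map_one, map_one]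

/-- A non-integral coordinate stays non-integral, and a partial derivative that is a unit stays a
unit. -/
theorem mapPts_mem_nonsingularReductionSet [IsLocalHom i] [M.IsMinimal R]
    [(M.baseChange l).IsMinimal S] {P : Points M} (hP : P ∈ nonsingularReductionSet R M) :
    mapPts (algebraMap k l) M (M.baseChange l) rfl P ∈
      nonsingularReductionSet S (M.baseChange l) := by
  by_contra hc
  obtain ⟨a, b, h, e, hs⟩ := exists_of_notMem_nonsingularReductionSet hc
  obtain _ | ⟨x, y, hn⟩ := P
  · cases e
  have e' : algebraMap k l x = algebraMap S l a ∧ algebraMap k l y = algebraMap S l b :=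
    (Affine.Point.some.injEq ..).mp e
  rcases hP x y hn rfl with hx | ⟨a', b', rfl, rfl, hab⟩
  · exact hx (mem_range_of_algebraMap_mem_range i hi ⟨a, e'.1.symm⟩)
  · rw [← hi, ← hi] at e'
    obtain rfl := IsFractionRing.injective S l e'.1
    obtain rfl := IsFractionRing.injective S l e'.2
    refine (nonsingular_reduction_iff hn.1).1 hab
      ⟨equation_integralModel_iff.2 hn.1, ?_, ?_⟩
    · by_contra h1
      have h2 := (notMem_maximalIdeal.1 h1).map i
      refine notMem_maximalIdeal.2 h2 ?_
      have := hs.memY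
      rw [integralModel_baseChange i hi M] at this
      simpa only [map_add, map_mul, map_ofNat, map_a₁, map_a₃] using this
    · by_contra h1
      have h2 := (notMem_maximalIdeal.1 h1).map i
      refine notMem_maximalIdeal.2 h2 ?_
      have := hs.memX
      rw [integralModel_baseChange i hi M] at this
      simpa only [map_add, map_sub, map_pow, map_mul, map_ofNat, map_a₁, map_a₂, map_a₄] using this

end Extension

end ArtinBSD


namespace ArtinBSD

/-! ### The Galois action on points of singular reduction. -/

section GaloisExtension

open WeierstrassCurve IsLocalRing

variable {R : Type*} [CommRing R] [IsDomain R] [IsDiscreteValuationRing R]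
variable {k : Type*} [Field k] [Algebra R k] [IsFractionRing R k]
variable {S : Type*} [CommRing S] [IsDomain S] [IsDiscreteValuationRing S]
variable {l : Type*} [Field l] [Algebra S l] [IsFractionRing S l]
variable [Algebra k l] (i : R →+* S)
  (hi : ∀ a, algebraMap S l (i a) = algebraMap k l (algebraMap R k a))
  (hσ : ∀ (σ : Gal(l/k)) (a : S), σ (algebraMap S l a) ∈ Set.range (algebraMap S l))
  (M : WeierstrassCurve k)

theorem ptsMap_some (σ : Gal(l/k)) {x y : l} (h : (M.baseChange l).toAffine.Nonsingular x y) :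
    ∃ h', ptsMap M (σ : l →ₐ[k] l) (.some x y h : (M.baseChange l).toAffine.Point) =
      (.some (σ x) (σ y) h' : (M.baseChange l).toAffine.Point) :=
  ⟨_, rfl⟩

theorem IsSingularMod.map_equiv {I : WeierstrassCurve S} {a b : S} (τ : S ≃+* S)
    (hI : I.map (τ : S →+* S) = I) (h : IsSingularMod (maximalIdeal S) I a b) :
    IsSingularMod (maximalIdeal S) I (τ a) (τ b) := by
  have hm : ∀ z ∈ maximalIdeal S, τ z ∈ maximalIdeal S := fun z hz h1 =>
    hz ((MulEquiv.isUnit_map τ).1 h1)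
  have h1 : I.a₁ = τ I.a₁ := (congrArg WeierstrassCurve.a₁ hI).symm
  have h2 : I.a₂ = τ I.a₂ := (congrArg WeierstrassCurve.a₂ hI).symm
  have h3 : I.a₃ = τ I.a₃ := (congrArg WeierstrassCurve.a₃ hI).symm
  have h4 : I.a₄ = τ I.a₄ := (congrArg WeierstrassCurve.a₄ hI).symm
  refine ⟨hI ▸ h.equation.map (τ : S →+* S), ?_, ?_⟩
  · have := hm _ h.memY
    rw [h1, h3]
    simpa only [map_add, map_mul, map_ofNat] using this
  · have := hm _ h.memX
    rw [h1, h2, h4]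
    simpa only [map_add, map_sub, map_pow, map_mul, map_ofNat] using this

include hi hσ

theorem exists_integralModel_equiv [M.IsIntegral R] [(M.baseChange l).IsIntegral S]
    (σ : Gal(l/k)) : ∃ τ : S ≃+* S, (∀ a, algebraMap S l (τ a) = σ (algebraMap S l a)) ∧
      (∀ a, τ (i a) = i a) ∧
      (integralModel S (M.baseChange l)).map (τ : S →+* S) = integralModel S (M.baseChange l) := by
  obtain ⟨τ, hτ⟩ := exists_ringEquiv_of_forall_mem_range (σ : l ≃+* l) (hσ σ) (hσ σ.symm)
  have hτi : ∀ a, τ (i a) = i a := fun a => by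
    apply IsFractionRing.injective S l
    rw [hτ, hi]
    exact σ.commutes _
  refine ⟨τ, hτ, hτi, ?_⟩
  rw [integralModel_baseChange i hi M, WeierstrassCurve.map_map]
  congr 1
  ext a
  exact hτi a

theorem ptsMap_notMem [M.IsMinimal R] [(M.baseChange l).IsMinimal S] (σ : Gal(l/k)) {P : Pts M l}
    (hP : P ∉ nonsingularReductionSet S (M.baseChange l)) :
    ptsMap M (σ : l →ₐ[k] l) P ∉ nonsingularReductionSet S (M.baseChange l) := by
  obtain ⟨a, b, h, rfl, hs⟩ := exists_of_notMem_nonsingularReductionSet hP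
  obtain ⟨τ, hτ, -, hI⟩ := exists_integralModel_equiv i hi hσ M σ
  intro hmem
  obtain ⟨h', e⟩ := ptsMap_some M σ h
  rcases hmem _ _ h' e with h1 | ⟨a', b', ha', hb', hn⟩
  · exact h1 (hσ σ a)
  · rw [← hτ] at ha' hb'
    obtain rfl := IsFractionRing.injective S l ha'
    obtain rfl := IsFractionRing.injective S l hb'
    refine (nonsingular_reduction_iff ?_).1 hn (hs.map_equiv τ hI)
    rw [hτ, hτ]
    exact h'.1

/-- A lift r of the x-coordinate of the node can be taken in the base ring, hence fixed by σ. Then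
x(σP) − r = σ(x(P) − r) is a unit multiple of x(P) − r, and `add_mem_or_sub_mem` applies to P and
σP. -/
theorem add_ptsMap_mem_or_sub_ptsMap_mem_of_notMem [IsLocalHom i] [M.IsMinimal R]
    [(M.baseChange l).IsMinimal S] (hΔ : M.Δ ≠ 0) (hc : dvrVal R k M.c₄ = 1) (σ : Gal(l/k))
    {P : Pts M l} (hP : P ∉ nonsingularReductionSet S (M.baseChange l)) :
    P + ptsMap M (σ : l →ₐ[k] l) P ∈ nonsingularReductionSet S (M.baseChange l) ∨
      P - ptsMap M (σ : l →ₐ[k] l) P ∈ nonsingularReductionSet S (M.baseChange l) := by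
  obtain ⟨a, b, h, rfl, hs⟩ := exists_of_notMem_nonsingularReductionSet hP
  obtain ⟨τ, hτ, hτi, hI⟩ := exists_integralModel_equiv i hi hσ M σ
  obtain ⟨h', e⟩ := ptsMap_some M σ h
  have hIM := integralModel_baseChange i hi M
  have hcR : IsUnit (integralModel R M).c₄ := by
    rw [← integralModel_c₄_eq R M, dvrVal_eq_one_iff] at hc
    exact hc
  have hDR : (integralModel R M).Δ ≠ 0 := by
    intro h0
    apply hΔ
    rw [← integralModel_Δ_eq R M, h0, map_zero]
  have hcS : IsUnit (integralModel S (M.baseChange l)).c₄ := by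
    rw [hIM, map_c₄]; exact hcR.map i
  have hlocal : ∀ z : R, i z ∈ maximalIdeal S → z ∈ maximalIdeal R := fun z hz h1 => hz (h1.map i)
  have hlocal' : ∀ z ∈ maximalIdeal R, i z ∈ maximalIdeal S := fun z hz h1 =>
    hz (isUnit_of_map_unit i z h1)
  have hshift : ∀ z, shiftB₄ (integralModel S (M.baseChange l)) (i z) =
      i (shiftB₄ (integralModel R M) z) := fun z => by
    rw [hIM]
    simp only [shiftB₄, map_b₂, map_b₄, map_add, map_mul, map_pow, map_ofNat]
  obtain ⟨u, hu⟩ := hcR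
  -- The first approximation solves c₄r₀ = 18b₆ − b₂b₄ in R; Newton's method then improves it until
  -- the shifted b₄ lies in Δ𝔪.
  set r₀ : R := ↑u⁻¹ * (18 * (integralModel R M).b₆ - (integralModel R M).b₂ *
    (integralModel R M).b₄) with hr₀
  have har₀ : a - i r₀ ∈ maximalIdeal S := by
    have h1 := hs.c₄_mul_sub_mem
    have h2 := Ideal.mul_mem_left _ (i ↑u⁻¹) h1
    have h3 : i ↑u⁻¹ * i u = 1 := by rw [← map_mul, Units.inv_mul, map_one]
    rw [hIM, map_c₄, ← hu, map_b₆, map_b₂, map_b₄] at h2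
    convert h2 using 1
    rw [hr₀]
    simp only [map_mul, map_sub, map_ofNat]
    linear_combination -a * h3
  have hb4₀ : shiftB₄ (integralModel R M) r₀ ∈ maximalIdeal R := by
    refine hlocal _ ?_
    rw [← hshift]
    have h1 := Ideal.sub_mem _ hs.shiftB₄_mem
      (shiftB₄_sub_mem (I := integralModel S (M.baseChange l)) har₀)
    rwa [sub_sub_cancel] at h1
  obtain ⟨n, hn⟩ := exists_forall_mem_pow_eq_mul hDR
  obtain ⟨r, hr, hrn⟩ := exists_shiftB₄_mem_pow (hu ▸ u.isUnit) hb4₀ n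
  obtain ⟨μ, hμ, hrμ⟩ := hn _ hrn
  have har : a - i r ∈ maximalIdeal S := by
    have := Ideal.sub_mem _ har₀ (hlocal' _ hr)
    rwa [map_sub, sub_sub_sub_cancel_right] at this
  obtain ⟨ε, hε, hετ⟩ := exists_isUnit_mul_eq τ (a - i r)
  rw [map_sub, hτi] at hετ
  have h'' : (M.baseChange l).toAffine.Nonsingular (algebraMap S l (τ a))
      (algebraMap S l (τ b)) := by
    rw [hτ, hτ]; exact h'
  have hΔ' : (M.baseChange l).Δ ≠ 0 := by
    rw [WeierstrassCurve.baseChange, map_Δ]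
    exact (map_ne_zero _).2 hΔ
  refine add_mem_or_sub_mem hΔ' hcS (h' := h'') hs har hε hετ (hlocal' _ hμ) ?_ rfl ?_
  · rw [hshift, hrμ, map_mul, hIM, map_Δ]
  · refine e.trans ?_
    exact (Affine.Point.some.injEq ..).mpr ⟨(hτ a).symm, (hτ b).symm⟩

/-- When c₄ is a unit, the Galois group acts up to sign modulo E₀(l), and its invariant points come
from E(k) = E₀(k), so `card_nsmul_mem_of_odd` applies. When Δ is a unit, E₀(l) is everything. -/
theorem card_nsmul_mem_closure [IsLocalHom i] [FiniteDimensional k l] [IsGalois k l]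
    [M.IsMinimal R] [(M.baseChange l).IsMinimal S] (hΔ : M.Δ ≠ 0)
    (hss : dvrVal R k M.c₄ = 1 ∨ dvrVal R k M.Δ = 1)
    (htop : AddSubgroup.closure (nonsingularReductionSet R M) = ⊤)
    (hodd : Odd (Nat.card Gal(l/k))) (P : Pts M l) :
    Nat.card Gal(l/k) • P ∈
      AddSubgroup.closure (nonsingularReductionSet S (M.baseChange l)) := by
  rcases hss with hc | hΔ1
  · let _ : DistribMulAction Gal(l/k) (Pts M l) :=
      { smul := fun σ P => ptsMap M (σ : l →ₐ[k] l) P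
        one_smul := fun P => DFunLike.congr_fun (ptsMap_id M) P
        mul_smul := fun σ τ P => DFunLike.congr_fun (ptsMap_comp M σ τ) P
        smul_zero := fun σ => map_zero _
        smul_add := fun σ => map_add _ }
    have hsmul : ∀ (σ : Gal(l/k)) (P : Pts M l), σ • P = ptsMap M (σ : l →ₐ[k] l) P :=
      fun _ _ => rfl
    have hmem : ∀ (σ : Gal(l/k)) (P : Pts M l),
        P ∈ nonsingularReductionSet S (M.baseChange l) →
        σ • P ∈ nonsingularReductionSet S (M.baseChange l) := fun σ P hP => by
      by_contra hc
      have := ptsMap_notMem i hi hσ M σ⁻¹ hc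
      rw [← hsmul, inv_smul_smul] at this
      exact this hP
    refine card_nsmul_mem_of_odd _ (fun σ a ha => ?_) hodd (fun σ a => ?_) (fun a ha => ?_) P
    · have h1 := AddSubgroup.mem_map_of_mem (ptsMap M (σ : l →ₐ[k] l)) ha
      rw [AddMonoidHom.map_closure] at h1
      refine AddSubgroup.closure_mono ?_ h1
      rintro _ ⟨Q, hQ, rfl⟩
      exact hmem σ Q hQ
    · by_cases h : a ∈ nonsingularReductionSet S (M.baseChange l)
      · exact Or.inl (AddSubgroup.add_mem _ (AddSubgroup.subset_closure h)
          (AddSubgroup.subset_closure (hmem σ a h)))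
      · exact (add_ptsMap_mem_or_sub_ptsMap_mem_of_notMem i hi hσ M hΔ hc σ h).imp
          (fun h => AddSubgroup.subset_closure h) (fun h => AddSubgroup.subset_closure h)
    · obtain ⟨Q, hQ⟩ : ∃ Q : Points M, mapPts (algebraMap k l) M (M.baseChange l) rfl Q = a := by
        obtain _ | ⟨x, y, h⟩ := a
        · exact ⟨0, map_zero _⟩
        · have h1 : ∀ σ : Gal(l/k), σ x = x ∧ σ y = y := fun σ => by
            obtain ⟨h', e⟩ := ptsMap_some M σ h
            exact (Affine.Point.some.injEq ..).mp (e.symm.trans (ha σ))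
          obtain ⟨x, rfl⟩ := (IsGalois.mem_range_algebraMap_iff_fixed (F := k) x).2
            fun σ => (h1 σ).1
          obtain ⟨y, rfl⟩ := (IsGalois.mem_range_algebraMap_iff_fixed (F := k) y).2
            fun σ => (h1 σ).2
          refine ⟨(.some x y ((Affine.map_nonsingular M.toAffine
            (algebraMap k l).injective x y).1 h) : M.toAffine.Point), ?_⟩
          exact mapPts_some ..
      have h1 : Q ∈ AddSubgroup.closure (nonsingularReductionSet R M) := htop ▸ AddSubgroup.mem_top Q
      have h2 := AddSubgroup.mem_map_of_mem (mapPts (algebraMap k l) M (M.baseChange l) rfl) h1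
      rw [AddMonoidHom.map_closure, hQ] at h2
      refine AddSubgroup.closure_mono ?_ h2
      rintro _ ⟨Q, hQ, rfl⟩
      exact mapPts_mem_nonsingularReductionSet i hi M hQ
  · refine AddSubgroup.nsmul_mem _ (AddSubgroup.subset_closure
      (mem_nonsingularReductionSet_of_isUnit_Δ ?_ P)) _
    rw [WeierstrassCurve.baseChange, map_Δ]
    exact dvrVal_algebraMap_eq_one i hi hΔ1

end GaloisExtension

end ArtinBSD


namespace ArtinBSD

/-! ### Completions of a Galois extension -/

section GaloisCompletion

variable {K L : Type*} [Field K] [NumberField K] [Field L] [NumberField L] [Algebra K L]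
  (w : HeightOneSpectrum (𝓞 L))

/-- `L_w` as an algebra over `K_v`. -/
noncomputable abbrev adicCompletionAlgebra (K : Type*) {L : Type*} [Field K] [NumberField K]
    [Field L] [NumberField L] [Algebra K L] (w : HeightOneSpectrum (𝓞 L)) :
    Algebra ((placeBelow K w).adicCompletion K) (w.adicCompletion L) :=
  (adicCompletionMap (K := K) w).toAlgebra

attribute [local instance] adicCompletionAlgebra

theorem isScalarTower_adicCompletion :
    IsScalarTower K ((placeBelow K w).adicCompletion K) (w.adicCompletion L) :=
  IsScalarTower.of_algebraMap_eq fun x => by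
    rw [IsScalarTower.algebraMap_apply K L (w.adicCompletion L)]
    exact (adicCompletionMap_algebraMap w x).symm

theorem continuousSMul_adicCompletion :
    ContinuousSMul ((placeBelow K w).adicCompletion K) (w.adicCompletion L) :=
  ⟨by
    simp only [Algebra.smul_def]
    exact ((continuous_adicCompletionMap w).comp continuous_fst).mul continuous_snd⟩

attribute [local instance] isScalarTower_adicCompletion continuousSMul_adicCompletion

open scoped Valued in
-- The subfield is finite-dimensional over the complete field K_v, hence closed, and it contains the
-- dense subfield L.
theorem adjoin_range_algebraMap_eq_top :
    IntermediateField.adjoin ((placeBelow K w).adicCompletion K)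
      (Set.range (algebraMap L (w.adicCompletion L))) = ⊤ := by
  set A := IntermediateField.adjoin ((placeBelow K w).adicCompletion K)
      (Set.range (algebraMap L (w.adicCompletion L)))
  have hcl := (Subalgebra.toSubmodule A.toSubalgebra).closed_of_finiteDimensional
  have hd := (w.denseRange_algebraMap L).mono
    (IntermediateField.subset_adjoin ((placeBelow K w).adicCompletion K) _ :
      Set.range (algebraMap L (w.adicCompletion L)) ⊆ A)
  refine eq_top_iff.2 fun x _ => ?_
  have : x ∈ closure (Subalgebra.toSubmodule A.toSubalgebra : Set (w.adicCompletion L)) := hd x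
  rw [hcl.closure_eq] at this
  exact this

open scoped Valued in
theorem continuous_galois (σ : Gal(w.adicCompletion L/(placeBelow K w).adicCompletion K)) :
    Continuous σ :=
  LinearMap.continuous_of_finiteDimensional σ.toLinearMap

/-- An automorphism of L_w over K_v is continuous, hence determined by its values on the dense
subfield L. -/
theorem restrict_injective [Normal K L] : Function.Injective
    ((AlgEquiv.restrictNormalHom (F := K) (K₁ := w.adicCompletion L) L).comp
      (AlgEquiv.restrictScalarsHom K :
        Gal(w.adicCompletion L/(placeBelow K w).adicCompletion K) →* _)) := by
  rw [injective_iff_map_eq_one]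
  intro σ hσ
  have h1 : ∀ x : L, σ (algebraMap L (w.adicCompletion L) x) = algebraMap L _ x := fun x => by
    have := AlgEquiv.restrictNormal_commutes (σ.restrictScalars K) L x
    have h2 : (σ.restrictScalars K).restrictNormal L = 1 := hσ
    rw [h2] at this
    exact this.symm
  refine AlgEquiv.ext fun x => ?_
  exact congrFun ((w.denseRange_algebraMap L).equalizer (continuous_galois w σ) continuous_id
    (funext h1)) x

theorem card_gal_completion_dvd [Normal K L] :
    Nat.card Gal(w.adicCompletion L/(placeBelow K w).adicCompletion K) ∣ Nat.card Gal(L/K) :=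
  Subgroup.card_dvd_of_injective _ (restrict_injective w)

/-- L is the splitting field over K of a separable polynomial. As L generates L_w over K_v, the same
polynomial has splitting field L_w over K_v. -/
theorem isGalois_completion [IsGalois K L] :
    IsGalois ((placeBelow K w).adicCompletion K) (w.adicCompletion L) := by
  obtain ⟨T, hT₁, hT₂⟩ := IsGalois.is_separable_splitting_field K L
  let T' := T.map (algebraMap K ((placeBelow K w).adicCompletion K))
  suffices T'.IsSplittingField ((placeBelow K w).adicCompletion K) (w.adicCompletion L) from
    IsGalois.of_separable_splitting_field (p := T') hT₁.map
  rw [isSplittingField_iff_intermediateField] at hT₂ ⊢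
  constructor
  · rw [Polynomial.map_map, ← IsScalarTower.algebraMap_eq]
    exact Polynomial.Splits.of_algHom hT₂.1 (IsScalarTower.toAlgHom _ _ _)
  · have h' : T'.rootSet (w.adicCompletion L) = T.rootSet (w.adicCompletion L) := by
      simp [Set.ext_iff, Polynomial.mem_rootSet', T']
    rw [eq_top_iff, ← adjoin_range_algebraMap_eq_top (K := K) w, IntermediateField.adjoin_le_iff, h']
    rintro _ ⟨x, rfl⟩
    have hx : x ∈ IntermediateField.adjoin K (T.rootSet L) := hT₂.2 ▸ IntermediateField.mem_top
    have hle : IntermediateField.adjoin K (T.rootSet L) ≤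
        ((IntermediateField.adjoin ((placeBelow K w).adicCompletion K)
          (T.rootSet (w.adicCompletion L))).restrictScalars K).comap
            (IsScalarTower.toAlgHom K L (w.adicCompletion L)) := by
      rw [IntermediateField.adjoin_le_iff]
      intro y hy
      refine IntermediateField.subset_adjoin _ _ ?_
      rw [Polynomial.mem_rootSet] at hy ⊢
      exact ⟨hy.1, (Polynomial.aeval_algebraMap_apply (w.adicCompletion L) y T).trans
        (by rw [hy.2, map_zero])⟩
    exact hle hx

theorem mem_range_integers_iff {x : w.adicCompletion L} :
    x ∈ Set.range (algebraMap (w.adicCompletionIntegers L) (w.adicCompletion L)) ↔ ‖x‖ ≤ 1 := by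
  rw [Valued.toNormedField.norm_le_one_iff, ← HeightOneSpectrum.mem_adicCompletionIntegers]
  exact ⟨fun ⟨a, ha⟩ => ha ▸ a.2, fun h => ⟨⟨x, h⟩, rfl⟩⟩

theorem galois_mem_range_integers
    (σ : Gal(w.adicCompletion L/(placeBelow K w).adicCompletion K))
    (a : w.adicCompletionIntegers L) :
    σ (algebraMap (w.adicCompletionIntegers L) (w.adicCompletion L) a) ∈
      Set.range (algebraMap (w.adicCompletionIntegers L) (w.adicCompletion L)) := by
  rw [mem_range_integers_iff]
  exact norm_map_le_one (j := (σ : w.adicCompletion L →+* w.adicCompletion L))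
    (exists_norm_lt_one w) (continuous_galois w σ) ((mem_range_integers_iff w).1 ⟨a, rfl⟩)

theorem adicCompletionMap_mem_integers (a : (placeBelow K w).adicCompletionIntegers K) :
    adicCompletionMap w (a : (placeBelow K w).adicCompletion K) ∈ w.adicCompletionIntegers L := by
  rw [HeightOneSpectrum.mem_adicCompletionIntegers, ← Valued.toNormedField.norm_le_one_iff]
  refine norm_adicCompletionMap_le_one w ?_
  rw [Valued.toNormedField.norm_le_one_iff]
  exact a.2

/-- The map on rings of integers of the completions. -/
noncomputable def integersMap (K : Type*) {L : Type*} [Field K] [NumberField K]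
    [Field L] [NumberField L] [Algebra K L] (w : HeightOneSpectrum (𝓞 L)) :
    (placeBelow K w).adicCompletionIntegers K →+* w.adicCompletionIntegers L :=
  ((adicCompletionMap (K := K) w).comp
    ((placeBelow K w).adicCompletionIntegers K).subtype).codRestrict
      (w.adicCompletionIntegers L) (adicCompletionMap_mem_integers w)

theorem algebraMap_integersMap (a : (placeBelow K w).adicCompletionIntegers K) :
    algebraMap (w.adicCompletionIntegers L) (w.adicCompletion L) (integersMap K w a) =
      algebraMap ((placeBelow K w).adicCompletion K) (w.adicCompletion L)
        (algebraMap ((placeBelow K w).adicCompletionIntegers K) _ a) := rfl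

theorem isUnit_integers_iff (a : w.adicCompletionIntegers L) :
    IsUnit a ↔ ¬ ‖algebraMap (w.adicCompletionIntegers L) (w.adicCompletion L) a‖ < 1 := by
  constructor
  · rintro ⟨u, rfl⟩ h
    have h1 : ‖algebraMap (w.adicCompletionIntegers L) (w.adicCompletion L) ↑u⁻¹‖ ≤ 1 :=
      (mem_range_integers_iff w).1 ⟨_, rfl⟩
    have h2 : ‖algebraMap (w.adicCompletionIntegers L) (w.adicCompletion L) ↑u‖ *
        ‖algebraMap (w.adicCompletionIntegers L) (w.adicCompletion L) ↑u⁻¹‖ = 1 := by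
      rw [← norm_mul, ← map_mul, Units.mul_inv, map_one, norm_one]
    have h3 := mul_lt_one_of_nonneg_of_lt_one_left (norm_nonneg _) h h1
    exact h3.ne h2
  · intro h
    rw [not_lt] at h
    set x := algebraMap (w.adicCompletionIntegers L) (w.adicCompletion L) a with hx
    have h0 : x ≠ 0 := norm_pos_iff.1 (one_pos.trans_le h)
    obtain ⟨b, hb⟩ := (mem_range_integers_iff w (x := x⁻¹)).2 (by
      rw [norm_inv]; exact inv_le_one_of_one_le₀ h)
    refine IsUnit.of_mul_eq_one b ?_
    apply IsFractionRing.injective (w.adicCompletionIntegers L) (w.adicCompletion L)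
    rw [map_mul, hb, ← hx, mul_inv_cancel₀ h0, map_one]

theorem isLocalHom_integersMap : IsLocalHom (integersMap K w) := ⟨fun a ha => by
  rw [isUnit_integers_iff] at ha ⊢
  rwa [algebraMap_integersMap, RingHom.algebraMap_toAlgebra,
    norm_adicCompletionMap_lt_one_iff] at ha⟩

end GaloisCompletion

end ArtinBSD


namespace ArtinBSD

/-! ### Tamagawa numbers and minimal differentials in a Galois extension -/

section Tamagawa

open WeierstrassCurve

variable {K L : Type*} [Field K] [NumberField K] [Field L] [NumberField L] [Algebra K L]
  (w : HeightOneSpectrum (𝓞 L)) (W : WeierstrassCurve K)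

attribute [local instance] adicCompletionAlgebra isScalarTower_adicCompletion
  continuousSMul_adicCompletion isLocalHom_integersMap

/-- The value 0 stands for infinite index; otherwise the quotient is a finite group killed by ℓ. -/
theorem index_eq_zero_or_pow {A : Type*} [AddCommGroup A] (H : AddSubgroup A) {ℓ : ℕ}
    [Fact ℓ.Prime] (h : ∀ a : A, ℓ • a ∈ H) : H.index = 0 ∨ ∃ n, H.index = ℓ ^ n := by
  rw [or_iff_not_imp_left]
  intro h0
  have : Finite (A ⧸ H) := Nat.finite_of_card_ne_zero h0
  refine (IsPGroup.iff_card (p := ℓ) (G := Multiplicative (A ⧸ H))).1 fun x => ⟨1, ?_⟩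
  obtain ⟨a, ha⟩ := QuotientAddGroup.mk_surjective (s := H) x.toAdd
  rw [pow_one, ← toAdd_eq_zero, toAdd_pow, ← ha]
  exact (QuotientAddGroup.eq_zero_iff _).2 (h a)

theorem baseChange_atPlace : (atPlace W (placeBelow K w)).baseChange (w.adicCompletion L) =
    atPlace (W.baseChange L) w := by
  simp only [atPlace, WeierstrassCurve.baseChange, WeierstrassCurve.map_map]
  congr 1
  exact RingHom.ext fun x => adicCompletionMap_algebraMap w x

/-- The change of variables compares the base-changed minimal equation with the one chosen over L_w.
The second clause holds because the scalars u multiply under composition. -/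
theorem exists_minimal_baseChange_eq :
    ∃ C : VariableChange (w.adicCompletion L),
      ((atPlace W (placeBelow K w)).minimal
        ((placeBelow K w).adicCompletionIntegers K)).baseChange (w.adicCompletion L) =
      C • (atPlace (W.baseChange L) w).minimal (w.adicCompletionIntegers L) ∧
      (C.u : w.adicCompletion L) * minimalScale (w.adicCompletionIntegers L)
        (atPlace (W.baseChange L) w) = adicCompletionMap w
          (minimalScale ((placeBelow K w).adicCompletionIntegers K) (atPlace W (placeBelow K w)) :
            (placeBelow K w).adicCompletion K) := by
  set C₁ := ((atPlace W (placeBelow K w)).exists_isMinimal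
    ((placeBelow K w).adicCompletionIntegers K)).choose
  set C₂ := ((atPlace (W.baseChange L) w).exists_isMinimal
    (w.adicCompletionIntegers L)).choose with hC₂
  refine ⟨C₁.baseChange (w.adicCompletion L) * C₂⁻¹, ?_, ?_⟩
  · rw [WeierstrassCurve.minimal, WeierstrassCurve.minimal, ← hC₂, mul_smul, inv_smul_smul,
      ← baseChange_atPlace]
    exact (map_variableChange ..).symm
  · have h1 : (C₁.baseChange (w.adicCompletion L) * C₂⁻¹).u * C₂.u =
        (C₁.baseChange (w.adicCompletion L)).u := by
      have : (C₁.baseChange (w.adicCompletion L) * C₂⁻¹ * C₂).u =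
        (C₁.baseChange (w.adicCompletion L)).u := by rw [inv_mul_cancel_right]
      exact this
    exact congrArg Units.val h1

theorem minimal_Δ_ne_zero {R : Type*} [CommRing R] [IsDomain R] [IsDiscreteValuationRing R]
    {k : Type*} [Field k] [Algebra R k] [IsFractionRing R k] {M : WeierstrassCurve k}
    (hM : M.Δ ≠ 0) : (M.minimal R).Δ ≠ 0 := by
  rw [WeierstrassCurve.minimal, variableChange_Δ]
  exact mul_ne_zero (pow_ne_zero _ (Units.ne_zero _)) hM

theorem baseChange_Δ_ne_zero {k l : Type*} [Field k] [Field l] [Algebra k l]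
    {M : WeierstrassCurve k} (hM : M.Δ ≠ 0) : (M.baseChange l).Δ ≠ 0 := by
  rw [WeierstrassCurve.baseChange, map_Δ]
  exact (map_ne_zero _).2 hM

theorem valuation_of_hasSemistableRed {R : Type*} [CommRing R] [IsDomain R]
    [IsDiscreteValuationRing R] {k : Type*} [Field k] [Algebra R k] [IsFractionRing R k]
    {M : WeierstrassCurve k} (h : HasSemistableRed R M) :
    dvrVal R k (M.minimal R).c₄ = 1 ∨ dvrVal R k (M.minimal R).Δ = 1 :=
  h.elim (fun h => Or.inr h.goodReduction) fun h => Or.inl h.multiplicativeReduction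

theorem norm_eq_one_of_dvrVal {x : w.adicCompletion L}
    (hx : dvrVal (w.adicCompletionIntegers L) (w.adicCompletion L) x = 1) : ‖x‖ = 1 := by
  obtain ⟨a, rfl⟩ := dvrVal_le_one_iff.1 hx.le
  exact le_antisymm ((mem_range_integers_iff w).1 ⟨a, rfl⟩)
    (not_lt.1 ((isUnit_integers_iff w a).1 (dvrVal_eq_one_iff.1 hx)))

variable (hss : HasSemistableRed ((placeBelow K w).adicCompletionIntegers K)
  (atPlace W (placeBelow K w)))

include hss

theorem isMinimal_minimal_baseChange : (((atPlace W (placeBelow K w)).minimal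
    ((placeBelow K w).adicCompletionIntegers K)).baseChange (w.adicCompletion L)).IsMinimal
      (w.adicCompletionIntegers L) :=
  isMinimal_baseChange (integersMap K w) (algebraMap_integersMap w) _
    (valuation_of_hasSemistableRed hss)

/-- Both equations over L_w are minimal, so the scalar u relating them has absolute value 1. -/
theorem minimalScaleAbs_baseChange (hΔ : W.Δ ≠ 0) :
    minimalScaleAbs (W.baseChange L) w = ‖adicCompletionMap w
      (minimalScale ((placeBelow K w).adicCompletionIntegers K) (atPlace W (placeBelow K w)) :
        (placeBelow K w).adicCompletion K)‖ := by
  obtain ⟨C, hC, hu⟩ := exists_minimal_baseChange_eq w W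
  have h1 := isMinimal_minimal_baseChange w W hss
  rw [hC] at h1
  have h2 := valuation_u_eq_one_of_isMinimal (R := w.adicCompletionIntegers L)
    (minimal_Δ_ne_zero (R := w.adicCompletionIntegers L) (M := atPlace (W.baseChange L) w)
      (baseChange_Δ_ne_zero (baseChange_Δ_ne_zero hΔ))) C
  rw [← hu, norm_mul, norm_eq_one_of_dvrVal w h2, one_mul]
  rfl

/-- The local Galois group embeds in Gal(L/K), so its order divides ℓ and is odd. This order kills
E/E₀, and so does ℓ. -/
theorem tamagawa_baseChange_eq_zero_or_pow (hΔ : W.Δ ≠ 0) [IsGalois K L] {ℓ : ℕ} [Fact ℓ.Prime] (hℓ : ℓ ≠ 2)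
    (hcard : Nat.card Gal(L/K) = ℓ) (htam : tamagawa W (placeBelow K w) = 1) :
    tamagawa (W.baseChange L) w = 0 ∨ ∃ n, tamagawa (W.baseChange L) w = ℓ ^ n := by
  refine index_eq_zero_or_pow _ ?_
  obtain ⟨C, hC, -⟩ := exists_minimal_baseChange_eq w W
  have hmin := isMinimal_minimal_baseChange w W hss
  refine nsmul_mem_closure_of_variableChange (minimal_Δ_ne_zero
    (baseChange_Δ_ne_zero (baseChange_Δ_ne_zero hΔ))) C hC fun P => ?_
  have := isGalois_completion (K := K) w
  obtain ⟨d, hd⟩ := hcard ▸ card_gal_completion_dvd (K := K) w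
  have hodd : Odd (Nat.card
      Gal(w.adicCompletion L/(placeBelow K w).adicCompletion K)) :=
    Odd.of_dvd_nat ((Fact.out : ℓ.Prime).odd_of_ne_two hℓ) ⟨d, hd⟩
  rw [hd, mul_comm, mul_smul]
  refine AddSubgroup.nsmul_mem _ ?_ d
  exact card_nsmul_mem_closure (integersMap K w) (algebraMap_integersMap w)
    (galois_mem_range_integers w) _ (minimal_Δ_ne_zero (baseChange_Δ_ne_zero hΔ))
    (valuation_of_hasSemistableRed hss)
    (AddSubgroup.index_eq_one.1 htam) hodd P

end Tamagawa

end ArtinBSD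


namespace ArtinBSD

/-! ### The global minimal differential and the local factor -/

section LocalFactor

open WeierstrassCurve

section

variable {K : Type*} [Field K] [NumberField K]

theorem dvrVal_eq_one_of_norm (v : HeightOneSpectrum (𝓞 K)) {x : v.adicCompletion K}
    (hx : ‖x‖ = 1) : dvrVal (v.adicCompletionIntegers K) (v.adicCompletion K) x = 1 := by
  obtain ⟨a, rfl⟩ := (mem_range_integers_iff v).2 hx.le
  exact dvrVal_eq_one_iff.2 ((isUnit_integers_iff v a).2 hx.not_lt)

theorem norm_eq_one_of_valuation (v : HeightOneSpectrum (𝓞 K)) {x : K}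
    (hx : v.valuation K x = 1) : ‖algebraMap K (v.adicCompletion K) x‖ = 1 :=
  le_antisymm ((norm_algebraMap_le_one_iff v x).2 hx.le)
    (not_lt.1 fun h => ((norm_algebraMap_lt_one_iff v x).1 h).ne hx)

theorem minimalScaleAbs_eq_one (W : WeierstrassCurve K) (v : HeightOneSpectrum (𝓞 K))
    (h₁ : v.valuation K W.a₁ ≤ 1) (h₂ : v.valuation K W.a₂ ≤ 1) (h₃ : v.valuation K W.a₃ ≤ 1)
    (h₄ : v.valuation K W.a₄ ≤ 1) (h₆ : v.valuation K W.a₆ ≤ 1) (hΔ : v.valuation K W.Δ = 1) :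
    minimalScaleAbs W v = 1 := by
  have hmem : ∀ {x : K}, v.valuation K x ≤ 1 →
      ∃ a : v.adicCompletionIntegers K, algebraMap _ (v.adicCompletion K) a = algebraMap K _ x :=
    fun h => (mem_range_integers_iff v).2 ((norm_algebraMap_le_one_iff v _).2 h)
  have hint : (atPlace W v).IsIntegral (v.adicCompletionIntegers K) :=
    isIntegral_of_exists_lift _ (hmem h₁) (hmem h₂) (hmem h₃) (hmem h₄) (hmem h₆)
  have hmin : (atPlace W v).IsMinimal (v.adicCompletionIntegers K) := by
    refine isMinimal_of_valuation_c₄ (Or.inr ?_)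
    rw [atPlace, WeierstrassCurve.baseChange, map_Δ]
    exact dvrVal_eq_one_of_norm v (norm_eq_one_of_valuation v hΔ)
  have hΔ0 : W.Δ ≠ 0 := by
    rintro h0
    rw [h0, map_zero] at hΔ
    exact zero_ne_one hΔ
  have := ((atPlace W v).exists_isMinimal (v.adicCompletionIntegers K)).choose_spec
  exact norm_eq_one_of_dvrVal v (valuation_u_eq_one_of_isMinimal
    (R := v.adicCompletionIntegers K) (W := atPlace W v) (baseChange_Δ_ne_zero hΔ0)
    ((atPlace W v).exists_isMinimal (v.adicCompletionIntegers K)).choose)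

theorem finite_minimalScaleAbs_ne_one (W : WeierstrassCurve K) (hΔ : W.Δ ≠ 0) :
    {v : HeightOneSpectrum (𝓞 K) | minimalScaleAbs W v ≠ 1}.Finite := by
  have hf : ∀ x : K, {v : HeightOneSpectrum (𝓞 K) | 1 < v.valuation K x}.Finite :=
    fun x => HeightOneSpectrum.Support.finite (𝓞 K) x
  refine ((hf W.a₁).union ((hf W.a₂).union ((hf W.a₃).union ((hf W.a₄).union ((hf W.a₆).union
    ((hf W.Δ).union (hf W.Δ⁻¹))))))).subset fun v hv => ?_
  by_contra hc
  simp only [Set.mem_union, Set.mem_ofPred_eq, not_or, not_lt] at hc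
  obtain ⟨h₁, h₂, h₃, h₄, h₆, h7, h8⟩ := hc
  refine hv (minimalScaleAbs_eq_one W v h₁ h₂ h₃ h₄ h₆ (le_antisymm h7 ?_))
  rw [map_inv₀] at h8
  exact (inv_le_one₀ (zero_lt_iff.2 ((Valuation.ne_zero_iff _).2 hΔ))).1 h8

theorem exists_norm_eq_zpow (v : HeightOneSpectrum (𝓞 K)) {π : K}
    (hπ : v.valuation K π = WithZero.exp (-1)) {x : v.adicCompletion K} (hx : x ≠ 0) :
    ∃ n : ℤ, ‖x‖ = ‖algebraMap K (v.adicCompletion K) π‖ ^ n := by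
  have hv : Valued.v x ≠ 0 := (Valuation.ne_zero_iff _).2 hx
  have hπ' : Valued.v (algebraMap K (v.adicCompletion K) π) = WithZero.exp (-1 : ℤ) := by
    rw [← hπ]
    exact HeightOneSpectrum.valuedAdicCompletion_eq_valuation' v π
  refine ⟨-WithZero.log (Valued.v x), ?_⟩
  rw [← norm_zpow, NumberField.FinitePlace.norm_def, NumberField.FinitePlace.norm_def, map_zpow₀,
    hπ', ← WithZero.exp_zsmul]
  simp [WithZero.exp_log hv]

end

/-- Every prime of ℤ has a generator π_p, a unit at all other primes, and the local scales have norm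
1 outside a finite set. The product of the right powers of the π_p has the prescribed norm
everywhere. -/
theorem exists_isGlobalMinimalScale (E : WeierstrassCurve ℚ) (hΔ : E.Δ ≠ 0) :
    ∃ c, IsGlobalMinimalScale E c := by
  classical
  have : IsPrincipalIdealRing (𝓞 ℚ) :=
    IsPrincipalIdealRing.of_surjective Rat.ringOfIntegersEquiv.symm.toRingHom
      Rat.ringOfIntegersEquiv.symm.surjective
  have hgen : ∀ p : HeightOneSpectrum (𝓞 ℚ), ∃ π : 𝓞 ℚ, p.asIdeal = Ideal.span {π} := fun p =>
    (IsPrincipalIdealRing.principal p.asIdeal).principal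
  choose π hπ using hgen
  have hπ0 : ∀ p : HeightOneSpectrum (𝓞 ℚ), π p ≠ 0 := fun p h => p.ne_bot (by rw [hπ, h, Ideal.span_singleton_eq_bot])
  have hval : ∀ p : HeightOneSpectrum (𝓞 ℚ), p.valuation ℚ (algebraMap (𝓞 ℚ) ℚ (π p)) = WithZero.exp (-1) := fun p => by
    rw [HeightOneSpectrum.valuation_of_algebraMap, p.intValuation_singleton (hπ0 p) (hπ p)]
  have hval' : ∀ p q : HeightOneSpectrum (𝓞 ℚ), p ≠ q →
      q.valuation ℚ (algebraMap (𝓞 ℚ) ℚ (π p)) = 1 := fun p q hpq => by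
    rw [HeightOneSpectrum.valuation_eq_one_iff_notMem]
    intro hmem
    refine hpq (HeightOneSpectrum.ext (p.isMaximal.eq_of_le q.isPrime.ne_top ?_))
    rw [hπ p, Ideal.span_singleton_le_iff_mem]
    exact hmem
  have hn := fun p : HeightOneSpectrum (𝓞 ℚ) => exists_norm_eq_zpow p (hval p)
    (minimalScale (p.adicCompletionIntegers ℚ) (atPlace E p)).ne_zero
  choose n hn using hn
  set s := (finite_minimalScaleAbs_ne_one E hΔ).toFinset
  refine ⟨∏ p ∈ s, algebraMap (𝓞 ℚ) ℚ (π p) ^ n p, ?_, fun q => ?_⟩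
  · exact Finset.prod_ne_zero_iff.2 fun p _ => zpow_ne_zero _ (by simpa using hπ0 p)
  · rw [map_prod, norm_prod]
    have h1 : ∀ p ∈ s, p ≠ q → ‖algebraMap ℚ (q.adicCompletion ℚ)
        (algebraMap (𝓞 ℚ) ℚ (π p) ^ n p)‖ = 1 := fun p _ hpq => by
      rw [map_zpow₀, norm_zpow, norm_eq_one_of_valuation q (hval' p q hpq), one_zpow]
    by_cases hq : q ∈ s
    · rw [Finset.prod_eq_single_of_mem q hq h1, map_zpow₀, norm_zpow, ← hn q]
      rfl
    · rw [Finset.prod_eq_one fun p hp => h1 p hp (ne_of_mem_of_not_mem hp hq)]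
      simpa [s, eq_comm] using hq

theorem isGlobalMinimalScale_globalMinimalScale (E : WeierstrassCurve ℚ) (hΔ : E.Δ ≠ 0) :
    IsGlobalMinimalScale E (globalMinimalScale E) :=
  Classical.epsilon_spec (exists_isGlobalMinimalScale E hΔ)

/-- The map of completions need not preserve norms, but it preserves norm 1; it is therefore applied
to the quotient of the global and the local scale. -/
theorem norm_globalMinimalScale_eq {L : Type*} [Field L] [NumberField L] [Algebra ℚ L]
    (E : WeierstrassCurve ℚ) (hΔ : E.Δ ≠ 0) (hss : IsSemistable E) (w : HeightOneSpectrum (𝓞 L)) :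
    ‖algebraMap L (w.adicCompletion L) (algebraMap ℚ L (globalMinimalScale E))‖ =
      minimalScaleAbs (E.baseChange L) w := by
  rw [minimalScaleAbs_baseChange w E (hss _) hΔ, ← adicCompletionMap_algebraMap]
  have h1 := (isGlobalMinimalScale_globalMinimalScale E hΔ).2 (placeBelow ℚ w)
  set u : (placeBelow ℚ w).adicCompletion ℚ :=
    ((minimalScale ((placeBelow ℚ w).adicCompletionIntegers ℚ) (atPlace E (placeBelow ℚ w)) :
      ((placeBelow ℚ w).adicCompletion ℚ)ˣ) : (placeBelow ℚ w).adicCompletion ℚ)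
  have hu : u ≠ 0 := Units.ne_zero _
  set c := algebraMap ℚ ((placeBelow ℚ w).adicCompletion ℚ) (globalMinimalScale E)
  have h2 : ‖c / u‖ = 1 := by
    rw [norm_div, h1]
    exact div_self (norm_ne_zero_iff.2 hu)
  have h3 : ‖adicCompletionMap w (c / u)‖ = 1 :=
    le_antisymm (norm_adicCompletionMap_le_one w h2.le)
      (not_lt.1 fun h => ((norm_adicCompletionMap_lt_one_iff w).1 h).ne h2)
  rw [map_div₀, norm_div] at h3
  exact eq_of_div_eq_one h3

theorem minimalScaleAbs_ne_zero {L : Type*} [Field L] [NumberField L] (W : WeierstrassCurve L)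
    (w : HeightOneSpectrum (𝓞 L)) : minimalScaleAbs W w ≠ 0 :=
  norm_ne_zero_iff.2 (Units.ne_zero _)

theorem localFactor_eq_finprod {L : Type*} [Field L] [NumberField L] [Algebra ℚ L]
    (E : WeierstrassCurve ℚ) (hΔ : E.Δ ≠ 0) (hss : IsSemistable E) :
    localFactor L E = ∏ᶠ w : HeightOneSpectrum (𝓞 L), (tamagawa (E.baseChange L) w : ℝ) := by
  refine finprod_congr fun w => ?_
  rw [norm_globalMinimalScale_eq E hΔ hss, div_self (minimalScaleAbs_ne_zero _ w), mul_one]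

theorem localFactor_rat (E : WeierstrassCurve ℚ) (hΔ : E.Δ ≠ 0) (hss : IsSemistable E)
    (htam : ∀ v, tamagawa E v = 1) : localFactor ℚ E = 1 := by
  rw [localFactor_eq_finprod E hΔ hss]
  refine finprod_eq_one_of_forall_eq_one fun v => ?_
  have : E.baseChange ℚ = E := by
    rw [WeierstrassCurve.baseChange, Subsingleton.elim (algebraMap ℚ ℚ) (RingHom.id ℚ), map_id]
  rw [this, htam, Nat.cast_one]

theorem localFactor_eq_zero_or_pow {L : Type*} [Field L] [NumberField L] [Algebra ℚ L]
    [IsGalois ℚ L] {ℓ : ℕ} [Fact ℓ.Prime] (hℓ : ℓ ≠ 2) (hcard : Nat.card Gal(L/ℚ) = ℓ)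
    (E : WeierstrassCurve ℚ) (hΔ : E.Δ ≠ 0) (hss : IsSemistable E)
    (htam : ∀ v, tamagawa E v = 1) :
    localFactor L E = 0 ∨ ∃ n : ℕ, localFactor L E = (ℓ : ℝ) ^ n := by
  rw [localFactor_eq_finprod E hΔ hss]
  -- The property is closed under products. The value 0, arising from a possibly infinite index, has
  -- to be carried along; an infinite support would give the default 1 = ℓ⁰.
  refine finprod_induction (fun x : ℝ => x = 0 ∨ ∃ n : ℕ, x = (ℓ : ℝ) ^ n) (Or.inr ⟨0, by simp⟩)
    ?_ fun w => ?_
  · rintro x y (rfl | ⟨m, rfl⟩) (rfl | ⟨n, rfl⟩)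
    · simp
    · simp
    · simp
    · exact Or.inr ⟨m + n, (pow_add _ _ _).symm⟩
  · rcases tamagawa_baseChange_eq_zero_or_pow w E (hss _) hΔ hℓ hcard (htam _) with h | ⟨n, h⟩
    · left; rw [h, Nat.cast_zero]
    · right; exact ⟨n, by rw [h, Nat.cast_pow]⟩

end LocalFactor

end ArtinBSD


namespace ArtinBSD

/-! ### The Tate–Shafarevich group under restriction -/

section ShaRestriction

variable {K Ω : Type*} [Field K] [NumberField K] [Field Ω] [Algebra ℚ K] [Algebra ℚ Ω] [Algebra K Ω]
  [IsScalarTower ℚ K Ω] {W : WeierstrassCurve ℚ} {W' : WeierstrassCurve K}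

theorem restrictCochain_mem_shaCocycles [Algebra.IsAlgebraic ℚ Ω]
    (h : W' = W.map (algebraMap ℚ K)) {c : Gal(Ω/ℚ) → Pts W Ω} (hc : c ∈ shaCocycles W Ω) :
    restrictCochain h c ∈ shaCocycles W' Ω := by
  obtain ⟨⟨h1, h2⟩, h3⟩ := hc
  refine ⟨⟨restrictCochain_mem_cocycles h h1, ?_⟩, ?_⟩
  · refine AddSubgroup.mem_iInf.2 fun w => ?_
    exact restrictCochain_mem_locallyTrivial h (adicCompletionMap w)
      (fun x => DFunLike.congr_fun (Subsingleton.elim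
        ((adicCompletionMap w).comp (algebraMap ℚ ((placeBelow ℚ w).adicCompletion ℚ)))
        ((algebraMap K (w.adicCompletion K)).comp (algebraMap ℚ K))) x)
      (AddSubgroup.mem_iInf.1 h2 (placeBelow ℚ w))
  · refine AddSubgroup.mem_iInf.2 fun w => ?_
    let v : NumberField.InfinitePlace ℚ := w.comap (algebraMap ℚ K)
    have : w.LiesOver v := ⟨rfl⟩
    let j : v.Completion →+* w.Completion := NumberField.LiesOver.completionMap
    exact restrictCochain_mem_locallyTrivial h j
      (fun x => DFunLike.congr_fun (Subsingleton.elim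
        (j.comp (algebraMap ℚ v.Completion))
        ((algebraMap K w.Completion).comp (algebraMap ℚ K))) x)
      (AddSubgroup.mem_iInf.1 h3 v)

end ShaRestriction

theorem baseChange_eq_map_baseChange_rat (E : WeierstrassCurve ℚ) (K : Type*) [Field K]
    [Algebra ℚ K] : E.baseChange K = (E.baseChange ℚ).map (algebraMap ℚ K) := by
  rw [WeierstrassCurve.baseChange, WeierstrassCurve.baseChange, WeierstrassCurve.map_map]
  congr 1

theorem mem_coboundaries_of_restrictCochain {K Ω : Type*} [Field K] [Field Ω] [Algebra ℚ K]
    [Algebra ℚ Ω] [Algebra K Ω] [IsScalarTower ℚ K Ω] {W : WeierstrassCurve ℚ}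
    {W' : WeierstrassCurve K} (h : W' = W.map (algebraMap ℚ K)) {c : Gal(Ω/ℚ) → Pts W Ω}
    (hres : restrictCochain h c ∈ coboundaries W' Ω) :
    ∃ P : Pts W Ω, ∀ σ : Gal(Ω/ℚ), (∀ x : K, σ (algebraMap K Ω x) = algebraMap K Ω x) →
      c σ = ptsMap W (σ : Ω →ₐ[ℚ] Ω) P - P := by
  obtain ⟨Q, hQ⟩ := hres
  have hid := baseChange_eq_map_id (Ω := Ω) h
  have hid' : W.baseChange Ω = (W'.baseChange Ω).map (RingHom.id Ω) := by
    rw [hid, WeierstrassCurve.map_id, WeierstrassCurve.map_id]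
  have hsurj : mapPts (RingHom.id Ω) _ _ hid (mapPts (RingHom.id Ω) _ _ hid' Q) = Q := by
    cases Q with
    | zero => exact (congrArg _ (mapPts_zero _ _ _ _)).trans (mapPts_zero _ _ _ _)
    | some x y hxy =>
      exact (congrArg _ (mapPts_some _ _ _ _ _ _ _)).trans (mapPts_some _ _ _ _ _ _ _)
  refine ⟨mapPts (RingHom.id Ω) _ _ hid' Q, fun σ hσ => ?_⟩
  let τ : Gal(Ω/K) := AlgEquiv.ofRingEquiv (f := (σ : Ω ≃+* Ω)) hσ
  have hτ : (τ.restrictScalars ℚ : Gal(Ω/ℚ)) = σ := AlgEquiv.ext fun x => rfl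
  apply mapPts_injective (RingHom.id Ω) _ _ hid
  have h1 := hQ τ
  have h2 := mapPts_id_ptsMap h τ (mapPts (RingHom.id Ω) _ _ hid' Q)
  rw [hτ] at h2
  rw [map_sub, h2, hsurj]
  exact (congrArg (fun s => mapPts (RingHom.id Ω) _ _ hid (c s)) hτ).symm.trans h1

/-- If `q` is prime to the degree of `F` then `Ш_{E/ℚ}[q]` injects into `Ш_{E/F}`. -/
theorem sha_eq_zero_of_nsmul_eq_zero (E : WeierstrassCurve ℚ) {ℓ q : ℕ} (hℓ : ℓ.Prime)
    (hq : q.Prime) (hqℓ : q ≠ ℓ) (F : IntermediateField ℚ QBar) [NumberField F] [IsGalois ℚ F]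
    (hdeg : Module.finrank ℚ F = ℓ)
    (h1 : Nat.card (AddCommGroup.primaryComponent (ShaOver E F) q) = 1)
    (x : ShaOver E ℚ) (hx : q • x = 0) : x = 0 := by
  have : IsScalarTower ℚ F QBar := .of_algebraMap_eq' (Subsingleton.elim _ _)
  have : Algebra.IsAlgebraic ℚ QBar := IsAlgClosure.isAlgebraic
  have hW := baseChange_eq_map_baseChange_rat E F
  obtain ⟨⟨c, hc⟩, rfl⟩ := QuotientAddGroup.mk_surjective x
  have hqc : q • c ∈ coboundaries (E.baseChange ℚ) QBar := by
    rw [← QuotientAddGroup.mk_nsmul, QuotientAddGroup.eq_zero_iff] at hx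
    exact hx
  have hres := restrictCochain_mem_shaCocycles hW hc
  have hqres : q • restrictCochain hW c ∈ coboundaries (E.baseChange F) QBar := by
    rw [← restrictCochain_nsmul]
    exact restrictCochain_mem_coboundaries hW hqc
  let y : ShaOver E F := QuotientAddGroup.mk ⟨restrictCochain hW c, hres⟩
  have hy : q • y = 0 := by
    rw [← QuotientAddGroup.mk_nsmul, QuotientAddGroup.eq_zero_iff]
    exact hqres
  have hy' : y ∈ AddCommGroup.primaryComponent (ShaOver E F) q :=
    AddCommGroup.mem_primaryComponent.2 ⟨1, by rw [pow_one, hy]⟩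
  have hy0 : y = 0 := by
    have := (Nat.card_eq_one_iff_unique.1 h1).1
    exact congrArg Subtype.val (Subsingleton.elim
      (⟨y, hy'⟩ : AddCommGroup.primaryComponent (ShaOver E F) q) 0)
  have hcob : restrictCochain hW c ∈ coboundaries (E.baseChange F) QBar :=
    (QuotientAddGroup.eq_zero_iff
      (⟨restrictCochain hW c, hres⟩ : shaCocycles (E.baseChange F) QBar)).1 hy0
  obtain ⟨P, hP⟩ := mem_coboundaries_of_restrictCochain hW hcob
  obtain ⟨ψ, hψ, hker⟩ := exists_hom_zmod hℓ F hdeg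
  have hindex : (absGal F).index = ℓ := by
    have : Fact ℓ.Prime := ⟨hℓ⟩
    rw [← hker, Subgroup.index_ker, MonoidHom.range_eq_top.2 hψ, Subgroup.card_top,
      Nat.card_eq_fintype_card, Fintype.card_multiplicative, ZMod.card]
  have : (absGal F).FiniteIndex := ⟨by rw [hindex]; exact hℓ.ne_zero⟩
  -- The class of c dies over F, so it is killed by the degree ℓ. It is also killed by q, which is
  -- prime to ℓ.
  have hℓc := index_nsmul_mem_coboundaries hc.1.1 (absGal F) hP
  rw [hindex] at hℓc
  have hℓx : ℓ • (QuotientAddGroup.mk ⟨c, hc⟩ : ShaOver E ℚ) = 0 := by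
    rw [← QuotientAddGroup.mk_nsmul, QuotientAddGroup.eq_zero_iff]
    exact hℓc
  have h2 := addOrderOf_dvd_of_nsmul_eq_zero hℓx
  have h3 := addOrderOf_dvd_of_nsmul_eq_zero hx
  rw [← AddMonoid.addOrderOf_eq_one_iff]
  exact Nat.dvd_one.1 (((Nat.coprime_primes hq hℓ).2 hqℓ) ▸ Nat.dvd_gcd h3 h2)

/-! ### Orders of finite abelian groups and their primary components -/

section Card

/-- By Cauchy's theorem a prime dividing the order yields an element of that order. -/
theorem exists_card_eq_pow_of_forall_prime {A : Type*} [AddCommGroup A] [Finite A] {ℓ : ℕ}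
    (h : ∀ q : ℕ, q.Prime → q ≠ ℓ → ∀ x : A, q • x = 0 → x = 0) :
    ∃ n : ℕ, Nat.card A = ℓ ^ n := by
  refine ⟨_, Nat.eq_prime_pow_of_unique_prime_dvd Nat.card_pos.ne' fun {q} hq hdvd => ?_⟩
  by_contra hne
  have : Fact q.Prime := ⟨hq⟩
  obtain ⟨x, hx⟩ := exists_prime_addOrderOf_dvd_card' q hdvd
  have h0 := h q hq hne x (by rw [← hx]; exact addOrderOf_nsmul_eq_zero x)
  rw [h0, addOrderOf_zero] at hx
  exact hq.one_lt.ne hx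

/-- The quotient by the p-primary part has no q-torsion for q ≠ ℓ: if p^k·q·a = 0 with q ≠ p, then
p^k·a is q-torsion and hence 0. -/
theorem card_eq_card_primaryComponent_mul_pow {A : Type*} [AddCommGroup A] [Finite A] {ℓ p : ℕ}
    (hp : p.Prime)
    (h : ∀ q : ℕ, q.Prime → q ≠ p → q ≠ ℓ →
      Nat.card (AddCommGroup.primaryComponent A q) = 1) :
    ∃ n : ℕ, Nat.card A = Nat.card (AddCommGroup.primaryComponent A p) * ℓ ^ n := by
  set B := AddCommGroup.primaryComponent A p
  have key : ∀ q : ℕ, q.Prime → q ≠ ℓ → ∀ x : A ⧸ B, q • x = 0 → x = 0 := by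
    intro q hq hqℓ x hx
    obtain ⟨a, rfl⟩ := QuotientAddGroup.mk_surjective x
    rw [← QuotientAddGroup.mk_nsmul, QuotientAddGroup.eq_zero_iff] at hx
    rw [QuotientAddGroup.eq_zero_iff]
    obtain ⟨k, hk⟩ := AddCommGroup.mem_primaryComponent.1 hx
    by_cases hqp : q = p
    · subst hqp
      exact AddCommGroup.mem_primaryComponent.2 ⟨k + 1, by rw [pow_succ, mul_nsmul', hk]⟩
    · have h1 : p ^ k • a ∈ AddCommGroup.primaryComponent A q :=
        AddCommGroup.mem_primaryComponent.2 ⟨1, by rw [pow_one, ← mul_nsmul, mul_nsmul', hk]⟩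
      have := (Nat.card_eq_one_iff_unique.1 (h q hq hqp hqℓ)).1
      refine AddCommGroup.mem_primaryComponent.2 ⟨k, congrArg Subtype.val (Subsingleton.elim
        (⟨_, h1⟩ : AddCommGroup.primaryComponent A q) 0)⟩
  obtain ⟨n, hn⟩ := exists_card_eq_pow_of_forall_prime key
  exact ⟨n, by rw [AddSubgroup.card_eq_card_quotient_mul_card_addSubgroup B, hn, mul_comm]⟩

end Card

end ArtinBSD


namespace ArtinBSD

/-! ### Heights of rational numbers in number fields -/

section RationalHeight

open NumberField Height

theorem iSup_fin_two (f : Fin 2 → ℝ) : ⨆ i, f i = max (f 0) (f 1) := by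
  refine le_antisymm (ciSup_le fun i => ?_) (max_le ?_ ?_)
  · fin_cases i
    · exact le_max_left _ _
    · exact le_max_right _ _
  · exact le_ciSup (Set.finite_range f).bddAbove 0
  · exact le_ciSup (Set.finite_range f).bddAbove 1

theorem FinitePlace.apply_intCast_le_one {K : Type*} [Field K] [NumberField K] (v : FinitePlace K)
    (n : ℤ) : v (n : K) ≤ 1 := by
  rw [← NumberField.FinitePlace.norm_embedding_eq, FinitePlace.norm_embedding]
  exact HeightOneSpectrum.adicAbv_intCast_le_one K _ n

/-- In the coprime coordinates [num : den] the finite places contribute nothing. Each infinite place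
contributes the same maximum, and the local degrees add up to [K : ℚ]. -/
theorem logHeight₁_ratCast {K : Type*} [Field K] [NumberField K] (r : ℚ) :
    logHeight₁ (r : K) = Module.finrank ℚ K * Real.log (max ‖r.num‖ ‖(r.den : ℤ)‖) := by
  have hr : (r : K) = ((r.num : ℤ) : K) / ((r.den : ℤ) : K) := by
    rw [Rat.cast_def, Int.cast_natCast]
  have hden : ((r.den : ℤ) : K) ≠ 0 := by simp
  have hne : (![((r.num : ℤ) : K), ((r.den : ℤ) : K)] : Fin 2 → K) ≠ 0 := fun h =>
    hden (congrFun h 1)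
  rw [hr, logHeight₁_div_eq_logHeight, logHeight_eq_log_mulHeight, NumberField.mulHeight_eq hne]
  have hfin : ∀ v : FinitePlace K,
      ⨆ i, v ((![((r.num : ℤ) : K), ((r.den : ℤ) : K)] : Fin 2 → K) i) = 1 := fun v => by
    rw [iSup_fin_two]
    refine le_antisymm (max_le (FinitePlace.apply_intCast_le_one v _)
      (FinitePlace.apply_intCast_le_one v _)) ?_
    obtain ⟨a, b, hab⟩ := Int.isCoprime_iff_gcd_eq_one.2
      (show Int.gcd r.num (r.den : ℤ) = 1 from r.reduced)
    have h1 : (1 : K) = (a : K) * (r.num : ℤ) + (b : K) * ((r.den : ℤ) : K) := by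
      rw [← Int.cast_mul, ← Int.cast_mul, ← Int.cast_add, hab, Int.cast_one]
    calc (1 : ℝ) = v (1 : K) := (map_one v).symm
      _ ≤ max (v ((a : K) * (r.num : ℤ))) (v ((b : K) * ((r.den : ℤ) : K))) := by
        rw [h1]; exact NumberField.FinitePlace.add_le v _ _
      _ ≤ _ := by
        refine max_le_max ?_ ?_
        · rw [map_mul]
          exact mul_le_of_le_one_left (apply_nonneg v _) (FinitePlace.apply_intCast_le_one v _)
        · rw [map_mul]
          exact mul_le_of_le_one_left (apply_nonneg v _) (FinitePlace.apply_intCast_le_one v _)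
  have hinf : ∀ v : InfinitePlace K,
      ⨆ i, v ((![((r.num : ℤ) : K), ((r.den : ℤ) : K)] : Fin 2 → K) i) =
        max ‖r.num‖ ‖(r.den : ℤ)‖ := fun v => by
    rw [iSup_fin_two]
    exact congrArg₂ max (InfinitePlace.map_intCast v _) (InfinitePlace.map_intCast v _)
  rw [finprod_eq_one_of_forall_eq_one hfin, mul_one]
  simp_rw [hinf]
  rw [Finset.prod_pow_eq_pow_sum, InfinitePlace.sum_mult_eq, Real.log_pow]

theorem logHeight₁_algebraMap {K : Type*} [Field K] [NumberField K] [Algebra ℚ K] (r : ℚ) :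
    logHeight₁ (algebraMap ℚ K r) = Module.finrank ℚ K * logHeight₁ r := by
  have h := logHeight₁_ratCast (K := ℚ) r
  rw [Module.finrank_self, Nat.cast_one, one_mul, Rat.cast_id] at h
  rw [eq_ratCast, h]
  convert logHeight₁_ratCast (K := K) r using 3
  exact congrArg (fun i : Algebra ℚ K => @Module.finrank ℚ K _ _ i.toModule)
    (Subsingleton.elim _ _)

end RationalHeight

/-! ### Convergence of the Néron–Tate height -/

section Convergence

open Height

variable {K : Type*} [Field K] [NumberField K]

/-- The coordinate x(2P) is the value of the map `addSubMap` at the symmetric square of (x, 1). The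
symmetric square and `addSubMap` each double the height up to a bounded error. -/
theorem exists_abs_naiveHeight_two_nsmul_sub_le (W : WeierstrassCurve K) [W.IsElliptic] :
    ∃ C, ∀ P : Points W, |naiveHeight W (2 • P) - 4 * naiveHeight W P| ≤ C := by
  classical
  obtain ⟨C₁, hC₁⟩ := W.abs_logHeight_addSubMap_sub_two_mul_logHeight_le
  obtain ⟨C₂, hC₂⟩ := abs_logHeight_sym2_sub_le K
  have key : ∀ (x y : K) (h : W.toAffine.Nonsingular x y),
      naiveHeight W (2 • (.some x y h : W.toAffine.Point) : Points W) =
        logHeight (fun i => (W.addSubMap i).eval ![x * x, x * 1 + 1 * x, 1 * 1]) := by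
    intro x y h
    have heq := (W.toAffine.equation_iff x y).1 h.1
    have hev : (fun i => (W.addSubMap i).eval ![x * x, x * 1 + 1 * x, 1 * 1]) =
        ![x ^ 4 - W.b₄ * x ^ 2 - 2 * W.b₆ * x - W.b₈,
          4 * x ^ 3 + W.b₂ * x ^ 2 + 2 * W.b₄ * x + W.b₆, 0] := by
      ext i
      fin_cases i <;> simp [WeierstrassCurve.addSubMap] <;> ring
    have hψ : 4 * x ^ 3 + W.b₂ * x ^ 2 + 2 * W.b₄ * x + W.b₆ =
        (y - W.toAffine.negY x y) ^ 2 := by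
      simp only [WeierstrassCurve.Affine.negY, WeierstrassCurve.b₂, WeierstrassCurve.b₄,
        WeierstrassCurve.b₆]
      linear_combination -4 * heq
    rw [hev, logHeight_cons_cons_cons_zero, hψ]
    have h2 : (2 • (.some x y h : W.toAffine.Point) : W.toAffine.Point) =
      .some x y h + .some x y h := two_nsmul _
    -- For a point of order two the denominator vanishes, and the height 0 of [∗ : 0] matches that
    -- of the point at infinity.
    by_cases hy : y = W.toAffine.negY x y
    · rw [← hy, sub_self, zero_pow two_ne_zero, logHeight_cons_cons_zero,
        logHeight_eq_zero_of_subsingleton]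
      have h3 : (2 • (.some x y h : W.toAffine.Point) : W.toAffine.Point) = .zero :=
        h2.trans (WeierstrassCurve.Affine.Point.add_self_of_Y_eq hy)
      exact congrArg (naiveHeight W) h3
    · have h3 : (2 • (.some x y h : W.toAffine.Point) : W.toAffine.Point) =
          .some _ _ (WeierstrassCurve.Affine.nonsingular_add h h fun hxy => hy hxy.right) :=
        h2.trans (WeierstrassCurve.Affine.Point.add_self_of_Y_ne hy)
      refine (congrArg (naiveHeight W) h3).trans ?_
      change logHeight₁ _ = _
      have hy' : y - W.toAffine.negY x y ≠ 0 := sub_ne_zero.2 hy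
      rw [← logHeight₁_div_eq_logHeight]
      congr 1
      rw [WeierstrassCurve.Affine.slope_of_Y_ne rfl hy, WeierstrassCurve.Affine.addX,
        eq_div_iff (pow_ne_zero 2 hy')]
      field_simp
      simp only [WeierstrassCurve.Affine.negY, WeierstrassCurve.b₄, WeierstrassCurve.b₆,
        WeierstrassCurve.b₈]
      linear_combination (-W.a₁ ^ 2 - 4 * W.a₂ - 8 * x) * heq
  refine ⟨|C₁| + 2 * |C₂|, fun P => ?_⟩
  cases P with
  | zero =>
    have h0 : naiveHeight W (2 • (.zero : W.toAffine.Point) : Points W) = 0 :=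
      congrArg (naiveHeight W) (nsmul_zero 2)
    have h1 : naiveHeight W (.zero : W.toAffine.Point) = 0 := rfl
    refine (congrArg abs (congrArg₂ (· - ·) h0 (congrArg (4 * ·) h1))).trans_le ?_
    simp only [mul_zero, sub_zero, abs_zero]
    positivity
  | some x y h =>
    have h1 := hC₁ ![x * x, x * 1 + 1 * x, 1 * 1]
    have hne : (![x, 1] : Fin 2 → K) ≠ 0 := fun h => one_ne_zero (congrFun h 1)
    have h2 := hC₂ hne hne
    rw [← logHeight₁_eq_logHeight] at h2
    have h3 : naiveHeight W (.some x y h : W.toAffine.Point) = logHeight₁ x := rfl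
    refine (congrArg abs (congrArg₂ (· - ·) (key x y h) (congrArg (4 * ·) h3))).trans_le ?_
    have h4 := h1.trans (le_abs_self C₁)
    have h5 := h2.trans (le_abs_self C₂)
    rw [abs_le] at h4 h5 ⊢
    constructor <;> linarith [h4.1, h4.2, h5.1, h5.2]

/-- Tate's telescoping argument: consecutive terms differ by at most a constant times 4⁻ⁿ. Without
convergence, `limUnder` would be arbitrary and could not be scaled. -/
theorem tendsto_naiveHeight (W : WeierstrassCurve K) [W.IsElliptic] (P : Points W) :
    ∃ a, Filter.Tendsto (fun n : ℕ => naiveHeight W (2 ^ n • P) / 4 ^ n) Filter.atTop (𝓝 a) := by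
  obtain ⟨C, hC⟩ := exists_abs_naiveHeight_two_nsmul_sub_le W
  refine cauchySeq_tendsto_of_complete (cauchySeq_of_le_geometric (1 / 4) (C / 4) (by norm_num)
    fun n => ?_)
  have h1 := hC (2 ^ n • P)
  rw [← mul_nsmul', ← pow_succ'] at h1
  rw [dist_comm, Real.dist_eq]
  have h2 : naiveHeight W (2 ^ (n + 1) • P) / 4 ^ (n + 1) - naiveHeight W (2 ^ n • P) / 4 ^ n =
      (naiveHeight W (2 ^ (n + 1) • P) - 4 * naiveHeight W (2 ^ n • P)) / 4 ^ (n + 1) := by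
    rw [pow_succ (4 : ℝ)]
    field_simp
  rw [h2, abs_div, abs_of_pos (show (0 : ℝ) < 4 ^ (n + 1) by positivity), div_pow, one_pow,
    div_mul_div_comm, mul_one, ← pow_succ']
  gcongr

end Convergence

/-! ### The regulator under an isomorphism scaling heights -/

section Regulator

variable {K L : Type*} [Field K] [NumberField K] [Field L] [NumberField L]
  {W : WeierstrassCurve K} {W' : WeierstrassCurve L}

theorem IsMordellWeilBasis.comp (e : Points W ≃+ Points W') {r : ℕ} {P : Fin r → Points W}
    (hP : IsMordellWeilBasis W P) : IsMordellWeilBasis W' fun i => e (P i) := by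
  intro Q
  have h : ∀ n : Fin r → ℤ, Q - ∑ i, n i • e (P i) ∈ AddCommGroup.torsion (Points W') ↔
      e.symm Q - ∑ i, n i • P i ∈ AddCommGroup.torsion (Points W) := fun n => by
    have h1 : Q - ∑ i, n i • e (P i) = e (e.symm Q - ∑ i, n i • P i) := by
      rw [map_sub, map_sum, AddEquiv.apply_symm_apply]
      simp only [map_zsmul]
    rw [h1]
    exact e.injective.isOfFinAddOrder_iff (f := e.toAddMonoidHom)
  simp only [h]
  exact hP (e.symm Q)

theorem IsMordellWeilBasis.rank_eq {r s : ℕ} {P : Fin r → Points W} {Q : Fin s → Points W}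
    (hP : IsMordellWeilBasis W P) (hQ : IsMordellWeilBasis W Q) : r = s := by
  have key : ∀ {r : ℕ} {P : Fin r → Points W}, IsMordellWeilBasis W P →
      Module.finrank ℤ (Points W ⧸ AddCommGroup.torsion (Points W)) = r := by
    intro r P hP
    let f : (Fin r → ℤ) →ₗ[ℤ] (Points W ⧸ AddCommGroup.torsion (Points W)) :=
      ((QuotientAddGroup.mk' (AddCommGroup.torsion (Points W))).toIntLinearMap).comp
        (Fintype.linearCombination ℤ P)
    have hf : ∀ (n : Fin r → ℤ) (R : Points W), f n = QuotientAddGroup.mk R ↔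
        R - ∑ i, n i • P i ∈ AddCommGroup.torsion (Points W) := fun n R => by
      rw [eq_comm, ← sub_eq_zero]
      change (QuotientAddGroup.mk R : Points W ⧸ AddCommGroup.torsion (Points W)) -
        QuotientAddGroup.mk (Fintype.linearCombination ℤ P n) = 0 ↔ _
      rw [← QuotientAddGroup.mk_sub, QuotientAddGroup.eq_zero_iff,
        Fintype.linearCombination_apply]
    have hbij : Function.Bijective f := by
      rw [Function.bijective_iff_existsUnique]
      intro b
      obtain ⟨R, rfl⟩ := QuotientAddGroup.mk_surjective b
      simp only [hf]
      exact hP R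
    rw [← (LinearEquiv.ofBijective f hbij).finrank_eq, Module.finrank_fin_fun]
  rw [← key hP, ← key hQ]

theorem torsionOrder_eq (e : Points W ≃+ Points W') : torsionOrder W' = torsionOrder W := by
  refine (Nat.card_congr (e.toEquiv.subtypeEquiv fun P => ?_)).symm
  exact (e.injective.isOfFinAddOrder_iff (f := e.toAddMonoidHom)).symm

/-- The pairing is multiplied by d, so an r × r determinant is multiplied by d^r, with r the common
rank of all bases. -/
theorem exists_regulator_eq_pow_mul (e : Points W ≃+ Points W') {d : ℝ} (hd : 0 ≤ d)
    (h : ∀ P, canonicalHeight W' (e P) = d * canonicalHeight W P) :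
    ∃ r : ℕ, regulator W' = d ^ r * regulator W := by
  have hpair : ∀ P Q, heightPairing W' (e P) (e Q) = d * heightPairing W P Q := fun P Q => by
    simp only [heightPairing, ← map_add, h]
    ring
  by_cases hne : ∃ (r : ℕ) (P : Fin r → Points W), IsMordellWeilBasis W P
  · obtain ⟨r, P₀, hP₀⟩ := hne
    refine ⟨r, ?_⟩
    rw [regulator, regulator, ← smul_eq_mul, ← Real.sInf_smul_of_nonneg (pow_nonneg hd r)]
    congr 1
    have hdet : ∀ P : Fin r → Points W,
        |(Matrix.of fun i j => heightPairing W' (e (P i)) (e (P j))).det| =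
          d ^ r * |(Matrix.of fun i j => heightPairing W (P i) (P j)).det| := fun P => by
      have : (Matrix.of fun i j => heightPairing W' (e (P i)) (e (P j))) =
          d • Matrix.of fun i j => heightPairing W (P i) (P j) := by
        ext i j
        exact hpair _ _
      rw [this, Matrix.det_smul, Fintype.card_fin, abs_mul, abs_of_nonneg (pow_nonneg hd r)]
    ext x
    constructor
    · rintro ⟨s, Q, hQ, rfl⟩
      have hP : IsMordellWeilBasis W fun i => e.symm (Q i) := hQ.comp e.symm
      obtain rfl := hP₀.rank_eq hP
      refine Set.mem_smul_set.2 ⟨_, ⟨_, _, hP, rfl⟩, ?_⟩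
      rw [smul_eq_mul, ← hdet]
      simp
    · intro hx
      obtain ⟨_, ⟨s, P, hP, rfl⟩, rfl⟩ := Set.mem_smul_set.1 hx
      obtain rfl := hP₀.rank_eq hP
      exact ⟨_, _, hP.comp e, by rw [hdet, smul_eq_mul]⟩
  -- If no basis exists, neither curve has one, and both regulators are the infimum of the empty
  -- set, which is 0.
  · refine ⟨0, ?_⟩
    have h1 : {x | ∃ (r : ℕ) (P : Fin r → Points W), IsMordellWeilBasis W P ∧
        x = |(Matrix.of fun i j => heightPairing W (P i) (P j)).det|} = ∅ := by
      ext x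
      simp only [Set.mem_ofPred_eq, Set.mem_empty_iff_false, iff_false]
      rintro ⟨r, P, hP, -⟩
      exact hne ⟨r, P, hP⟩
    have h2 : {x | ∃ (r : ℕ) (P : Fin r → Points W'), IsMordellWeilBasis W' P ∧
        x = |(Matrix.of fun i j => heightPairing W' (P i) (P j)).det|} = ∅ := by
      ext x
      simp only [Set.mem_ofPred_eq, Set.mem_empty_iff_false, iff_false]
      rintro ⟨r, P, hP, -⟩
      exact hne ⟨r, _, hP.comp e.symm⟩
    rw [regulator, regulator, h1, h2, Real.sInf_empty, mul_zero]

end Regulator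

/-! ### Heights, torsion and regulators from ℚ to F. -/

section BaseChange

variable {F : Type} [Field F] [NumberField F] [Algebra ℚ F] (E : WeierstrassCurve ℚ)

theorem naiveHeight_ptsMap (P : Pts E ℚ) :
    naiveHeight (E.baseChange F) (ptsMap E (Algebra.ofId ℚ F) P) =
      Module.finrank ℚ F * naiveHeight (E.baseChange ℚ) P := by
  cases P with
  | zero => exact (mul_zero _).symm
  | some x y h => exact logHeight₁_algebraMap x

theorem canonicalHeight_ptsMap [E.IsElliptic] (P : Pts E ℚ) :
    canonicalHeight (E.baseChange F) (ptsMap E (Algebra.ofId ℚ F) P) =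
      Module.finrank ℚ F * canonicalHeight (E.baseChange ℚ) P := by
  have : (E.baseChange ℚ).IsElliptic := inferInstanceAs ((E.map (algebraMap ℚ ℚ)).IsElliptic)
  obtain ⟨a, ha⟩ := tendsto_naiveHeight (E.baseChange ℚ) P
  have h1 : (fun n : ℕ => naiveHeight (E.baseChange F)
      (2 ^ n • ptsMap E (Algebra.ofId ℚ F) P) / 4 ^ n) =
      fun n : ℕ => (Module.finrank ℚ F : ℝ) *
        (naiveHeight (E.baseChange ℚ) (2 ^ n • P) / 4 ^ n) := by
    funext n
    rw [← map_nsmul, naiveHeight_ptsMap, mul_div_assoc]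
  rw [canonicalHeight, canonicalHeight, h1, (ha.const_mul _).limUnder_eq, ha.limUnder_eq]
  ring

/-- The isomorphism `E(ℚ) ≃ E(F)` when there are no new points over `F`. -/
noncomputable def pointsEquiv {E : WeierstrassCurve ℚ} (hpts : NoNewPoints E F) :
    Points (E.baseChange ℚ) ≃+ Points (E.baseChange F) :=
  AddEquiv.ofBijective (ptsMap E (Algebra.ofId ℚ F))
    ⟨by classical exact WeierstrassCurve.Affine.Point.map_injective (W' := E) (Algebra.ofId ℚ F), hpts⟩

theorem torsionOrder_baseChange {E : WeierstrassCurve ℚ} (hpts : NoNewPoints E F) :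
    torsionOrder (E.baseChange F) = torsionOrder (E.baseChange ℚ) :=
  torsionOrder_eq (pointsEquiv hpts)

theorem exists_regulator_baseChange {E : WeierstrassCurve ℚ} [E.IsElliptic]
    (hpts : NoNewPoints E F) : ∃ r : ℕ, regulator (E.baseChange F) =
      (Module.finrank ℚ F : ℝ) ^ r * regulator (E.baseChange ℚ) :=
  exists_regulator_eq_pow_mul (pointsEquiv hpts) (Nat.cast_nonneg _) (canonicalHeight_ptsMap E)

end BaseChange

end ArtinBSD

/-! ### Comparison of the two computations of the BSD ratio. -/

open scoped NumberField in
open ArtinBSD in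
theorem mainTheorem5 (ℓ p : ℕ) [Fact ℓ.Prime] [Fact p.Prime]
    (hp : ∀ P : Ideal (𝓞 (CyclotomicField ℓ ℚ)), P.IsPrime → P.LiesOver (Ideal.span {(p : ℤ)}) →
      ¬ P.IsPrincipal ∧ P.inertiaDeg ℤ = 2)
    (E : WeierstrassCurve ℚ) [E.IsElliptic] (hconj : ArtinBSDConjecture E)
    (hss : IsSemistable E) (hisog : HasNoIsogenies E)
    (hsha : Nat.card (AddSubgroup.torsionBy (ShaOver E ℚ) (p : ℤ)) = 1)
    (htam : ∀ v, tamagawa E v = 1)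
    (F : IntermediateField ℚ QBar) [NumberField F] [IsGalois ℚ F] [IsCyclic Gal(F/ℚ)]
    (hdeg : Module.finrank ℚ F = ℓ) (hpts : NoNewPoints E F)
    (hshaF : Nat.card (AddCommGroup.primaryComponent (ShaOver E F) p) = p ^ 2) :
    ∃ q : ℕ, q.Prime ∧ q ≠ p ∧ q ≠ ℓ ∧
      Nat.card (AddCommGroup.primaryComponent (ShaOver E F) q) ≠ 1 := by
  by_contra! hno
  obtain ⟨B, hB⟩ := hconj
  have hcyc : IsCyclotomicExtension {ℓ} ℚ (CyclotomicField ℓ ℚ) :=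
    CyclotomicField.isCyclotomicExtension ℓ ℚ
  have hℓ : ℓ.Prime := Fact.out
  have hℓ2 : ℓ ≠ 2 := ne_two_of_not_isPrincipal hp
  have hΔ : E.Δ ≠ 0 := E.isUnit_Δ.ne_zero
  have hfinQ : Finite (ShaOver E ℚ) := hB.finite_sha ℚ
  have hfinF : Finite (ShaOver E F) := hB.finite_sha F
  -- The values of the invariant are units. This excludes a zero regulator, a zero torsion order and
  -- a zero (infinite) Tamagawa index.
  have hne : ∀ (K : Type) [Field K] [NumberField K] [Algebra ℚ K] [Algebra K QBar],
      bsdQuotient E K ≠ 0 := fun K _ _ _ _ h => by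
    have h1 := hB.bsd_ind K
    rw [h] at h1
    exact (B (indTrivial K)).ne_zero (h1.symm.trans Complex.ofReal_zero)
  obtain ⟨c, hc⟩ : ∃ c : ℕ, Nat.card (ShaOver E ℚ) = ℓ ^ c := by
    refine exists_card_eq_pow_of_forall_prime fun q hq hqℓ x hx => ?_
    by_cases hqp : q = p
    · subst hqp
      have := (Nat.card_eq_one_iff_unique.1 hsha).1
      have hmem : x ∈ AddSubgroup.torsionBy (ShaOver E ℚ) (q : ℤ) := by
        rw [← natCast_zsmul] at hx
        exact hx
      exact congrArg Subtype.val
        (Subsingleton.elim (⟨x, hmem⟩ : AddSubgroup.torsionBy (ShaOver E ℚ) (q : ℤ)) 0)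
    · exact sha_eq_zero_of_nsmul_eq_zero E hℓ hq hqℓ F hdeg (hno q hq hqp hqℓ) x hx
  obtain ⟨b, hb⟩ := card_eq_card_primaryComponent_mul_pow (A := ShaOver E F) (ℓ := ℓ)
    (Fact.out : p.Prime) hno
  rw [hshaF] at hb
  obtain ⟨r, hr⟩ := exists_regulator_baseChange (F := F) hpts
  rw [hdeg] at hr
  obtain ⟨β, hβ⟩ := exists_bsdQuotient_eq_mul_norm hB hss hisog F hdeg hpts
  have hcard : Nat.card Gal(F/ℚ) = ℓ := by rw [IsGalois.card_aut_eq_finrank, hdeg]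
  have hneF := hne F
  have hneQ := hne ℚ
  unfold bsdQuotient at hβ hneF hneQ
  rw [torsionOrder_baseChange hpts] at hβ hneF
  rw [localFactor_rat E hΔ hss htam, mul_one] at hβ hneQ
  obtain ⟨n, hn⟩ := (localFactor_eq_zero_or_pow hℓ2 hcard E hΔ hss htam).resolve_left
    fun h => hneF (by rw [h, mul_zero, zero_div])
  rw [hn, hr, hb, hc] at hβ
  have hreg : regulator (E.baseChange ℚ) ≠ 0 := fun h => hneQ (by rw [h, zero_mul, zero_div])
  have htor : (torsionOrder (E.baseChange ℚ) : ℝ) ≠ 0 := fun h =>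
    hneQ (by rw [h, zero_pow two_ne_zero, div_zero])
  -- The exponents come from Ш_{E/ℚ} (c), the scaling of the regulator (r), the ℓ-part of Ш_{E/F}
  -- (b) and the Tamagawa numbers over F (n); c stays on the left to avoid division.
  have hR : (ℓ : ℝ) ^ c * (Algebra.norm ℤ β : ℝ) = (ℓ : ℝ) ^ (r + b + n) * (p : ℝ) ^ 2 := by
    push_cast at hβ
    field_simp at hβ
    rw [pow_add, pow_add]
    linear_combination -hβ
  have hZ : (ℓ : ℤ) ^ c * Algebra.norm ℤ β = (ℓ : ℤ) ^ (r + b + n) * (p : ℤ) ^ 2 := by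
    exact_mod_cast hR
  refine pow_mul_absNorm_ne (ℓ := ℓ) hp β (r + b + n) c ?_
  rw [Ideal.absNorm_span_singleton]
  have hN := congrArg Int.natAbs hZ
  simpa only [Int.natAbs_mul, Int.natAbs_pow, Int.natAbs_natCast] using hN
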